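/- Let $\mathbb K=\mathbb Q[\epsilon][[\hbar]]$, $q=e^{\epsilon\hbar}\in\mathbb K$, $[m]=\frac{1-q^m}{1-q}=1+q+\dots+q^{m-1}$ and $[m]!=[1][2]\cdots[m]$ (a unit of $\mathbb K$). All algebras are $\hbar$-adically complete and separated $\mathbb K$-algebras, and tensor products are over $\mathbb K$ and $\hbar$-adically completed. Let $\mathbb D$ be the $\hbar$-adically complete $\mathbb K$-algebra topologically generated by $\mathbf y,\mathbf b,\mathbf a,\mathbf x$ with the relations $$\mathbf x\mathbf y=q\,\mathbf y\mathbf x+\frac{1-\mathbf A\mathbf B}{\hbar},\quad [\mathbf a,\mathbf x]=\mathbf x,\quad [\mathbf b,\mathbf x]=\epsilon\mathbf x,\quad [\mathbf a,\mathbf y]=-\mathbf y,\quad [\mathbf b,\mathbf y]=-\epsilon\mathbf y,\quad [\mathbf a,\mathbf b]=0,$$ where $\mathbf A=e^{-\epsilon\hbar\mathbf a}$ and $\mathbf B=e^{-\hbar\mathbf b}$. For a topological Hopf algebra $H$ with coproduct $\Delta$, counit $\varepsilon$ and antipode $S$, an invertible $\mathbf R=\sum r_i\otimes s_i\in H\otimes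 H$ is a universal $R$-matrix (and $H$ is quasi-triangular) if $(\Delta\otimes\mathrm{id})\mathbf R=\mathbf R_{13}\mathbf R_{23}$, $(\mathrm{id}\otimes\Delta)\mathbf R=\mathbf R_{13}\mathbf R_{12}$ and $\Delta^{op}(h)\mathbf R=\mathbf R\Delta(h)$ for all $h\in H$. Its Drinfeld element is $\mathbf u=\sum S(s_i)r_i$. A ribbon element is a central $\mathbf v\in H$ with $\mathbf v^2=\mathbf uS(\mathbf u)$, $\Delta(\mathbf v)=\mathbf R^{-1}\mathbf R_{21}^{-1}(\mathbf v\otimes\mathbf v)$, $S(\mathbf v)=\mathbf v$ and $\varepsilon(\mathbf v)=1$. A spinner is an invertible $\mathbf C\in H$ with $\mathbf C^{-1}\mathbf u=S(\mathbf u)\mathbf C$, $\varepsilon(\mathbf C)=1$, $\Delta(\mathbf C)=\mathbf C\otimes\mathbf C$, $S(\mathbf C)=\mathbf C^{-1}$ and $\mathbf Ch\mathbf C^{-1}=S^2(h)$ for all $h\in H$. **Theorem.** 1. The ordered monomials give a bijection $\mathbb Q[\epsilon,y,b,a,x][[\hbar]]\to\mathbb D$, $y^kb^\ell a^mx^n\mapsto\mathbf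 y^k\mathbf b^\ell\mathbf a^m\mathbf x^n$ (extended to series in $\hbar$). 2. $\mathbb D$ has a topological Hopf algebra structure over $\mathbb K$ with $$\Delta(\mathbf y)=1\otimes\mathbf y+\mathbf y\otimes\mathbf B,\quad \Delta(\mathbf b)=\mathbf b\otimes1+1\otimes\mathbf b,\quad \Delta(\mathbf a)=\mathbf a\otimes1+1\otimes\mathbf a,\quad \Delta(\mathbf x)=1\otimes\mathbf x+\mathbf x\otimes\mathbf A,$$ $$S(\mathbf y)=-\mathbf y\mathbf B^{-1},\quad S(\mathbf b)=-\mathbf b,\quad S(\mathbf a)=-\mathbf a,\quad S(\mathbf x)=-\mathbf x\mathbf A^{-1},\quad \varepsilon(\mathbf y)=\varepsilon(\mathbf b)=\varepsilon(\mathbf a)=\varepsilon(\mathbf x)=0.$$ 3. With this structure $\mathbb D$ is a ribbon Hopf algebra: the element $$\mathbf R=\sum_{m,n=0}^\infty\frac{\hbar^{m+n}}{[m]!\,n!}\,\mathbf y^m\mathbf b^n\otimes\mathbf a^n\mathbf x^m$$ is invertible and is a universal $R$-matrix; its Drinfeld element satisfies $\mathbf u=\mathbf A\mathbf B\,S(\mathbf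 u)$; there is exactly one element $\mathbf C=(\mathbf A\mathbf B)^{1/2}$ of $\mathbb D$ with $\mathbf C^2=\mathbf A\mathbf B$ and $\mathbf C\equiv1$ modulo $\hbar\mathbb D$; this $\mathbf C$ is invertible and a spinner, and $\mathbf v=\mathbf C^{-1}\mathbf u$ is a ribbon element. -/

import Mathlib

open scoped TensorProduct Nat

namespace QD

noncomputable section

/-! ### The ground ring `K = ℚ[ε]⟦ħ⟧` -/

/-- The ground ring `K = ℚ[ε]⟦ħ⟧`. -/
abbrev K : Type := PowerSeries (Polynomial ℚ)

/-- The formal variable `ħ`. -/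
def hbar : K := PowerSeries.X

/-- The parameter `ε`. -/
def eps : K := PowerSeries.C (Polynomial.X : Polynomial ℚ)

/-- A rational number as a scalar. -/
def rat (r : ℚ) : K := PowerSeries.C (Polynomial.C r)

/-- `q = e^{εħ} = ∑ₙ (εⁿ / n!) ħⁿ`. -/
def q : K := PowerSeries.mk fun n => Polynomial.C (1 / (n ! : ℚ)) * Polynomial.X ^ n

/-- The `q`-integer `[m] = (1 - q^m) / (1 - q) = 1 + q + ⋯ + q^(m-1)`. -/
def qInt (m : ℕ) : K := ∑ i ∈ Finset.range m, q ^ i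

/-- The `q`-factorial `[m]! = [1][2]⋯[m]`. -/
def qFact (m : ℕ) : K := ∏ i ∈ Finset.range m, qInt (i + 1)

theorem isUnit_qFact (m : ℕ) : IsUnit (qFact m) := by
  have hq : PowerSeries.constantCoeff q = 1 := by
    rw [← PowerSeries.coeff_zero_eq_constantCoeff_apply]
    simp [q]
  unfold qFact
  refine IsUnit.prod_iff.2 fun i _ => ?_
  rw [PowerSeries.isUnit_iff_constantCoeff]
  have h : PowerSeries.constantCoeff (qInt (i + 1)) = Polynomial.C ((i : ℚ) + 1) := by
    simp [qInt, map_sum, map_pow, hq]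
  rw [h]
  exact Polynomial.isUnit_C.2 (IsUnit.mk0 _ (by positivity))

/-! ### The `ħ`-adic completion of a `K`-algebra -/

section Completion

variable (T : Type*) [Ring T] [Algebra K T]

/-- The two-sided ideal `ħⁿ T`. -/
def hIdeal (n : ℕ) : Ideal T where
  carrier := Set.range fun s : T => hbar ^ n • s
  add_mem' := by
    rintro _ _ ⟨s, rfl⟩ ⟨t, rfl⟩
    exact ⟨s + t, smul_add _ _ _⟩
  zero_mem' := ⟨0, smul_zero _⟩
  smul_mem' := by
    rintro c _ ⟨s, rfl⟩
    exact ⟨c * s, (mul_smul_comm _ _ _).symm⟩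

instance (n : ℕ) : (hIdeal T n).IsTwoSided where
  mul_mem_of_left := by
    rintro _ c ⟨s, rfl⟩
    exact ⟨s * c, (smul_mul_assoc _ _ _).symm⟩

theorem hIdeal_succ_le (n : ℕ) : hIdeal T (n + 1) ≤ hIdeal T n := by
  rintro _ ⟨s, rfl⟩
  exact ⟨hbar • s, by simp only [smul_smul, pow_succ]⟩

/-- The compatible families in `∏ₙ T / ħⁿ T`. -/
def complSubalgebra : Subalgebra K (∀ n, T ⧸ hIdeal T n) where
  carrier := {f | ∀ n, Ideal.Quotient.factorₐ K (hIdeal_succ_le T n) (f (n + 1)) = f n}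
  mul_mem' := by
    intro f g hf hg n
    simp only [Pi.mul_apply, map_mul]
    rw [hf n, hg n]
  add_mem' := by
    intro f g hf hg n
    simp only [Pi.add_apply, map_add]
    rw [hf n, hg n]
  algebraMap_mem' := by
    intro r n
    simp only [Pi.algebraMap_apply, AlgHom.commutes]

/-- The `ħ`-adic completion `lim T / ħⁿ T`. -/
def Compl : Type _ := complSubalgebra T

instance : Ring (Compl T) := inferInstanceAs (Ring (complSubalgebra T))

instance : Algebra K (Compl T) := inferInstanceAs (Algebra K (complSubalgebra T))

variable {T}

/-- The projection of the completion to `T / ħⁿ T`. -/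
def proj (n : ℕ) : Compl T →ₐ[K] T ⧸ hIdeal T n :=
  (Pi.evalAlgHom K (fun n => T ⧸ hIdeal T n) n).comp (complSubalgebra T).val

theorem factor_proj (n : ℕ) (s : Compl T) :
    Ideal.Quotient.factorₐ K (hIdeal_succ_le T n) (proj (n + 1) s) = proj n s :=
  s.2 n

theorem Compl.ext_proj {s t : Compl T} (h : ∀ n, proj n s = proj n t) : s = t :=
  Subtype.ext (funext h)

/-- The canonical map from an algebra to its completion. -/
def of : T →ₐ[K] Compl T :=
  (AlgHom.pi (R := K) (A := fun n => T ⧸ hIdeal T n) fun n => Ideal.Quotient.mkₐ K (hIdeal T n)).codRestrict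
    (complSubalgebra T) fun _ _ => rfl

theorem hbar_pow_smul_quot (n : ℕ) (s : T ⧸ hIdeal T n) : hbar ^ n • s = 0 := by
  obtain ⟨t, rfl⟩ := Ideal.Quotient.mk_surjective s
  exact Ideal.Quotient.eq_zero_iff_mem.2 ⟨t, rfl⟩

/-- The convergent series `∑ₖ ħᵏ cₖ` in a completed algebra. -/
def hsum (c : ℕ → Compl T) : Compl T :=
  ⟨fun n => ∑ k ∈ Finset.range n, hbar ^ k • proj n (c k), by
    intro n
    rw [map_sum, Finset.sum_range_succ]
    simp only [map_smul, factor_proj]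
    rw [hbar_pow_smul_quot, add_zero]⟩

theorem proj_hsum (c : ℕ → Compl T) (n : ℕ) :
    proj n (hsum c) = ∑ k ∈ Finset.range n, hbar ^ k • proj n (c k) :=
  rfl

theorem hsum_succ (c : ℕ → Compl T) : hsum c = c 0 + hbar • hsum fun k => c (k + 1) := by
  refine Compl.ext_proj fun n => ?_
  have h : ∑ k ∈ Finset.range n, hbar ^ k • proj n (c k)
      = ∑ k ∈ Finset.range (n + 1), hbar ^ k • proj n (c k) := by
    rw [Finset.sum_range_succ, hbar_pow_smul_quot, add_zero]
  rw [map_add, map_smul, proj_hsum, proj_hsum, h, Finset.sum_range_succ', Finset.smul_sum,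
    pow_zero, one_smul, add_comm]
  simp only [smul_smul, pow_succ']

/-- The exponential `e^{ħw} = ∑ₖ ħᵏ wᵏ / k!`. -/
def hexp (w : Compl T) : Compl T := hsum fun k => rat (1 / (k ! : ℚ)) • w ^ k

/-- The element `(1 - e^{ħw}) / ħ = -∑ₖ ħᵏ wᵏ⁺¹ / (k+1)!`. -/
def oneSubExpDiv (w : Compl T) : Compl T :=
  hsum fun k => -(rat (1 / ((k + 1) ! : ℚ)) • w ^ (k + 1))

theorem hbar_smul_oneSubExpDiv (w : Compl T) : hbar • oneSubExpDiv w = 1 - hexp w := by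
  have h1 : hexp w = 1 + hbar • hsum fun k => rat (1 / ((k + 1) ! : ℚ)) • w ^ (k + 1) := by
    rw [hexp, hsum_succ]
    simp [rat]
  have h2 : oneSubExpDiv w = -hsum fun k => rat (1 / ((k + 1) ! : ℚ)) • w ^ (k + 1) := by
    refine Compl.ext_proj fun n => ?_
    rw [oneSubExpDiv, map_neg, proj_hsum, proj_hsum]
    simp only [map_neg, smul_neg, Finset.sum_neg_distrib]
  rw [h1, h2, smul_neg]
  abel

variable {T' : Type*} [Ring T'] [Algebra K T']

theorem hIdeal_le_ker (f : T →ₗ[K] Compl T') (n : ℕ) :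
    (hIdeal T n).restrictScalars K ≤ LinearMap.ker ((proj n).toLinearMap ∘ₗ f) := by
  intro s hs
  obtain ⟨t, rfl⟩ : ∃ t : T, hbar ^ n • t = s := hs
  simp [hbar_pow_smul_quot]

/-- The map `T / ħⁿ T → T' / ħⁿ T'` induced by a `K`-linear map `T → T'^`. -/
def extendLevel (f : T →ₗ[K] Compl T') (n : ℕ) :
    (T ⧸ hIdeal T n) →ₗ[K] (T' ⧸ hIdeal T' n) :=
  ((hIdeal T n).restrictScalars K).liftQ ((proj n).toLinearMap ∘ₗ f) (hIdeal_le_ker f n) ∘ₗ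
    (Submodule.Quotient.restrictScalarsEquiv K (hIdeal T n)).symm.toLinearMap

theorem extendLevel_mk (f : T →ₗ[K] Compl T') (n : ℕ) (t : T) :
    extendLevel f n (Ideal.Quotient.mk (hIdeal T n) t) = proj n (f t) :=
  rfl

theorem factor_extendLevel (f : T →ₗ[K] Compl T') (n : ℕ) (s : Compl T) :
    Ideal.Quotient.factorₐ K (hIdeal_succ_le T' n) (extendLevel f (n + 1) (proj (n + 1) s)) =
      extendLevel f n (proj n s) := by
  obtain ⟨t, ht⟩ := Ideal.Quotient.mk_surjective (proj (n + 1) s)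
  have ht' : Ideal.Quotient.mk (hIdeal T n) t = proj n s := by
    rw [← factor_proj, ← ht]
    rfl
  rw [← ht, ← ht', extendLevel_mk, extendLevel_mk, factor_proj]

/-- The extension of a `K`-linear map `T → T'^` to the completion `T^`. -/
def extend (f : T →ₗ[K] Compl T') : Compl T →ₗ[K] Compl T' where
  toFun s := ⟨fun n => extendLevel f n (proj n s), fun n => factor_extendLevel f n s⟩
  map_add' s t := by
    refine Subtype.ext (funext fun n => ?_)
    simp only [map_add]
    rfl
  map_smul' r s := by
    refine Subtype.ext (funext fun n => ?_)
    simp only [map_smul]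
    rfl

theorem extend_of (f : T →ₗ[K] Compl T') (t : T) : extend f (of t) = f t :=
  Compl.ext_proj fun _ => rfl

/-- The map of completions induced by a `K`-linear map. -/
def complMap (f : T →ₗ[K] T') : Compl T →ₗ[K] Compl T' := extend (of.toLinearMap ∘ₗ f)

/-- For linear maps `f`, `g` into an algebra `C`, the linear map `m ⊗ n ↦ f m * g n`. -/
def mulLift {M N C : Type*} [AddCommGroup M] [Module K M] [AddCommGroup N] [Module K N]
    [Ring C] [Algebra K C] (f : M →ₗ[K] C) (g : N →ₗ[K] C) : M ⊗[K] N →ₗ[K] C :=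
  TensorProduct.lift ((LinearMap.mul K C).compl₁₂ f g)

end Completion

/-! ### Topological Hopf algebras -/

section Hopf

variable (H : Type*) [Ring H] [Algebra K H]

/-- The completed tensor square. -/
abbrev Ten2 : Type _ := Compl (H ⊗[K] H)

/-- The completed tensor cube. -/
abbrev Ten3 : Type _ := Compl ((H ⊗[K] H) ⊗[K] H)

variable {H}

/-- `a ⊗ b` as an element of the completed tensor square. -/
def ten (a b : H) : Ten2 H := of (a ⊗ₜ[K] b)

/-- `a ⊗ b ↦ b ⊗ a`. -/
def flip : Ten2 H →ₗ[K] Ten2 H := complMap (TensorProduct.comm K H H).toLinearMap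

/-- `a ⊗ b ↦ a ⊗ b ⊗ 1`. -/
def leg12 : Ten2 H →ₗ[K] Ten3 H :=
  complMap (Algebra.TensorProduct.includeLeft : H ⊗[K] H →ₐ[K] (H ⊗[K] H) ⊗[K] H).toLinearMap

/-- `a ⊗ b ↦ a ⊗ 1 ⊗ b`. -/
def leg13 : Ten2 H →ₗ[K] Ten3 H :=
  complMap (Algebra.TensorProduct.map
    (Algebra.TensorProduct.includeLeft : H →ₐ[K] H ⊗[K] H) (AlgHom.id K H)).toLinearMap

/-- `a ⊗ b ↦ 1 ⊗ a ⊗ b`. -/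
def leg23 : Ten2 H →ₗ[K] Ten3 H :=
  complMap (Algebra.TensorProduct.map
    (Algebra.TensorProduct.includeRight : H →ₐ[K] H ⊗[K] H) (AlgHom.id K H)).toLinearMap

/-- `a ↦ a ⊗ 1 ⊗ 1`. -/
def leg1 : H →ₗ[K] Ten3 H :=
  of.toLinearMap ∘ₗ
    (Algebra.TensorProduct.includeLeft : H ⊗[K] H →ₐ[K] (H ⊗[K] H) ⊗[K] H).toLinearMap ∘ₗ
    (Algebra.TensorProduct.includeLeft : H →ₐ[K] H ⊗[K] H).toLinearMap

/-- `a ↦ 1 ⊗ 1 ⊗ a`. -/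
def leg3 : H →ₗ[K] Ten3 H :=
  of.toLinearMap ∘ₗ
    (Algebra.TensorProduct.includeRight : H →ₐ[K] (H ⊗[K] H) ⊗[K] H).toLinearMap

/-- `Δ ⊗ id`, that is `a ⊗ b ↦ (Δ a ⊗ 1) (1 ⊗ 1 ⊗ b)`. -/
def comulId (Δ : H →ₗ[K] Ten2 H) : Ten2 H →ₗ[K] Ten3 H :=
  extend (mulLift (leg12 ∘ₗ Δ) leg3)

/-- `id ⊗ Δ`, that is `a ⊗ b ↦ (a ⊗ 1 ⊗ 1) (1 ⊗ Δ b)`. -/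
def idComul (Δ : H →ₗ[K] Ten2 H) : Ten2 H →ₗ[K] Ten3 H :=
  extend (mulLift leg1 (leg23 ∘ₗ Δ))

/-- `a ⊗ b ↦ f a * g b`, with values in the completion of `H`. -/
def mulMap (f g : H →ₗ[K] H) : Ten2 H →ₗ[K] Compl H :=
  extend (mulLift (of.toLinearMap ∘ₗ f) (of.toLinearMap ∘ₗ g))

/-- The linear endomorphism `h ↦ ε(h) 1`. -/
def unitCounit (ε : H →ₐ[K] K) : H →ₗ[K] H := Algebra.linearMap K H ∘ₗ ε.toLinearMap

variable (H)

/-- A topological Hopf algebra over `K`: an `ħ`-adically complete and separated `K`-algebra with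
a Hopf algebra structure with respect to the `ħ`-adically completed tensor product. As `H` is
complete, it is identified with its completion through `of`. -/
structure TopHopf where
  complete : IsAdicComplete (Ideal.span {hbar}) H
  comul : H →ₐ[K] Ten2 H
  counit : H →ₐ[K] K
  antipode : H →ₗ[K] H
  coassoc : ∀ h, comulId comul.toLinearMap (comul h) = idComul comul.toLinearMap (comul h)
  counit_comul : ∀ h, mulMap (unitCounit counit) LinearMap.id (comul h) = of h
  comul_counit : ∀ h, mulMap LinearMap.id (unitCounit counit) (comul h) = of h
  antipode_comul : ∀ h, mulMap antipode LinearMap.id (comul h) = of (unitCounit counit h)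
  comul_antipode : ∀ h, mulMap LinearMap.id antipode (comul h) = of (unitCounit counit h)

variable {H}

/-- `R` is a universal `R`-matrix: `(Δ ⊗ id) R = R₁₃ R₂₃`, `(id ⊗ Δ) R = R₁₃ R₁₂` and
`Δᵒᵖ(h) R = R Δ(h)`. -/
structure IsQuasitriangular (P : TopHopf H) (R : (Ten2 H)ˣ) : Prop where
  comul_id : comulId P.comul.toLinearMap R = leg13 (R : Ten2 H) * leg23 (R : Ten2 H)
  id_comul : idComul P.comul.toLinearMap R = leg13 (R : Ten2 H) * leg12 (R : Ten2 H)
  comul_op : ∀ h, flip (P.comul h) * R = R * P.comul h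

/-- `u` is the Drinfeld element `∑ S(sᵢ) rᵢ` of `R = ∑ rᵢ ⊗ sᵢ`. -/
def IsDrinfeldElement (P : TopHopf H) (R : (Ten2 H)ˣ) (u : H) : Prop :=
  of u = mulMap P.antipode LinearMap.id (flip (R : Ten2 H))

/-- `v` is a ribbon element, where `u` is the Drinfeld element. -/
structure IsRibbonElement (P : TopHopf H) (R : (Ten2 H)ˣ) (u v : H) : Prop where
  central : ∀ h, v * h = h * v
  sq : v ^ 2 = u * P.antipode u
  comul : P.comul v =
    ((R⁻¹ : (Ten2 H)ˣ) : Ten2 H) * flip ((R⁻¹ : (Ten2 H)ˣ) : Ten2 H) * ten v v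
  antipode : P.antipode v = v
  counit : P.counit v = 1

/-- `C` is a spinner, where `u` is the Drinfeld element. -/
structure IsSpinner (P : TopHopf H) (u : H) (C : Hˣ) : Prop where
  drinfeld : ((C⁻¹ : Hˣ) : H) * u = P.antipode u * C
  counit : P.counit C = 1
  comul : P.comul C = ten (C : H) (C : H)
  antipode : P.antipode C = ((C⁻¹ : Hˣ) : H)
  conj : ∀ h, (C : H) * h * ((C⁻¹ : Hˣ) : H) = P.antipode (P.antipode h)

/-- `s` is the positive square root of `x` in the sense of power series in `ħ`: `s² = x` and
`s` has constant term `1`. -/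
def IsPosSqrt (s x : H) : Prop := s ^ 2 = x ∧ ∃ c : H, s = 1 + hbar • c

end Hopf

/-! ### The algebra `𝔻` -/

/-- The four generators. -/
inductive Gen : Type
  | y | b | a | x

/-- The free `ħ`-adically complete algebra on the four generators. -/
abbrev FreeC : Type := Compl (FreeAlgebra K Gen)

/-- The free generators. -/
def gen (g : Gen) : FreeC := of (FreeAlgebra.ι K g)

/-- The element `(1 - AB) / ħ = (1 - A) / ħ + A (1 - B) / ħ`, where `A = e^{-εħa}`,
`B = e^{-ħb}`. -/
def oneSubABDiv : FreeC :=
  oneSubExpDiv (-(eps • gen .a)) + hexp (-(eps • gen .a)) * oneSubExpDiv (-gen .b)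

theorem hbar_smul_oneSubABDiv :
    hbar • oneSubABDiv = 1 - hexp (-(eps • gen .a)) * hexp (-gen .b) := by
  rw [oneSubABDiv, smul_add, ← mul_smul_comm, hbar_smul_oneSubExpDiv, hbar_smul_oneSubExpDiv,
    mul_sub, mul_one]
  abel

/-- The defining relations of `𝔻`. -/
inductive Rel : FreeC → FreeC → Prop
  | xy : Rel (gen .x * gen .y) (q • (gen .y * gen .x) + oneSubABDiv)
  | ax : Rel (gen .a * gen .x - gen .x * gen .a) (gen .x)
  | bx : Rel (gen .b * gen .x - gen .x * gen .b) (eps • gen .x)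
  | ay : Rel (gen .a * gen .y - gen .y * gen .a) (-gen .y)
  | by' : Rel (gen .b * gen .y - gen .y * gen .b) (-(eps • gen .y))
  | ab : Rel (gen .a * gen .b - gen .b * gen .a) 0

/-- The `ħ`-adically complete algebra `𝔻` with generators `y, b, a, x` and the above relations.
As the quotient of `FreeC` by the two-sided ideal of the relations need not be separated, its
completion is taken; this is the quotient of `FreeC` by the closure of that ideal. -/
abbrev D : Type := Compl (RingQuot Rel)

/-- The generators of `𝔻`. -/
def dgen (g : Gen) : D := of (RingQuot.mkAlgHom K Rel (gen g))

/-- The generator `y`. -/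
def y : D := dgen .y

/-- The generator `b`. -/
def b : D := dgen .b

/-- The generator `a`. -/
def a : D := dgen .a

/-- The generator `x`. -/
def x : D := dgen .x

/-- `A = e^{-εħa}`. -/
def A : D := hexp (-(eps • a))

/-- `B = e^{-ħb}`. -/
def B : D := hexp (-b)

/-- The ordering map `ℚ[ε, y, b, a, x]⟦ħ⟧ → 𝔻`, which sends the monomial `yᵏ bˡ aᵐ xⁿ` to the
ordered product `yᵏ bˡ aᵐ xⁿ`. -/
def ordering (f : PowerSeries (MvPolynomial Gen (Polynomial ℚ))) : D :=
  hsum fun N => ∑ s ∈ (PowerSeries.coeff N f).support,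
    PowerSeries.C ((PowerSeries.coeff N f).coeff s) •
      (y ^ s .y * b ^ s .b * a ^ s .a * x ^ s .x)

/-- `R = ∑_{m,n} ħ^{m+n} / ([m]! n!) yᵐ bⁿ ⊗ aⁿ xᵐ`. -/
def Rmatrix : Ten2 D :=
  hsum fun N => ∑ p ∈ Finset.HasAntidiagonal.antidiagonal N,
    (Ring.inverse (qFact p.1) * rat (1 / (p.2 ! : ℚ))) •
      ten (y ^ p.1 * b ^ p.2) (a ^ p.2 * x ^ p.1)

/-- The coproduct, counit and antipode of `𝔻` on generators. Here `hexp b = B⁻¹` and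
`hexp (eps • a) = A⁻¹`. -/
structure HasGeneratorFormulas (P : TopHopf D) : Prop where
  comul_y : P.comul y = ten 1 y + ten y B
  comul_b : P.comul b = ten b 1 + ten 1 b
  comul_a : P.comul a = ten a 1 + ten 1 a
  comul_x : P.comul x = ten 1 x + ten x A
  counit_gen : P.counit y = 0 ∧ P.counit b = 0 ∧ P.counit a = 0 ∧ P.counit x = 0
  antipode_y : P.antipode y = -(y * hexp b)
  antipode_b : P.antipode b = -b
  antipode_a : P.antipode a = -a
  antipode_x : P.antipode x = -(x * hexp (eps • a))

end

end QD

open scoped TensorProduct Nat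
open Finset.HasAntidiagonal (antidiagonal)

namespace QD

noncomputable section

/-! ### Separated and complete modules -/

section Modules

/-- `s` is the sum of the series `∑ₖ ħᵏ cₖ`. -/
def IsHSum {M : Type*} [AddCommGroup M] [Module K M] (c : ℕ → M) (s : M) : Prop :=
  ∀ n, ∃ r, s = ∑ k ∈ Finset.range n, hbar ^ k • c k + hbar ^ n • r

/-- `ħ`-adically separated modules. -/
class HSep (M : Type*) [AddCommGroup M] [Module K M] : Prop where
  eq_zero : ∀ m : M, (∀ n : ℕ, ∃ r, m = hbar ^ n • r) → m = 0

/-- `ħ`-adically separated modules in which all series `∑ₖ ħᵏ cₖ` converge. -/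
class HComplete (M : Type*) [AddCommGroup M] [Module K M] : Prop extends HSep M where
  exists_sum : ∀ c : ℕ → M, ∃ s, IsHSum c s

variable {M N : Type*} [AddCommGroup M] [Module K M] [AddCommGroup N] [Module K N]

theorem IsHSum.unique [HSep M] {c : ℕ → M} {s t : M} (hs : IsHSum c s) (ht : IsHSum c t) :
    s = t := by
  refine sub_eq_zero.1 (HSep.eq_zero _ fun n => ?_)
  obtain ⟨r, hr⟩ := hs n
  obtain ⟨r', hr'⟩ := ht n
  exact ⟨r - r', by rw [hr, hr', smul_sub]; abel⟩

theorem IsHSum.map {c : ℕ → M} {s : M} (hs : IsHSum c s) (f : M →ₗ[K] N) :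
    IsHSum (fun k => f (c k)) (f s) := by
  intro n
  obtain ⟨r, hr⟩ := hs n
  exact ⟨f r, by rw [hr]; simp [map_sum]⟩

theorem IsHSum.of_shift {c : ℕ → M} {s : M} (hs : IsHSum (fun k => c (k + 1)) s) :
    IsHSum c (c 0 + hbar • s) := by
  intro n
  cases n with
  | zero => exact ⟨c 0 + hbar • s, by simp⟩
  | succ n =>
    obtain ⟨r, hr⟩ := hs n
    refine ⟨r, ?_⟩
    rw [hr, Finset.sum_range_succ', smul_add, Finset.smul_sum]
    simp only [smul_smul, pow_succ', pow_zero, one_smul]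
    abel

theorem exists_isHSum_of_approx (S : Set M) (hS : ∀ m : M, ∃ s ∈ S, ∃ m', m = s + hbar • m')
    (m : M) : ∃ c : ℕ → M, (∀ k, c k ∈ S) ∧ IsHSum c m := by
  choose s hs r hr using hS
  let it : ℕ → M := fun k => r^[k] m
  refine ⟨fun k => s (it k), fun k => hs _, fun n => ⟨it n, ?_⟩⟩
  induction n with
  | zero => simp [it]
  | succ n ih =>
    rw [Finset.sum_range_succ, ih, add_assoc]
    congr 1
    have : it (n + 1) = r (it n) := Function.iterate_succ_apply' r n m
    rw [this, pow_succ, mul_smul, ← smul_add, ← hr]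

theorem linearMap_ext_of_approx [HSep N] (S : Set M)
    (hS : ∀ m : M, ∃ s ∈ S, ∃ m', m = s + hbar • m') {f g : M →ₗ[K] N}
    (h : ∀ s ∈ S, f s = g s) : f = g := by
  refine LinearMap.ext fun m => ?_
  obtain ⟨c, hc, hm⟩ := exists_isHSum_of_approx S hS m
  refine (hm.map f).unique ?_
  simpa only [fun k => h _ (hc k)] using hm.map g

theorem mem_pow_smul_top (n : ℕ) (m : M) :
    m ∈ (Ideal.span {hbar} ^ n • ⊤ : Submodule K M) ↔ ∃ r, m = hbar ^ n • r := by
  rw [Ideal.span_singleton_pow, Submodule.ideal_span_singleton_smul,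
    Submodule.mem_smul_pointwise_iff_exists]
  simp [eq_comm]

theorem HComplete.isAdicComplete [HComplete M] : IsAdicComplete (Ideal.span {hbar}) M := by
  refine { haus' := fun m hm => HSep.eq_zero m fun n => ?_, prec' := fun f hf => ?_ }
  · have := hm n
    rwa [SModEq.zero, mem_pow_smul_top] at this
  · have h : ∀ n, ∃ r, f (n + 1) - f n = hbar ^ n • r := fun n => by
      have := (hf (Nat.le_succ n)).symm
      rwa [SModEq.sub_mem, mem_pow_smul_top] at this
    choose r hr using h
    obtain ⟨s, hs⟩ := HComplete.exists_sum r
    refine ⟨f 0 + s, fun n => ?_⟩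
    rw [SModEq.comm, SModEq.sub_mem, mem_pow_smul_top]
    obtain ⟨t, ht⟩ := hs n
    refine ⟨t, ?_⟩
    have : ∑ k ∈ Finset.range n, hbar ^ k • r k = f n - f 0 := by
      simp only [← hr, Finset.sum_range_sub]
    rw [ht, this]
    abel

instance HSep.pi {ι : Type*} {M : ι → Type*} [∀ i, AddCommGroup (M i)] [∀ i, Module K (M i)]
    [∀ i, HSep (M i)] : HSep (∀ i, M i) where
  eq_zero m hm := funext fun i => HSep.eq_zero _ fun n => by
    obtain ⟨r, hr⟩ := hm n
    exact ⟨r i, congrFun hr i⟩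

instance HComplete.pi {ι : Type*} {M : ι → Type*} [∀ i, AddCommGroup (M i)]
    [∀ i, Module K (M i)] [∀ i, HComplete (M i)] : HComplete (∀ i, M i) where
  exists_sum c := by
    choose s hs using fun i => HComplete.exists_sum fun k => c k i
    refine ⟨s, fun n => ?_⟩
    choose r hr using fun i => hs i n
    exact ⟨r, funext fun i => by simp [hr i]⟩

theorem HComplete.of_equiv [HComplete M] (e : M ≃ₗ[K] N) : HComplete N where
  eq_zero m hm := by
    refine e.symm.map_eq_zero_iff.1 (HSep.eq_zero _ fun n => ?_)
    obtain ⟨r, hr⟩ := hm n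
    exact ⟨e.symm r, by rw [hr, map_smul]⟩
  exists_sum c := by
    obtain ⟨s, hs⟩ := HComplete.exists_sum fun k => e.symm (c k)
    exact ⟨e s, by simpa using hs.map e.toLinearMap⟩

instance HComplete.mulOpposite [HComplete M] : HComplete Mᵐᵒᵖ :=
  HComplete.of_equiv (MulOpposite.opLinearEquiv K)

instance HComplete.moduleEnd {Q : Type*} [CommRing Q] [Algebra K Q] [Module Q M]
    [IsScalarTower K Q M] [HComplete M] : HComplete (Module.End Q M) where
  eq_zero f hf := LinearMap.ext fun m => HSep.eq_zero _ fun n => by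
    obtain ⟨r, hr⟩ := hf n
    exact ⟨r m, by rw [hr]; rfl⟩
  exists_sum c := by
    have key : ∀ d : ℕ → Module.End Q M, ∃ s : Module.End Q M,
        ∀ m, IsHSum (fun k => d k m) (s m) := by
      intro d
      choose s hs using fun m => HComplete.exists_sum fun k => d k m
      refine ⟨{ toFun := s, map_add' := fun m m' => ?_, map_smul' := fun r m => ?_ }, hs⟩
      · refine (hs _).unique fun n => ?_
        obtain ⟨r, hr⟩ := hs m n
        obtain ⟨r', hr'⟩ := hs m' n
        refine ⟨r + r', ?_⟩
        simp only [hr, hr', map_add, smul_add, Finset.sum_add_distrib]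
        abel
      · refine (hs _).unique ?_
        simpa using (hs m).map (LinearMap.lsmul Q M r |>.restrictScalars K)
    choose s hs using fun n : ℕ => key fun k => c (k + n)
    refine ⟨s 0, fun n => ⟨s n, LinearMap.ext fun m => (hs 0 m).unique ?_⟩⟩
    have h : ∀ n, s 0 m = (∑ k ∈ Finset.range n, hbar ^ k • c k + hbar ^ n • s n) m := by
      intro n
      induction n with
      | zero => simp
      | succ n ih =>
        have h1 : s n m = c n m + hbar • s (n + 1) m := by
          refine (hs n m).unique ?_
          have := IsHSum.of_shift (c := fun k => c (k + n) m) (s := s (n + 1) m)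
            (by simpa only [add_right_comm, add_assoc, add_comm 1] using hs (n + 1) m)
          simpa using this
        rw [ih, Finset.sum_range_succ]
        simp only [LinearMap.add_apply, LinearMap.smul_apply, h1, smul_add, pow_succ, mul_smul]
        abel
    rw [← h n]
    exact hs 0 m

end Modules

/-! ### Completed algebras -/

section Completed

variable {T T' : Type*} [Ring T] [Algebra K T] [Ring T'] [Algebra K T']

theorem isHSum_hsum (c : ℕ → Compl T) : IsHSum c (hsum c) := by
  intro n
  refine ⟨hsum fun k => c (k + n), ?_⟩
  induction n with
  | zero => simp
  | succ n ih =>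
    rw [ih, hsum_succ fun k => c (k + n), Finset.sum_range_succ, smul_add, smul_smul, pow_succ]
    simp only [zero_add, add_right_comm _ 1 n, add_assoc]

theorem exists_eq_hsum_of (s : Compl T) : ∃ t : ℕ → T, s = hsum fun k => of (t k) := by
  choose l hl using fun n => Ideal.Quotient.mk_surjective (proj n s)
  have h : ∀ n, ∃ r, hbar ^ n • r = l (n + 1) - l n := fun n => by
    have h1 : Ideal.Quotient.mk (hIdeal T n) (l (n + 1)) = Ideal.Quotient.mk (hIdeal T n) (l n) := by
      rw [hl n, ← factor_proj, ← hl (n + 1)]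
      rfl
    exact Ideal.Quotient.eq.1 h1
  choose t ht using h
  have h0 : ∃ r : T, hbar ^ 0 • r = l 0 := ⟨l 0, by simp⟩
  refine ⟨fun k => if k = 0 then t 0 + l 0 else t k, Compl.ext_proj fun n => ?_⟩
  rw [proj_hsum]
  cases n with
  | zero =>
    rw [← one_smul K (proj 0 s), ← pow_zero hbar, hbar_pow_smul_quot]
    simp
  | succ n =>
    have key : ∀ n, ∑ k ∈ Finset.range (n + 1), hbar ^ k • (if k = 0 then t 0 + l 0 else t k)
        = l (n + 1) := by
      intro n
      induction n with
      | zero =>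
        have := ht 0
        simp only [pow_zero, one_smul, zero_add] at this
        simp [this]
      | succ n ih =>
        rw [Finset.sum_range_succ, ih, if_neg (by omega), ht]
        abel
    rw [← hl (n + 1), ← key n]
    simp only [map_sum]
    rfl

theorem exists_of_add_hbar_smul (s : Compl T) : ∃ t : T, ∃ r, s = of t + hbar • r := by
  obtain ⟨t, rfl⟩ := exists_eq_hsum_of s
  exact ⟨t 0, _, hsum_succ _⟩

instance : HComplete (Compl T) where
  eq_zero s hs := Compl.ext_proj fun n => by
    obtain ⟨r, rfl⟩ := hs n
    simp [hbar_pow_smul_quot]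
  exists_sum c := ⟨hsum c, isHSum_hsum c⟩

theorem IsHSum.eq_hsum {c : ℕ → Compl T} {s : Compl T} (h : IsHSum c s) : s = hsum c :=
  h.unique (isHSum_hsum c)

theorem Compl.linearMap_ext {N : Type*} [AddCommGroup N] [Module K N] [HSep N]
    {f g : Compl T →ₗ[K] N} (h : ∀ t, f (of t) = g (of t)) : f = g :=
  linearMap_ext_of_approx (Set.range of)
    (fun s => by
      obtain ⟨t, r, h⟩ := exists_of_add_hbar_smul s
      exact ⟨of t, ⟨t, rfl⟩, r, h⟩)
    (by rintro _ ⟨t, rfl⟩; exact h t)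

theorem Compl.algHom_ext {H : Type*} [Ring H] [Algebra K H] [HSep H]
    {f g : Compl T →ₐ[K] H} (h : ∀ t, f (of t) = g (of t)) : f = g :=
  AlgHom.toLinearMap_injective (Compl.linearMap_ext h)

theorem map_hsum (f : Compl T →ₗ[K] Compl T') (c : ℕ → Compl T) :
    f (hsum c) = hsum fun k => f (c k) :=
  ((isHSum_hsum c).map f).eq_hsum

theorem hsum_add (c d : ℕ → Compl T) : hsum (fun k => c k + d k) = hsum c + hsum d := by
  refine Compl.ext_proj fun n => ?_
  simp [proj_hsum, Finset.sum_add_distrib]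

theorem hsum_sub (c d : ℕ → Compl T) : hsum (fun k => c k - d k) = hsum c - hsum d := by
  refine Compl.ext_proj fun n => ?_
  simp [proj_hsum, smul_sub]

theorem smul_hsum (r : K) (c : ℕ → Compl T) : r • hsum c = hsum fun k => r • c k :=
  map_hsum (LinearMap.lsmul K (Compl T) r) c

theorem mul_hsum (s : Compl T) (c : ℕ → Compl T) : s * hsum c = hsum fun k => s * c k :=
  map_hsum (LinearMap.mulLeft K s) c

theorem hsum_mul (s : Compl T) (c : ℕ → Compl T) : hsum c * s = hsum fun k => c k * s :=
  map_hsum (LinearMap.mulRight K s) c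

theorem hsum_hsum (c : ℕ → ℕ → Compl T) :
    hsum (fun i => hsum fun j => c i j) =
      hsum fun N => ∑ p ∈ antidiagonal N, c p.1 p.2 := by
  refine Compl.ext_proj fun n => ?_
  simp only [proj_hsum, Finset.smul_sum, map_sum, smul_smul, ← pow_add]
  have h1 : ∀ p ∈ (Finset.range n ×ˢ Finset.range n).filter (fun p => p.1 + p.2 < n),
      p.1 + p.2 ∈ Finset.range n := by simp
  rw [← Finset.sum_product', ← Finset.sum_filter_add_sum_filter_not _ (fun p => p.1 + p.2 < n),
    ← Finset.sum_fiberwise_of_maps_to h1]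
  have h2 : ∑ p ∈ (Finset.range n ×ˢ Finset.range n).filter (fun p => ¬ p.1 + p.2 < n),
      hbar ^ (p.1 + p.2) • proj n (c p.1 p.2) = 0 := by
    refine Finset.sum_eq_zero fun p hp => ?_
    obtain ⟨k, hk⟩ := Nat.exists_eq_add_of_le (not_lt.1 (Finset.mem_filter.1 hp).2)
    rw [hk, pow_add, mul_smul, hbar_pow_smul_quot]
  rw [h2, add_zero]
  refine Finset.sum_congr rfl fun N hN => ?_
  refine Finset.sum_congr_of_eq_on_inter ?_ ?_ ?_
  · intro p hp hp'
    simp only [Finset.mem_filter] at hp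
    exact absurd (Finset.HasAntidiagonal.mem_antidiagonal.2 hp.2) hp'
  · intro p hp hp'
    simp only [Finset.mem_filter, Finset.mem_product, Finset.mem_range, Finset.HasAntidiagonal.mem_antidiagonal]
      at *
    omega
  · intro p hp hp'
    rw [Finset.HasAntidiagonal.mem_antidiagonal.1 hp']

theorem hsum_mul_hsum (c d : ℕ → Compl T) :
    hsum c * hsum d = hsum fun N => ∑ p ∈ antidiagonal N, c p.1 * d p.2 := by
  rw [hsum_mul, ← hsum_hsum fun i j => c i * d j]
  simp only [mul_hsum]

/-! ### The exponential -/

theorem rat_mul (r s : ℚ) : rat (r * s) = rat r * rat s := by simp [rat]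

theorem rat_add (r s : ℚ) : rat (r + s) = rat r + rat s := by simp [rat]

theorem rat_one : rat 1 = 1 := by simp [rat]

theorem add_pow_div_factorial {H : Type*} [Ring H] [Algebra K H] {u v : H} (h : Commute u v)
    (n : ℕ) : rat (1 / (n ! : ℚ)) • (u + v) ^ n =
      ∑ p ∈ antidiagonal n,
        (rat (1 / (p.1 ! : ℚ)) • u ^ p.1) * (rat (1 / (p.2 ! : ℚ)) • v ^ p.2) := by
  rw [h.add_pow', Finset.smul_sum]
  refine Finset.sum_congr rfl fun p hp => ?_
  obtain rfl := Finset.HasAntidiagonal.mem_antidiagonal.1 hp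
  have hc : ((p.1 + p.2).choose p.1 : K) = rat ((p.1 + p.2).choose p.1 : ℚ) := by
    simp [rat]
  rw [smul_mul_smul_comm, ← Nat.cast_smul_eq_nsmul K, smul_smul, hc, ← rat_mul, ← rat_mul]
  congr 2
  have := Nat.choose_mul_factorial_mul_factorial (Nat.le_add_right p.1 p.2)
  rw [Nat.add_sub_cancel_left] at this
  have h1 : ((p.1 + p.2)! : ℚ) = (p.1 + p.2).choose p.1 * p.1 ! * p.2 ! := by
    exact_mod_cast this.symm
  rw [h1]
  have h2 : ((p.1 + p.2).choose p.1 : ℚ) ≠ 0 := by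
    exact_mod_cast (Nat.choose_pos (Nat.le_add_right _ _)).ne'
  field_simp

theorem hexp_add {u v : Compl T} (h : Commute u v) : hexp (u + v) = hexp u * hexp v := by
  simp only [hexp, hsum_mul_hsum, add_pow_div_factorial h]

theorem hexp_zero : hexp (0 : Compl T) = 1 := by
  rw [hexp, hsum_succ]
  have : (hsum fun k => rat (1 / ((k + 1) ! : ℚ)) • (0 : Compl T) ^ (k + 1)) = 0 :=
    Compl.ext_proj fun n => by simp [proj_hsum]
  rw [this]
  simp [rat_one]

theorem hexp_mul_hexp_neg (u : Compl T) : hexp u * hexp (-u) = 1 := by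
  rw [← hexp_add (Commute.refl u).neg_right, add_neg_cancel, hexp_zero]

theorem hexp_neg_mul_hexp (u : Compl T) : hexp (-u) * hexp u = 1 := by
  rw [← hexp_add (Commute.refl u).neg_left, neg_add_cancel, hexp_zero]

theorem oneSubExpDiv_add {u v : Compl T} (h : Commute u v) :
    oneSubExpDiv (u + v) = oneSubExpDiv u + hexp u * oneSubExpDiv v := by
  rw [hexp, oneSubExpDiv, oneSubExpDiv, oneSubExpDiv, hsum_mul_hsum, ← hsum_add]
  congr 1
  funext k
  rw [add_pow_div_factorial h, Finset.Nat.sum_antidiagonal_succ']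
  simp [rat_one]
  abel

theorem oneSubExpDiv_zero : oneSubExpDiv (0 : Compl T) = 0 :=
  Compl.ext_proj fun n => by simp [proj_hsum, oneSubExpDiv]

theorem map_hexp (f : Compl T →ₗ[K] Compl T') {w : Compl T} {w' : Compl T'}
    (h : ∀ k, f (w ^ k) = w' ^ k) : f (hexp w) = hexp w' := by
  simp only [hexp, map_hsum, map_smul, h]

theorem map_oneSubExpDiv (f : Compl T →ₗ[K] Compl T') {w : Compl T} {w' : Compl T'}
    (h : ∀ k, f (w ^ k) = w' ^ k) : f (oneSubExpDiv w) = oneSubExpDiv w' := by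
  simp only [oneSubExpDiv, map_hsum, map_smul, map_neg, h]

theorem algHom_hexp (f : Compl T →ₐ[K] Compl T') (w : Compl T) : f (hexp w) = hexp (f w) :=
  map_hexp f.toLinearMap fun k => map_pow f w k

theorem algHom_oneSubExpDiv (f : Compl T →ₐ[K] Compl T') (w : Compl T) :
    f (oneSubExpDiv w) = oneSubExpDiv (f w) :=
  map_oneSubExpDiv f.toLinearMap fun k => map_pow f w k

theorem hexp_mul_of_semiconj {u v s : Compl T} (h : u * s = s * v) :
    hexp u * s = s * hexp v := by
  have h' : ∀ k, u ^ k * s = s * v ^ k := fun k =>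
    (((show SemiconjBy s v u from h.symm).pow_right k).eq).symm
  simp only [hexp, hsum_mul, mul_hsum, smul_mul_assoc, mul_smul_comm, h']

theorem hexp_commute {u s : Compl T} (h : Commute u s) : Commute (hexp u) s :=
  hexp_mul_of_semiconj h

theorem exists_hexp_eq (w : Compl T) : ∃ c, hexp w = 1 + hbar • c :=
  ⟨-oneSubExpDiv w, by rw [smul_neg, hbar_smul_oneSubExpDiv]; abel⟩

theorem hexp_nsmul (n : ℕ) (w : Compl T) : hexp (n • w) = hexp w ^ n := by
  induction n with
  | zero => simp [hexp_zero]
  | succ n ih => rw [succ_nsmul, hexp_add ((Commute.refl w).smul_left n), ih, pow_succ]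

/-! ### Homomorphisms between completed algebras -/

/-- The multiplicative extension of an algebra homomorphism to the completion. -/
def extendAlg (f : T →ₐ[K] Compl T') : Compl T →ₐ[K] Compl T' :=
  AlgHom.ofLinearMap (extend f.toLinearMap)
    (by rw [← map_one (of (T := T)), extend_of]; simp)
    (by
      have h : ∀ (s : Compl T) (t : T), extend f.toLinearMap (s * of t)
          = extend f.toLinearMap s * extend f.toLinearMap (of t) := fun s t =>
        LinearMap.congr_fun (Compl.linearMap_ext
          (f := extend f.toLinearMap ∘ₗ LinearMap.mulRight K (of t))
          (g := LinearMap.mulRight K (extend f.toLinearMap (of t)) ∘ₗ extend f.toLinearMap)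
          fun t' => by simp [← map_mul, extend_of]) s
      exact fun s t => LinearMap.congr_fun (Compl.linearMap_ext
          (f := extend f.toLinearMap ∘ₗ LinearMap.mulLeft K s)
          (g := LinearMap.mulLeft K (extend f.toLinearMap s) ∘ₗ extend f.toLinearMap)
          fun t' => by simp [h]) t)

@[simp] theorem extendAlg_of (f : T →ₐ[K] Compl T') (t : T) : extendAlg f (of t) = f t :=
  extend_of f.toLinearMap t

section CompleteTarget

variable {H : Type*} [Ring H] [Algebra K H] [HComplete H]

theorem of_bijective : Function.Bijective (of : H →ₐ[K] Compl H) := by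
  constructor
  · refine (injective_iff_map_eq_zero _).2 fun h hh => HSep.eq_zero h fun n => ?_
    have : proj n (of h) = 0 := by rw [hh, map_zero]
    obtain ⟨r, hr⟩ : h ∈ hIdeal H n := Ideal.Quotient.eq_zero_iff_mem.1 this
    exact ⟨r, hr.symm⟩
  · intro s
    obtain ⟨t, rfl⟩ := exists_eq_hsum_of s
    obtain ⟨h, hh⟩ := HComplete.exists_sum t
    exact ⟨h, (hh.map of.toLinearMap).eq_hsum⟩

variable (H) in
/-- A complete algebra is its own completion. -/
def ofEquiv : H ≃ₐ[K] Compl H := AlgEquiv.ofBijective of of_bijective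

@[simp] theorem ofEquiv_symm_of (h : H) : (ofEquiv H).symm (of h) = h :=
  (ofEquiv H).symm_apply_apply h

/-- The extension to the completion of a linear map with values in a complete algebra. -/
def liftLin (f : T →ₗ[K] H) : Compl T →ₗ[K] H :=
  (ofEquiv H).symm.toLinearMap ∘ₗ extend (of.toLinearMap ∘ₗ f)

@[simp] theorem liftLin_of (f : T →ₗ[K] H) (t : T) : liftLin f (of t) = f t := by
  simp [liftLin, extend_of]

/-- The extension to the completion of a homomorphism with values in a complete algebra. -/
def liftAlg (f : T →ₐ[K] H) : Compl T →ₐ[K] H :=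
  (ofEquiv H).symm.toAlgHom.comp (extendAlg (of.comp f))

@[simp] theorem liftAlg_of (f : T →ₐ[K] H) (t : T) : liftAlg f (of t) = f t := by
  simp [liftAlg]

end CompleteTarget

end Completed

/-! ### The universal property of `𝔻` -/

section Universal

variable {T : Type*} [Ring T] [Algebra K T]

/-- The defining relations of `𝔻`, for four elements of a completed algebra. -/
structure DRel (y b a x : Compl T) : Prop where
  xy : x * y = q • (y * x) + oneSubExpDiv (-(eps • a) + -b)
  ax : a * x = x * a + x
  bx : b * x = x * b + eps • x
  ay : a * y = y * a - y
  by' : b * y = y * b - eps • y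
  ab : Commute a b

/-- The projection of the free completed algebra to `𝔻`. -/
def toD : FreeC →ₐ[K] D := of.comp (RingQuot.mkAlgHom K Rel)

theorem toD_rel {r s : FreeC} (h : Rel r s) : toD r = toD s :=
  congrArg of (RingQuot.mkAlgHom_rel K h)

theorem commute_smul_neg {a b : Compl T} (h : Commute a b) : Commute (-(eps • a)) (-b) :=
  ((h.smul_left eps).neg_left).neg_right

theorem dRel_D : DRel y b a x where
  ab := by
    have := toD_rel Rel.ab
    rw [map_sub, map_mul, map_mul, map_zero, sub_eq_zero] at this
    exact this
  ax := by
    have := toD_rel Rel.ax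
    rw [map_sub, map_mul, map_mul, sub_eq_iff_eq_add'] at this
    exact this
  bx := by
    have := toD_rel Rel.bx
    rw [map_sub, map_mul, map_mul, map_smul, sub_eq_iff_eq_add'] at this
    exact this
  ay := by
    have := toD_rel Rel.ay
    rw [map_sub, map_mul, map_mul, map_neg, sub_eq_iff_eq_add', ← sub_eq_add_neg] at this
    exact this
  by' := by
    have := toD_rel Rel.by'
    rw [map_sub, map_mul, map_mul, map_neg, map_smul, sub_eq_iff_eq_add', ← sub_eq_add_neg] at this
    exact this
  xy := by
    have hab : Commute a b := by
      have := toD_rel Rel.ab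
      rw [map_sub, map_mul, map_mul, map_zero, sub_eq_zero] at this
      exact this
    have := toD_rel Rel.xy
    rw [map_mul, map_add, map_smul, map_mul, oneSubABDiv, map_add, map_mul, algHom_oneSubExpDiv,
      algHom_oneSubExpDiv, algHom_hexp, map_neg, map_neg, map_smul] at this
    rw [oneSubExpDiv_add (commute_smul_neg hab)]
    exact this

section Lift

variable {H : Type*} [Ring H] [Algebra K H] [HComplete H]

/-- The homomorphism from the free completed algebra given by the images of the generators. -/
def freeLift (v : Gen → H) : FreeC →ₐ[K] H := liftAlg (FreeAlgebra.lift K v)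

@[simp] theorem freeLift_gen (v : Gen → H) (g : Gen) : freeLift v (gen g) = v g := by
  simp [freeLift, gen]

/-- The homomorphism from `𝔻` given by the images of the generators. -/
def liftD (v : Gen → H) (h : ∀ ⦃r s⦄, Rel r s → freeLift v r = freeLift v s) : D →ₐ[K] H :=
  liftAlg (RingQuot.liftAlgHom K ⟨freeLift v, h⟩)

@[simp] theorem liftD_dgen (v : Gen → H) (h : ∀ ⦃r s⦄, Rel r s → freeLift v r = freeLift v s)
    (g : Gen) : liftD v h (dgen g) = v g := by
  simp [liftD, dgen]

theorem algHom_ext_D {H : Type*} [Ring H] [Algebra K H] [HSep H] {f g : D →ₐ[K] H}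
    (hy : f y = g y) (hb : f b = g b) (ha : f a = g a) (hx : f x = g x) : f = g := by
  refine Compl.algHom_ext fun t => ?_
  have : (f.comp of).comp (RingQuot.mkAlgHom K Rel) = (g.comp of).comp (RingQuot.mkAlgHom K Rel) := by
    refine Compl.algHom_ext fun t => ?_
    have : ((f.comp toD).comp of : FreeAlgebra K Gen →ₐ[K] H) = (g.comp toD).comp of := by
      refine FreeAlgebra.hom_ext (funext fun i => ?_)
      cases i
      exacts [hy, hb, ha, hx]
    exact DFunLike.congr_fun this t
  exact DFunLike.congr_fun (RingQuot.ringQuot_ext' K _ _ this) t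

end Lift

/-- The four elements as a family indexed by the generators. -/
def tuple {H : Type*} (y b a x : H) : Gen → H
  | .y => y
  | .b => b
  | .a => a
  | .x => x

theorem DRel.freeLift_eq {y b a x : Compl T} (h : DRel y b a x) ⦃r s : FreeC⦄ (hr : Rel r s) :
    freeLift (tuple y b a x) r = freeLift (tuple y b a x) s := by
  cases hr with
  | xy =>
    simp only [map_mul, map_add, map_smul, freeLift_gen, oneSubABDiv, algHom_oneSubExpDiv,
      algHom_hexp, map_neg, tuple]
    rw [h.xy, oneSubExpDiv_add (commute_smul_neg h.ab)]
  | ax => simp [tuple, h.ax]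
  | bx => simp [tuple, h.bx]
  | ay => simp [tuple, h.ay]
  | by' => simp [tuple, h.by']
  | ab => simp [tuple, h.ab.eq]

/-- The homomorphism from `𝔻` given by four elements that satisfy the relations. -/
def DRel.lift {y b a x : Compl T} (h : DRel y b a x) : D →ₐ[K] Compl T :=
  liftD (tuple y b a x) h.freeLift_eq

section

variable {y' b' a' x' : Compl T} (h : DRel y' b' a' x')

theorem DRel.lift_y : h.lift y = y' := liftD_dgen _ _ _

theorem DRel.lift_b : h.lift b = b' := liftD_dgen _ _ _

theorem DRel.lift_a : h.lift a = a' := liftD_dgen _ _ _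

theorem DRel.lift_x : h.lift x = x' := liftD_dgen _ _ _

end

end Universal

/-! ### Commutation relations -/

section Commutation

variable {T : Type*} [Ring T] [Algebra K T] {y b a x : Compl T}

theorem powerSeries_eq_sum_add {R : Type*} [CommRing R] (f : PowerSeries R) (n : ℕ) :
    f = ∑ k ∈ Finset.range n, PowerSeries.X ^ k * PowerSeries.C (PowerSeries.coeff k f)
      + PowerSeries.X ^ n * PowerSeries.mk fun k => PowerSeries.coeff (k + n) f := by
  ext m
  rw [map_add, map_sum, PowerSeries.coeff_X_pow_mul']
  simp only [PowerSeries.coeff_X_pow_mul', PowerSeries.coeff_C, PowerSeries.coeff_mk]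
  rcases lt_or_ge m n with h | h
  · rw [if_neg (by omega), Finset.sum_eq_single m]
    · simp
    · intro k _ hk
      split_ifs <;> first | rfl | omega
    · intro hm
      exact absurd (Finset.mem_range.2 h) hm
  · rw [if_pos h, Finset.sum_eq_zero, Nat.sub_add_cancel h, zero_add]
    intro k hk
    have := Finset.mem_range.1 hk
    split_ifs <;> first | rfl | omega

theorem isHSum_q : IsHSum (fun k => rat (1 / (k ! : ℚ)) * eps ^ k) q := by
  intro n
  refine ⟨PowerSeries.mk fun k => PowerSeries.coeff (k + n) q, ?_⟩
  have h : ∀ k, hbar ^ k • (rat (1 / (k ! : ℚ)) * eps ^ k)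
      = PowerSeries.X ^ k * PowerSeries.C (PowerSeries.coeff k q) := fun k => by
    rw [smul_eq_mul, hbar, rat, eps, ← map_pow, ← map_mul, q, PowerSeries.coeff_mk]
  simp only [h]
  exact powerSeries_eq_sum_add q n

theorem hexp_smul_one : hexp (eps • (1 : Compl T)) = q • 1 := by
  have h := isHSum_q.map (LinearMap.toSpanSingleton K (Compl T) 1)
  rw [← LinearMap.toSpanSingleton_apply K (Compl T) 1 q, h.eq_hsum, hexp]
  congr 1
  funext k
  simp [smul_pow, mul_smul]

theorem hexp_mul_eq_q_smul {u s : Compl T} (h : u * s = s * u + eps • s) :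
    hexp u * s = q • (s * hexp u) := by
  have h1 : u * s = s * (u + eps • 1) := by rw [h, mul_add, mul_smul_comm, mul_one]
  rw [hexp_mul_of_semiconj h1, hexp_add ((Commute.one_right u).smul_right eps), hexp_smul_one,
    mul_smul_comm, mul_one, mul_smul_comm]

theorem mul_hexp_neg_eq_q_smul {u s : Compl T} (h : u * s = s * u + eps • s) :
    s * hexp (-u) = q • (hexp (-u) * s) := by
  have h1 := hexp_mul_eq_q_smul h
  calc s * hexp (-u) = hexp (-u) * (hexp u * s) * hexp (-u) := by
        rw [← mul_assoc, hexp_neg_mul_hexp, one_mul]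
    _ = q • (hexp (-u) * s * (hexp u * hexp (-u))) := by
        rw [h1]; simp only [mul_smul_comm, smul_mul_assoc, mul_assoc]
    _ = _ := by rw [hexp_mul_hexp_neg, mul_one]

namespace DRel

variable (h : DRel y b a x)
include h

theorem A_y : hexp (-(eps • a)) * y = q • (y * hexp (-(eps • a))) :=
  hexp_mul_eq_q_smul (by
    rw [neg_mul, smul_mul_assoc, h.ay, mul_neg, mul_smul_comm, smul_sub]; abel)

theorem B_y : hexp (-b) * y = q • (y * hexp (-b)) :=
  hexp_mul_eq_q_smul (by rw [neg_mul, h.by', mul_neg]; abel)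

theorem x_A : x * hexp (-(eps • a)) = q • (hexp (-(eps • a)) * x) :=
  mul_hexp_neg_eq_q_smul (by rw [smul_mul_assoc, h.ax, mul_smul_comm, smul_add])

theorem x_B : x * hexp (-b) = q • (hexp (-b) * x) :=
  mul_hexp_neg_eq_q_smul h.bx

theorem Binv_x : hexp b * x = q • (x * hexp b) :=
  hexp_mul_eq_q_smul h.bx

theorem y_Ainv : y * hexp (eps • a) = q • (hexp (eps • a) * y) := by
  have := mul_hexp_neg_eq_q_smul (u := -(eps • a)) (s := y) (by
    rw [neg_mul, smul_mul_assoc, h.ay, mul_neg, mul_smul_comm, smul_sub]; abel)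
  rwa [neg_neg] at this

theorem hexp_AB :
    hexp (-(eps • a) + -b) = hexp (-(eps • a)) * hexp (-b) :=
  hexp_add (commute_smul_neg h.ab)

end DRel

end Commutation

/-! ### Ordered monomials span -/

section Spanning

/-- The ordered monomial `yᵏ bˡ aᵐ xⁿ`. -/
def mono (s : Gen →₀ ℕ) : D := y ^ s .y * b ^ s .b * a ^ s .a * x ^ s .x

/-- The ordering map on polynomials. -/
def ordPoly (p : MvPolynomial Gen (Polynomial ℚ)) : D :=
  ∑ s ∈ p.support, PowerSeries.C (p.coeff s) • mono s

theorem ordering_eq (f : PowerSeries (MvPolynomial Gen (Polynomial ℚ))) :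
    ordering f = hsum fun N => ordPoly (PowerSeries.coeff N f) := rfl

theorem ordPoly_eq_sum {p : MvPolynomial Gen (Polynomial ℚ)} {S : Finset (Gen →₀ ℕ)}
    (h : p.support ⊆ S) : ordPoly p = ∑ s ∈ S, PowerSeries.C (p.coeff s) • mono s := by
  refine Finset.sum_subset h fun s _ hs => ?_
  rw [MvPolynomial.notMem_support_iff.1 hs, map_zero, zero_smul]

theorem ordPoly_add (p p' : MvPolynomial Gen (Polynomial ℚ)) :
    ordPoly (p + p') = ordPoly p + ordPoly p' := by
  classical
  rw [ordPoly_eq_sum (MvPolynomial.support_add (p := p) (q := p')),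
    ordPoly_eq_sum (p := p) Finset.subset_union_left,
    ordPoly_eq_sum (p := p') Finset.subset_union_right, ← Finset.sum_add_distrib]
  simp [add_smul]

theorem ordPoly_C_mul (c : Polynomial ℚ) (p : MvPolynomial Gen (Polynomial ℚ)) :
    ordPoly (MvPolynomial.C c * p) = PowerSeries.C c • ordPoly p := by
  have h : (MvPolynomial.C c * p).support ⊆ p.support := by
    rw [← MvPolynomial.smul_eq_C_mul]
    exact MvPolynomial.support_smul
  rw [ordPoly_eq_sum h, ordPoly, Finset.smul_sum]
  simp [mul_smul]

theorem ordPoly_monomial (s : Gen →₀ ℕ) : ordPoly (MvPolynomial.monomial s 1) = mono s := by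
  classical
  rw [ordPoly_eq_sum MvPolynomial.support_monomial_subset, Finset.sum_singleton,
    MvPolynomial.coeff_monomial, if_pos rfl, map_one, one_smul]

/-- The elements of `𝔻` that are combinations of ordered monomials modulo `ħ`. -/
def ordSpan : Submodule K D :=
  Submodule.span K (Set.range mono ∪ Set.range fun d : D => hbar • d)

theorem mono_mem_ordSpan (s : Gen →₀ ℕ) : mono s ∈ ordSpan :=
  Submodule.subset_span (Or.inl ⟨s, rfl⟩)

theorem hbar_smul_mem_ordSpan (d : D) : hbar • d ∈ ordSpan :=
  Submodule.subset_span (Or.inr ⟨d, rfl⟩)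

instance : Finite Gen :=
  Finite.of_surjective ![Gen.y, .b, .a, .x] fun g => by
    cases g
    exacts [⟨0, rfl⟩, ⟨1, rfl⟩, ⟨2, rfl⟩, ⟨3, rfl⟩]

/-- The exponent vector with given entries. -/
def expo (k l m n : ℕ) : Gen →₀ ℕ :=
  Finsupp.equivFunOnFinite.symm (tuple k l m n)

theorem mul_mem_ordSpan {g : D}
    (h : ∀ k l m n, g * (y ^ k * (b ^ l * (a ^ m * x ^ n))) ∈ ordSpan) {d : D}
    (hd : d ∈ ordSpan) : g * d ∈ ordSpan := by
  have : ordSpan ≤ ordSpan.comap (LinearMap.mulLeft K g) := by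
    refine Submodule.span_le.2 ?_
    rintro _ (⟨s, rfl⟩ | ⟨r, rfl⟩)
    · simpa [mono, mul_assoc] using h (s .y) (s .b) (s .a) (s .x)
    · simpa using hbar_smul_mem_ordSpan (g * r)
  exact this hd

theorem mul4_mem_ordSpan (k l m n : ℕ) : y ^ k * (b ^ l * (a ^ m * x ^ n)) ∈ ordSpan := by
  have := mono_mem_ordSpan (expo k l m n)
  simpa [mono, expo, mul_assoc, tuple] using this

theorem y_mul_mem_ordSpan {d : D} (hd : d ∈ ordSpan) : y * d ∈ ordSpan :=
  mul_mem_ordSpan (fun k l m n => by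
    rw [← mul_assoc, ← pow_succ']
    exact mul4_mem_ordSpan _ _ _ _) hd

theorem b_mul_mem_ordSpan {d : D} (hd : d ∈ ordSpan) : b * d ∈ ordSpan := by
  refine mul_mem_ordSpan (fun k l m n => ?_) hd
  induction k with
  | zero =>
    rw [pow_zero, one_mul, ← mul_assoc, ← pow_succ']
    simpa using mul4_mem_ordSpan 0 (l + 1) m n
  | succ k ih =>
    rw [pow_succ', mul_assoc, ← mul_assoc b, dRel_D.by', sub_mul, smul_mul_assoc, mul_assoc y b]
    refine sub_mem (y_mul_mem_ordSpan ih) (Submodule.smul_mem _ _ ?_)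
    exact y_mul_mem_ordSpan (mul4_mem_ordSpan _ _ _ _)

theorem a_mul_mem_ordSpan {d : D} (hd : d ∈ ordSpan) : a * d ∈ ordSpan := by
  refine mul_mem_ordSpan (fun k l m n => ?_) hd
  induction k with
  | zero =>
    rw [pow_zero, one_mul, ← mul_assoc, (dRel_D.ab.pow_right l).eq, mul_assoc, ← mul_assoc a,
      ← pow_succ']
    simpa using mul4_mem_ordSpan 0 l (m + 1) n
  | succ k ih =>
    rw [pow_succ', mul_assoc, ← mul_assoc a, dRel_D.ay, sub_mul, mul_assoc y a]
    refine sub_mem (y_mul_mem_ordSpan ih) ?_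
    exact y_mul_mem_ordSpan (mul4_mem_ordSpan _ _ _ _)

theorem exists_oneSubExpDiv_eq {T : Type*} [Ring T] [Algebra K T] (w : Compl T) :
    ∃ r, oneSubExpDiv w = -w + hbar • r :=
  ⟨_, by rw [oneSubExpDiv, hsum_succ]; simp [rat_one]; rfl⟩

theorem x_mul_mem_ordSpan {d : D} (hd : d ∈ ordSpan) : x * d ∈ ordSpan := by
  have ha : ∀ m n, x * (a ^ m * x ^ n) ∈ ordSpan := by
    intro m n
    induction m with
    | zero =>
      rw [pow_zero, one_mul, ← pow_succ']
      simpa using mul4_mem_ordSpan 0 0 0 (n + 1)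
    | succ m ih =>
      have hx : x * a = a * x - x := by rw [dRel_D.ax]; abel
      rw [pow_succ', mul_assoc, ← mul_assoc x, hx, sub_mul, mul_assoc a x]
      exact sub_mem (a_mul_mem_ordSpan ih) ih
  have hb : ∀ l m n, x * (b ^ l * (a ^ m * x ^ n)) ∈ ordSpan := by
    intro l m n
    induction l with
    | zero => rw [pow_zero, one_mul]; exact ha m n
    | succ l ih =>
      have hx : x * b = b * x - eps • x := by rw [dRel_D.bx]; abel
      rw [pow_succ', mul_assoc, ← mul_assoc x, hx, sub_mul, mul_assoc b x, smul_mul_assoc]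
      exact sub_mem (b_mul_mem_ordSpan ih) (Submodule.smul_mem _ _ ih)
  refine mul_mem_ordSpan (fun k l m n => ?_) hd
  induction k with
  | zero => rw [pow_zero, one_mul]; exact hb l m n
  | succ k ih =>
    obtain ⟨r, hr⟩ := exists_oneSubExpDiv_eq (-(eps • a) + -b)
    rw [pow_succ', mul_assoc, ← mul_assoc x, dRel_D.xy, hr, add_mul, smul_mul_assoc, mul_assoc y x,
      neg_add, neg_neg, neg_neg, add_mul, add_mul, smul_mul_assoc, smul_mul_assoc]
    have hm := mul4_mem_ordSpan k l m n
    exact add_mem (Submodule.smul_mem _ _ (y_mul_mem_ordSpan ih))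
      (add_mem (add_mem (Submodule.smul_mem _ _ (a_mul_mem_ordSpan hm)) (b_mul_mem_ordSpan hm))
        (hbar_smul_mem_ordSpan _))

theorem mem_ordSpan (d : D) : d ∈ ordSpan := by
  have h1 : ∀ w : FreeAlgebra K Gen, ∀ d ∈ ordSpan, toD (of w) * d ∈ ordSpan := by
    intro w
    induction w using FreeAlgebra.induction with
    | grade0 r =>
      intro d hd
      rw [AlgHom.commutes, AlgHom.commutes, ← Algebra.smul_def]
      exact Submodule.smul_mem _ _ hd
    | grade1 g =>
      intro d hd
      cases g
      exacts [y_mul_mem_ordSpan hd, b_mul_mem_ordSpan hd, a_mul_mem_ordSpan hd,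
        x_mul_mem_ordSpan hd]
    | mul u v hu hv =>
      intro d hd
      rw [map_mul, map_mul, mul_assoc]
      exact hu _ (hv _ hd)
    | add u v hu hv =>
      intro d hd
      rw [map_add, map_add, add_mul]
      exact add_mem (hu _ hd) (hv _ hd)
  obtain ⟨t, r, rfl⟩ := exists_of_add_hbar_smul d
  refine add_mem ?_ (hbar_smul_mem_ordSpan r)
  obtain ⟨z, rfl⟩ := RingQuot.mkAlgHom_surjective K Rel t
  obtain ⟨w, s, rfl⟩ := exists_of_add_hbar_smul z
  rw [map_add, map_add, map_smul, map_smul]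
  refine add_mem ?_ (hbar_smul_mem_ordSpan _)
  have := h1 w 1 (by simpa using mul4_mem_ordSpan 0 0 0 0)
  rwa [mul_one] at this

theorem exists_ordPoly_add (d : D) : ∃ p, ∃ r, d = ordPoly p + hbar • r := by
  induction mem_ordSpan d using Submodule.span_induction with
  | mem d hd =>
    rcases hd with ⟨s, rfl⟩ | ⟨r, rfl⟩
    · exact ⟨MvPolynomial.monomial s 1, 0, by rw [ordPoly_monomial, smul_zero, add_zero]⟩
    · exact ⟨0, r, by simp [ordPoly]⟩
  | zero => exact ⟨0, 0, by simp [ordPoly]⟩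
  | add d d' _ _ h h' =>
    obtain ⟨p, r, hp⟩ := h
    obtain ⟨p', r', hp'⟩ := h'
    exact ⟨p + p', r + r', by rw [hp, hp', ordPoly_add, smul_add]; abel⟩
  | smul c d _ h =>
    obtain ⟨p, r, hp⟩ := h
    have hc := powerSeries_eq_sum_add c 1
    simp only [Finset.range_one, Finset.sum_singleton, pow_zero, one_mul, pow_one] at hc
    refine ⟨MvPolynomial.C (PowerSeries.coeff 0 c) * p,
      c • r + (PowerSeries.mk fun k => PowerSeries.coeff (k + 1) c) • ordPoly p, ?_⟩
    have h1 : c • ordPoly p = PowerSeries.C (PowerSeries.coeff 0 c) • ordPoly p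
        + hbar • (PowerSeries.mk fun k => PowerSeries.coeff (k + 1) c) • ordPoly p := by
      rw [smul_smul, ← add_smul]
      exact congrArg (· • ordPoly p) hc
    rw [hp, ordPoly_C_mul, smul_add, smul_add, h1, smul_comm c hbar r]
    abel

theorem ordering_surjective : Function.Surjective ordering := by
  intro d
  obtain ⟨c, hc, hd⟩ := exists_isHSum_of_approx (Set.range ordPoly)
    (fun d => by
      obtain ⟨p, r, h⟩ := exists_ordPoly_add d
      exact ⟨_, ⟨p, rfl⟩, r, h⟩) d
  choose p hp using hc
  refine ⟨PowerSeries.mk p, ?_⟩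
  rw [ordering_eq, hd.eq_hsum]
  simp [hp]

end Spanning

/-! ### Power series rings are complete -/

section PowerSeriesComplete

theorem powerSeries_eq_zero {R : Type*} [CommRing R] {f : PowerSeries R}
    (h : ∀ n, ∃ r, f = PowerSeries.X ^ n * r) : f = 0 := by
  ext n
  obtain ⟨r, hr⟩ := h (n + 1)
  rw [hr, PowerSeries.coeff_X_pow_mul', if_neg (by omega), map_zero]

theorem powerSeries_exists_sum {R : Type*} [CommRing R] (c : ℕ → PowerSeries R) :
    ∃ s, ∀ n, ∃ r, s = ∑ k ∈ Finset.range n, PowerSeries.X ^ k * c k + PowerSeries.X ^ n * r := by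
  refine ⟨PowerSeries.mk fun m => ∑ k ∈ Finset.range (m + 1), PowerSeries.coeff (m - k) (c k),
    fun n => ?_⟩
  suffices h : PowerSeries.X ^ n ∣ (PowerSeries.mk fun m => ∑ k ∈ Finset.range (m + 1),
      PowerSeries.coeff (m - k) (c k)) - ∑ k ∈ Finset.range n, PowerSeries.X ^ k * c k by
    obtain ⟨r, hr⟩ := h
    exact ⟨r, by rw [← hr]; abel⟩
  rw [PowerSeries.X_pow_dvd_iff]
  intro m hm
  rw [map_sub, PowerSeries.coeff_mk, map_sum, sub_eq_zero]
  simp only [PowerSeries.coeff_X_pow_mul']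
  rw [← Finset.sum_filter]
  refine Finset.sum_congr ?_ fun _ _ => rfl
  ext k
  simp only [Finset.mem_range, Finset.mem_filter]
  omega

instance : HComplete K where
  eq_zero _ h := powerSeries_eq_zero h
  exists_sum c := powerSeries_exists_sum c

/-- The polynomial ring `ℚ[ε, y, b, a, x]`. -/
abbrev Poly : Type := MvPolynomial Gen (Polynomial ℚ)

/-- The ring `ℚ[ε, y, b, a, x]⟦ħ⟧`. -/
abbrev PolyH : Type := PowerSeries Poly

theorem hbar_smul_polyH (f : PolyH) : hbar • f = PowerSeries.X * f := by
  rw [Algebra.smul_def, PowerSeries.algebraMap_apply'', hbar, PowerSeries.map_X]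

theorem hbar_pow_smul_polyH (n : ℕ) (f : PolyH) : hbar ^ n • f = PowerSeries.X ^ n * f := by
  rw [Algebra.smul_def, PowerSeries.algebraMap_apply'', hbar, map_pow, PowerSeries.map_X]

instance : HComplete PolyH where
  eq_zero f h := powerSeries_eq_zero fun n => by simpa only [hbar_pow_smul_polyH] using h n
  exists_sum c := by
    obtain ⟨s, hs⟩ := powerSeries_exists_sum c
    exact ⟨s, fun n => by simpa only [hbar_pow_smul_polyH] using hs n⟩

theorem eq_zero_of_hbar_smul_polyH {f : PolyH} (h : hbar • f = 0) : f = 0 := by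
  rw [hbar_smul_polyH] at h
  exact (mul_eq_zero.1 h).resolve_left PowerSeries.X_ne_zero

end PowerSeriesComplete

/-! ### The universal Verma module -/

section Verma

/-- The underlying module of the Verma module: the coordinates are those with respect to the
vectors `yᵏ v`, where `v` is killed by `x`. -/
abbrev Verma : Type := ℕ → PolyH

/-- The value of `b` on `yᵏ v`. -/
def vb (k : ℕ) : PolyH := PowerSeries.C (MvPolynomial.X .b) - (k : PolyH) * algebraMap K PolyH eps

/-- The value of `a` on `yᵏ v`. -/
def va (k : ℕ) : PolyH := PowerSeries.C (MvPolynomial.X .a) - (k : PolyH)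

/-- The value of `(1 - AB) / ħ` on `yᵏ v`. -/
def vz (k : ℕ) : PolyH := freeLift (tuple 0 (vb k) (va k) 0) oneSubABDiv

/-- The coefficient in `x yᵏ v = dₖ yᵏ⁻¹ v`. -/
def vd : ℕ → PolyH
  | 0 => 0
  | k + 1 => q • vd k + vz k

/-- Diagonal operators. -/
def diag : (ℕ → PolyH) →ₐ[K] Module.End PolyH Verma :=
  (Algebra.lmul PolyH Verma).restrictScalars K

@[simp] theorem diag_apply (f : ℕ → PolyH) (v : Verma) (k : ℕ) : diag f v k = f k * v k := rfl

/-- The operator `y`. -/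
def opY : Module.End PolyH Verma where
  toFun v k := if k = 0 then 0 else v (k - 1)
  map_add' v w := by funext k; by_cases h : k = 0 <;> simp [h]
  map_smul' c v := by funext k; by_cases h : k = 0 <;> simp [h]

/-- The operator `x`. -/
def opX : Module.End PolyH Verma where
  toFun v k := vd (k + 1) * v (k + 1)
  map_add' v w := by funext k; simp [mul_add]
  map_smul' c v := by funext k; simp; ring

theorem opX_apply (v : Verma) (k : ℕ) : opX v k = vd (k + 1) * v (k + 1) := rfl

theorem opY_apply_zero (v : Verma) : opY v 0 = 0 := rfl

theorem opY_apply_succ (v : Verma) (k : ℕ) : opY v (k + 1) = v k := rfl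

/-- The images of the generators in the Verma module. -/
def vermaGen : Gen → Module.End PolyH Verma := tuple opY (diag vb) (diag va) opX

theorem algHom_ext_freeC {H : Type*} [Ring H] [Algebra K H] [HSep H] {f g : FreeC →ₐ[K] H}
    (h : ∀ i, f (gen i) = g (gen i)) : f = g :=
  Compl.algHom_ext fun t => DFunLike.congr_fun
    (FreeAlgebra.hom_ext (funext h) : f.comp of = g.comp (of : FreeAlgebra K Gen →ₐ[K] _)) t

theorem freeLift_oneSubABDiv {H : Type*} [Ring H] [Algebra K H] [HComplete H] (y b a x : H) :
    freeLift (tuple y b a x) oneSubABDiv = freeLift (tuple 0 b a 0) oneSubABDiv := by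
  have h1 : (freeLift (tuple y b a x)).comp (freeLift (tuple 0 (gen .b) (gen .a) 0))
      = freeLift (tuple 0 b a 0) := by
    refine algHom_ext_freeC fun g => ?_
    cases g <;> simp [tuple]
  rw [← h1, AlgHom.comp_apply]
  congr 1
  simp [oneSubABDiv, algHom_oneSubExpDiv, algHom_hexp, tuple]

theorem freeLift_vermaGen : freeLift vermaGen oneSubABDiv = diag vz := by
  rw [vermaGen, freeLift_oneSubABDiv]
  have h1 : ∀ k, (Pi.evalAlgHom K (fun _ : ℕ => PolyH) k).comp
      (freeLift (tuple (0 : ℕ → PolyH) vb va 0)) = freeLift (tuple 0 (vb k) (va k) 0) := by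
    intro k
    refine algHom_ext_freeC fun g => ?_
    cases g <;> simp [tuple]
  have h2 : diag.comp (freeLift (tuple (0 : ℕ → PolyH) vb va 0))
      = freeLift (tuple (0 : Module.End PolyH Verma) (diag vb) (diag va) 0) := by
    refine algHom_ext_freeC (H := Module.End PolyH Verma) fun g => ?_
    cases g <;> simp [tuple]
  rw [← h2, AlgHom.comp_apply]
  congr 1
  funext k
  exact DFunLike.congr_fun (h1 k) oneSubABDiv

theorem eps_smul_polyH (f : PolyH) : eps • f = algebraMap K PolyH eps * f := Algebra.smul_def _ _

theorem verma_rel ⦃r s : FreeC⦄ (hr : Rel r s) : freeLift vermaGen r = freeLift vermaGen s := by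
  cases hr with
  | xy =>
    rw [map_mul, map_add, map_smul, map_mul, freeLift_vermaGen]
    simp only [freeLift_gen, vermaGen, tuple]
    refine LinearMap.ext fun v => funext fun k => ?_
    simp only [Module.End.mul_apply, LinearMap.add_apply, LinearMap.smul_apply, Pi.add_apply,
      Pi.smul_apply, opX_apply, opY_apply_succ, diag_apply, vd]
    cases k with
    | zero => rw [opY_apply_zero, vd]; simp
    | succ k => rw [opY_apply_succ, opX_apply, add_mul, smul_mul_assoc]
  | ax =>
    simp only [map_sub, map_mul, freeLift_gen, vermaGen, tuple]
    refine LinearMap.ext fun v => funext fun k => ?_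
    simp only [Module.End.mul_apply, LinearMap.sub_apply, Pi.sub_apply, opX_apply, diag_apply, va]
    push_cast
    ring
  | bx =>
    simp only [map_sub, map_mul, map_smul, freeLift_gen, vermaGen, tuple]
    refine LinearMap.ext fun v => funext fun k => ?_
    simp only [Module.End.mul_apply, LinearMap.sub_apply, Pi.sub_apply, opX_apply, diag_apply, vb,
      LinearMap.smul_apply, Pi.smul_apply, eps_smul_polyH]
    push_cast
    ring
  | ay =>
    simp only [map_sub, map_mul, map_neg, freeLift_gen, vermaGen, tuple]
    refine LinearMap.ext fun v => funext fun k => ?_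
    simp only [Module.End.mul_apply, LinearMap.sub_apply, Pi.sub_apply, diag_apply, va,
      LinearMap.neg_apply, Pi.neg_apply]
    cases k with
    | zero => simp [opY_apply_zero]
    | succ k =>
      simp only [opY_apply_succ, diag_apply, va]
      push_cast
      ring
  | by' =>
    simp only [map_sub, map_mul, map_neg, map_smul, freeLift_gen, vermaGen, tuple]
    refine LinearMap.ext fun v => funext fun k => ?_
    simp only [Module.End.mul_apply, LinearMap.sub_apply, Pi.sub_apply, diag_apply, vb,
      LinearMap.neg_apply, Pi.neg_apply, LinearMap.smul_apply, Pi.smul_apply, eps_smul_polyH]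
    cases k with
    | zero => simp [opY_apply_zero]
    | succ k =>
      simp only [opY_apply_succ, diag_apply, vb]
      push_cast
      ring
  | ab =>
    simp only [map_sub, map_mul, map_zero, freeLift_gen, vermaGen, tuple]
    rw [← map_mul, ← map_mul, mul_comm, sub_self]

/-- The Verma module as a representation of `𝔻`. -/
def verma : D →ₐ[K] Module.End PolyH Verma := liftD vermaGen verma_rel

theorem verma_y : verma y = opY := liftD_dgen _ _ _

theorem verma_b : verma b = diag vb := liftD_dgen _ _ _

theorem verma_a : verma a = diag va := liftD_dgen _ _ _

theorem verma_x : verma x = opX := liftD_dgen _ _ _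

/-- The vector `yᵏ v`. -/
def ve (k : ℕ) : Verma := Pi.single k 1

theorem diag_ve (f : ℕ → PolyH) (k : ℕ) : diag f (ve k) = f k • ve k := by
  funext i
  rcases eq_or_ne i k with rfl | h <;> simp [ve, *]

theorem verma_y_ve (k : ℕ) : verma y (ve k) = ve (k + 1) := by
  rw [verma_y]
  funext i
  cases i with
  | zero => rw [opY_apply_zero]; simp [ve]
  | succ i => rw [opY_apply_succ]; simp [ve, Pi.single_apply]

theorem verma_x_ve (k : ℕ) : verma x (ve k) = vd k • ve (k - 1) := by
  rw [verma_x]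
  funext i
  rw [opX_apply]
  cases k with
  | zero => simp [ve, vd]
  | succ k =>
    rcases eq_or_ne i k with rfl | h <;> simp [ve, *]

theorem verma_b_ve (k : ℕ) : verma b (ve k) = vb k • ve k := by rw [verma_b, diag_ve]

theorem verma_a_ve (k : ℕ) : verma a (ve k) = va k • ve k := by rw [verma_a, diag_ve]

end Verma

/-! ### The Verma module is faithful -/

section Faithful

theorem verma_hbar_smul (d : D) (v : Verma) : verma (hbar • d) v = hbar • verma d v := by
  rw [map_smul, LinearMap.smul_apply]

theorem verma_y_pow_ve (j k : ℕ) : verma (y ^ j) (ve k) = ve (k + j) := by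
  induction j with
  | zero => simp
  | succ j ih => rw [pow_succ', map_mul, Module.End.mul_apply, ih, verma_y_ve, add_assoc]

theorem verma_pow_ve {d : D} {c : PolyH} {k : ℕ} (h : verma d (ve k) = c • ve k) (j : ℕ) :
    verma (d ^ j) (ve k) = c ^ j • ve k := by
  induction j with
  | zero => simp
  | succ j ih =>
    rw [pow_succ', map_mul, Module.End.mul_apply, ih, map_smul, h, smul_smul, pow_succ]

/-- The coefficient in `xʲ yⁿ v = vD n j yⁿ⁻ʲ v`. -/
def vD (n j : ℕ) : PolyH := ∏ i ∈ Finset.range j, vd (n - i)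

theorem verma_x_pow_ve (j n : ℕ) : verma (x ^ j) (ve n) = vD n j • ve (n - j) := by
  induction j with
  | zero => simp [vD]
  | succ j ih =>
    rw [pow_succ', map_mul, Module.End.mul_apply, ih, map_smul, verma_x_ve, smul_smul, vD, vD,
      Finset.prod_range_succ, Nat.sub_sub]

theorem vD_eq_zero {n j : ℕ} (h : n < j) : vD n j = 0 :=
  Finset.prod_eq_zero (Finset.mem_range.2 h) (by rw [Nat.sub_self, vd])

theorem verma_mono_ve (s : Gen →₀ ℕ) (n : ℕ) :
    verma (mono s) (ve n) =
      (vD n (s .x) * va (n - s .x) ^ s .a * vb (n - s .x) ^ s .b) • ve (n - s .x + s .y) := by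
  rw [mono, map_mul, map_mul, map_mul, Module.End.mul_apply, verma_x_pow_ve, map_smul,
    Module.End.mul_apply, verma_pow_ve (verma_a_ve _), Module.End.mul_apply, map_smul,
    verma_pow_ve (verma_b_ve _), map_smul, map_smul, verma_y_pow_ve, smul_smul, smul_smul]

/-- Reduction modulo `ħ`. -/
def modH : PolyH →+* Poly := PowerSeries.constantCoeff

theorem modH_hbar_smul (f : PolyH) : modH (hbar • f) = 0 := by
  simp [hbar_smul_polyH, modH]

theorem constantCoeff_q : PowerSeries.constantCoeff q = 1 := by
  rw [← PowerSeries.coeff_zero_eq_constantCoeff_apply]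
  simp [q]

theorem modH_smul (c : K) (f : PolyH) :
    modH (c • f) = MvPolynomial.C (PowerSeries.constantCoeff c) * modH f := by
  rw [Algebra.smul_def, map_mul, PowerSeries.algebraMap_apply'']
  congr 1

theorem exists_oneSubABDiv_eq : ∃ r, oneSubABDiv = eps • gen .a + gen .b + hbar • r := by
  obtain ⟨r, hr⟩ := exists_oneSubExpDiv_eq (-(eps • gen .a))
  obtain ⟨s, hs⟩ := exists_oneSubExpDiv_eq (-gen .b)
  obtain ⟨c, hc⟩ := exists_hexp_eq (-(eps • gen .a))
  refine ⟨r + s + c * (gen .b + hbar • s), ?_⟩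
  rw [oneSubABDiv, hr, hs, hc, neg_neg, neg_neg, add_mul, one_mul, smul_add, smul_add,
    smul_mul_assoc]
  abel

theorem modH_vz (k : ℕ) : modH (vz k) = MvPolynomial.C Polynomial.X * MvPolynomial.X .a
    + MvPolynomial.X .b - (2 * k : Poly) * MvPolynomial.C Polynomial.X := by
  obtain ⟨r, hr⟩ := exists_oneSubABDiv_eq
  have h : vz k = eps • va k + vb k
      + hbar • freeLift (tuple 0 (vb k) (va k) 0) r := by
    rw [vz, hr]
    simp only [map_add, map_smul, freeLift_gen, tuple]
  rw [h, map_add, map_add, modH_hbar_smul, modH_smul]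
  simp only [va, vb, map_sub, map_mul, map_natCast, PowerSeries.algebraMap_apply'']
  simp [modH, eps, MvPolynomial.algebraMap_eq]
  ring

theorem coeff_modH_vd (k : ℕ) :
    (modH (vd k)).coeff (Finsupp.single .b 1) = (k : Polynomial ℚ) := by
  induction k with
  | zero => simp [vd]
  | succ k ih =>
    classical
    have h1 : ((2 * k : Poly) * MvPolynomial.C Polynomial.X)
        = MvPolynomial.C (2 * k * Polynomial.X) := by
      rw [map_mul, map_mul, map_natCast, map_ofNat]
    rw [vd, map_add, modH_smul, constantCoeff_q, map_one, one_mul, modH_vz, h1]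
    rw [MvPolynomial.coeff_add, ih, MvPolynomial.coeff_sub, MvPolynomial.coeff_add,
      MvPolynomial.coeff_C_mul, MvPolynomial.coeff_X, MvPolynomial.coeff_X, MvPolynomial.coeff_C,
      if_neg, if_pos rfl, if_neg]
    · simp
    · intro h
      simpa using DFunLike.congr_fun h .b
    · intro h
      simpa using DFunLike.congr_fun h .b

theorem modH_vd_ne_zero {k : ℕ} (h : k ≠ 0) : modH (vd k) ≠ 0 := by
  intro h0
  have := coeff_modH_vd k
  rw [h0, MvPolynomial.coeff_zero] at this
  exact h (by exact_mod_cast this.symm)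

theorem modH_vD_ne_zero (n : ℕ) : modH (vD n n) ≠ 0 := by
  rw [vD, map_prod, Finset.prod_ne_zero_iff]
  intro i hi
  have := Finset.mem_range.1 hi
  exact modH_vd_ne_zero (by omega)

theorem modH_va_zero : modH (va 0) = MvPolynomial.X .a := by simp [va, modH]

theorem modH_vb_zero : modH (vb 0) = MvPolynomial.X .b := by simp [vb, modH]

theorem modH_verma_ordPoly (p : Poly) (n r : ℕ) :
    modH (verma (ordPoly p) (ve n) r) = ∑ s ∈ p.support, if r = n - s .x + s .y then
      MvPolynomial.C (p.coeff s) *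
        (modH (vD n (s .x)) * modH (va (n - s .x)) ^ s .a * modH (vb (n - s .x)) ^ s .b)
      else 0 := by
  rw [ordPoly, map_sum, LinearMap.sum_apply, Finset.sum_apply, map_sum]
  refine Finset.sum_congr rfl fun s _ => ?_
  rw [map_smul, LinearMap.smul_apply, verma_mono_ve, Pi.smul_apply, modH_smul, Pi.smul_apply,
    smul_eq_mul, ve, Pi.single_apply, PowerSeries.constantCoeff_C]
  split_ifs <;> simp

theorem eq_zero_of_modH_verma {p : Poly} (h : ∀ n r, modH (verma (ordPoly p) (ve n) r) = 0) :
    p = 0 := by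
  classical
  have key : ∀ n, ∀ s ∈ p.support, s .x ≠ n := by
    intro n
    induction n using Nat.strong_induction_on with
    | _ n ih =>
    intro s₀ hs₀ hn
    have h0 := h n (s₀ .y)
    rw [modH_verma_ordPoly] at h0
    have h1 : ∑ s ∈ p.support, (if s₀ .y = n - s .x + s .y then
        MvPolynomial.C (p.coeff s) *
          (modH (vD n (s .x)) * modH (va (n - s .x)) ^ s .a * modH (vb (n - s .x)) ^ s .b)
        else 0) = modH (vD n n) * ∑ s ∈ p.support, if s .x = n ∧ s .y = s₀ .y then
          MvPolynomial.monomial (expo 0 (s .b) (s .a) 0) (p.coeff s) else 0 := by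
      rw [Finset.mul_sum]
      refine Finset.sum_congr rfl fun s hs => ?_
      rcases lt_trichotomy (s .x) n with hlt | heq | hgt
      · exact absurd rfl (ih _ hlt s hs)
      · rw [heq, Nat.sub_self, zero_add, modH_va_zero, modH_vb_zero]
        by_cases hy : s₀ .y = s .y
        · have hm : MvPolynomial.monomial (expo 0 (s .b) (s .a) 0) (p.coeff s)
              = MvPolynomial.C (p.coeff s)
                * (MvPolynomial.X .a ^ s .a * MvPolynomial.X .b ^ s .b) := by
            rw [MvPolynomial.X_pow_eq_monomial, MvPolynomial.X_pow_eq_monomial,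
              MvPolynomial.monomial_mul, MvPolynomial.C_mul_monomial]
            have he : expo 0 (s .b) (s .a) 0
                = Finsupp.single .a (s .a) + Finsupp.single .b (s .b) := by
              refine Finsupp.ext fun g => ?_
              cases g <;> simp [expo, tuple]
            rw [he, mul_one, mul_one]
          rw [if_pos hy, if_pos ⟨rfl, hy.symm⟩, hm]
          ring
        · rw [if_neg hy, if_neg fun h => hy h.2.symm, mul_zero]
      · rw [vD_eq_zero hgt, map_zero, zero_mul, zero_mul, mul_zero, ite_self,
          if_neg fun h => hgt.ne' h.1, mul_zero]
    rw [h1] at h0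
    have h2 := (mul_eq_zero.1 h0).resolve_left (modH_vD_ne_zero n)
    have h3 := congrArg (MvPolynomial.coeff (expo 0 (s₀ .b) (s₀ .a) 0)) h2
    rw [MvPolynomial.coeff_sum, MvPolynomial.coeff_zero, Finset.sum_eq_single s₀] at h3
    · rw [if_pos ⟨hn, rfl⟩, MvPolynomial.coeff_monomial, if_pos rfl] at h3
      exact MvPolynomial.mem_support_iff.1 hs₀ h3
    · intro s _ hne
      split_ifs with hc
      · rw [MvPolynomial.coeff_monomial, if_neg]
        intro he
        refine hne (Finsupp.ext fun g => ?_)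
        cases g
        · exact hc.2
        · simpa [expo, tuple] using DFunLike.congr_fun he .b
        · simpa [expo, tuple] using DFunLike.congr_fun he .a
        · exact hc.1.trans hn.symm
      · exact MvPolynomial.coeff_zero _
    · exact fun h => absurd hs₀ h
  rw [← MvPolynomial.support_eq_empty, Finset.eq_empty_iff_forall_notMem]
  exact fun s hs => key _ s hs rfl

theorem eq_zero_of_verma_ordering {f : PolyH} (h : ∀ n, verma (ordering f) (ve n) = 0) :
    f = 0 := by
  have key : ∀ m (f : PolyH), (∀ n, verma (ordering f) (ve n) = 0) →
      PowerSeries.coeff m f = 0 := by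
    have h0 : ∀ f : PolyH, (∀ n, verma (ordering f) (ve n) = 0) → PowerSeries.coeff 0 f = 0 := by
      intro f hf
      refine eq_zero_of_modH_verma fun n r => ?_
      have h1 := congrArg modH (congrFun (hf n) r)
      rw [ordering_eq, hsum_succ, map_add, LinearMap.add_apply, Pi.add_apply, map_add,
        verma_hbar_smul, Pi.smul_apply, modH_hbar_smul, add_zero] at h1
      rw [h1, Pi.zero_apply, map_zero]
    intro m
    induction m with
    | zero => exact h0
    | succ m ih =>
      intro f hf
      have h1 := ih (PowerSeries.mk fun k => PowerSeries.coeff (k + 1) f) fun n => by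
        funext r
        refine eq_zero_of_hbar_smul_polyH ?_
        have h2 := congrFun (hf n) r
        rw [ordering_eq, hsum_succ, h0 f hf, map_add, LinearMap.add_apply, Pi.add_apply,
          verma_hbar_smul, Pi.smul_apply] at h2
        simpa [ordPoly, ordering_eq] using h2
      simpa using h1
  exact PowerSeries.ext fun m => by rw [key m f h, map_zero]

theorem verma_faithful {d : D} (h : ∀ n, verma d (ve n) = 0) : d = 0 := by
  obtain ⟨f, rfl⟩ := ordering_surjective d
  rw [eq_zero_of_verma_ordering h, ordering_eq]
  exact (isHSum_hsum _).unique fun n => ⟨0, by simp [ordPoly]⟩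

theorem ordering_sub (f g : PolyH) : ordering (f - g) = ordering f - ordering g := by
  have h : ∀ p p' : Poly, ordPoly (p - p') = ordPoly p - ordPoly p' := fun p p' => by
    rw [eq_sub_iff_add_eq, ← ordPoly_add, sub_add_cancel]
  simp only [ordering_eq, map_sub, h, hsum_sub]

theorem ordering_bijective : Function.Bijective ordering := by
  refine ⟨fun f g hfg => sub_eq_zero.1 (eq_zero_of_verma_ordering fun n => ?_),
    ordering_surjective⟩
  rw [ordering_sub, hfg, sub_self, map_zero, LinearMap.zero_apply]

end Faithful

/-! ### Completed tensor powers -/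

section Tensor

variable {H : Type*} [Ring H] [Algebra K H]

theorem ten_mul_ten (s t s' t' : H) : ten s t * ten s' t' = ten (s * s') (t * t') := by
  rw [ten, ten, ten, ← map_mul, Algebra.TensorProduct.tmul_mul_tmul]

theorem ten_one_one : ten (1 : H) 1 = 1 := map_one of

/-- `s ↦ s ⊗ 1`. -/
def tenL : H →ₐ[K] Ten2 H := of.comp Algebra.TensorProduct.includeLeft

/-- `s ↦ 1 ⊗ s`. -/
def tenR : H →ₐ[K] Ten2 H := of.comp Algebra.TensorProduct.includeRight

theorem tenL_apply (s : H) : tenL s = ten s 1 := rfl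

theorem tenR_apply (s : H) : tenR s = ten 1 s := rfl

theorem ten_eq (s t : H) : ten s t = tenL s * tenR t := by
  rw [tenL_apply, tenR_apply, ten_mul_ten, mul_one, one_mul]

theorem tenL_tenR_commute (s t : H) : Commute (tenL s) (tenR t) := by
  rw [Commute, SemiconjBy, tenL_apply, tenR_apply, ten_mul_ten, ten_mul_ten]
  simp

theorem Ten2.linearMap_ext {N : Type*} [AddCommGroup N] [Module K N] [HSep N]
    {f g : Ten2 H →ₗ[K] N} (h : ∀ s t, f (ten s t) = g (ten s t)) : f = g :=
  Compl.linearMap_ext fun t => LinearMap.congr_fun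
    (TensorProduct.ext' h : f ∘ₗ of.toLinearMap = g ∘ₗ of.toLinearMap) t

/-- `s ⊗ t ⊗ r` as an element of the completed tensor cube. -/
def ten3 (s t r : H) : Ten3 H := of ((s ⊗ₜ[K] t) ⊗ₜ[K] r)

theorem ten3_mul_ten3 (s t r s' t' r' : H) :
    ten3 s t r * ten3 s' t' r' = ten3 (s * s') (t * t') (r * r') := by
  rw [ten3, ten3, ten3, ← map_mul, Algebra.TensorProduct.tmul_mul_tmul,
    Algebra.TensorProduct.tmul_mul_tmul]

/-- The homomorphism given by homomorphisms on the two factors with commuting images. -/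
def ten2Lift {T : Type*} [Ring T] [Algebra K T] (f g : H →ₐ[K] Compl T)
    (h : ∀ s t, Commute (f s) (g t)) : Ten2 H →ₐ[K] Compl T :=
  extendAlg (Algebra.TensorProduct.lift f g h)

section

variable {T : Type*} [Ring T] [Algebra K T] (f g : H →ₐ[K] Compl T)
  (h : ∀ s t, Commute (f s) (g t))

theorem ten2Lift_ten (s t : H) : ten2Lift f g h (ten s t) = f s * g t := by
  rw [ten2Lift, ten, extendAlg_of, Algebra.TensorProduct.lift_tmul]

theorem ten2Lift_tenL (s : H) : ten2Lift f g h (tenL s) = f s := by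
  rw [tenL_apply, ten2Lift_ten, map_one, mul_one]

theorem ten2Lift_tenR (s : H) : ten2Lift f g h (tenR s) = g s := by
  rw [tenR_apply, ten2Lift_ten, map_one, one_mul]

end

theorem flip_ten (s t : H) : flip (ten s t) = ten t s := by
  rw [flip, complMap, ten, extend_of]
  rfl

theorem tenR_tenL_commute (s t : H) : Commute (tenR s) (tenL t) := (tenL_tenR_commute t s).symm

/-- The flip as a homomorphism. -/
def flipA : Ten2 H →ₐ[K] Ten2 H := ten2Lift tenR tenL tenR_tenL_commute

theorem flipA_apply (X : Ten2 H) : flipA X = flip X :=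
  LinearMap.congr_fun (Ten2.linearMap_ext (f := flipA.toLinearMap) (g := flip) fun s t => by
    rw [AlgHom.toLinearMap_apply, flipA, ten2Lift_ten, flip_ten, ten_eq]
    exact tenR_tenL_commute s t) X

theorem flip_mul (X Y : Ten2 H) : flip (X * Y) = flip X * flip Y := by
  simp only [← flipA_apply, map_mul]

theorem flip_one : flip (1 : Ten2 H) = 1 := by rw [← flipA_apply, map_one]

/-- `s ↦ s ⊗ 1 ⊗ 1`. -/
def l1 : H →ₐ[K] Ten3 H :=
  of.comp (Algebra.TensorProduct.includeLeft.comp Algebra.TensorProduct.includeLeft)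

/-- `s ↦ 1 ⊗ s ⊗ 1`. -/
def l2 : H →ₐ[K] Ten3 H :=
  of.comp (Algebra.TensorProduct.includeLeft.comp Algebra.TensorProduct.includeRight)

/-- `s ↦ 1 ⊗ 1 ⊗ s`. -/
def l3 : H →ₐ[K] Ten3 H := of.comp Algebra.TensorProduct.includeRight

theorem l1_apply (s : H) : l1 s = ten3 s 1 1 := rfl

theorem l2_apply (s : H) : l2 s = ten3 1 s 1 := rfl

theorem l3_apply (s : H) : l3 s = ten3 1 1 s := rfl

theorem l1_l2_commute (s t : H) : Commute (l1 s) (l2 t) := by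
  rw [Commute, SemiconjBy, l1_apply, l2_apply, ten3_mul_ten3, ten3_mul_ten3]; simp

theorem l1_l3_commute (s t : H) : Commute (l1 s) (l3 t) := by
  rw [Commute, SemiconjBy, l1_apply, l3_apply, ten3_mul_ten3, ten3_mul_ten3]; simp

theorem l2_l3_commute (s t : H) : Commute (l2 s) (l3 t) := by
  rw [Commute, SemiconjBy, l2_apply, l3_apply, ten3_mul_ten3, ten3_mul_ten3]; simp

/-- `leg12` as a homomorphism. -/
def l12 : Ten2 H →ₐ[K] Ten3 H := ten2Lift l1 l2 l1_l2_commute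

/-- `leg13` as a homomorphism. -/
def l13 : Ten2 H →ₐ[K] Ten3 H := ten2Lift l1 l3 l1_l3_commute

/-- `leg23` as a homomorphism. -/
def l23 : Ten2 H →ₐ[K] Ten3 H := ten2Lift l2 l3 l2_l3_commute

theorem l12_ten (s t : H) : l12 (ten s t) = ten3 s t 1 := by
  rw [l12, ten2Lift_ten, l1_apply, l2_apply, ten3_mul_ten3]; simp

theorem l13_ten (s t : H) : l13 (ten s t) = ten3 s 1 t := by
  rw [l13, ten2Lift_ten, l1_apply, l3_apply, ten3_mul_ten3]; simp

theorem l23_ten (s t : H) : l23 (ten s t) = ten3 1 s t := by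
  rw [l23, ten2Lift_ten, l2_apply, l3_apply, ten3_mul_ten3]; simp

theorem leg12_eq : leg12 = (l12 : Ten2 H →ₐ[K] Ten3 H).toLinearMap :=
  Ten2.linearMap_ext fun s t => by
    rw [AlgHom.toLinearMap_apply, l12_ten, leg12, complMap, ten, extend_of]; rfl

theorem leg13_eq : leg13 = (l13 : Ten2 H →ₐ[K] Ten3 H).toLinearMap :=
  Ten2.linearMap_ext fun s t => by
    rw [AlgHom.toLinearMap_apply, l13_ten, leg13, complMap, ten, extend_of]; rfl

theorem leg23_eq : leg23 = (l23 : Ten2 H →ₐ[K] Ten3 H).toLinearMap :=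
  Ten2.linearMap_ext fun s t => by
    rw [AlgHom.toLinearMap_apply, l23_ten, leg23, complMap, ten, extend_of]; rfl

theorem leg1_eq : leg1 = (l1 : H →ₐ[K] Ten3 H).toLinearMap := rfl

theorem leg3_eq : leg3 = (l3 : H →ₐ[K] Ten3 H).toLinearMap := rfl

theorem l12_l3_commute (X : Ten2 H) (r : H) : Commute (l12 X) (l3 r) :=
  LinearMap.congr_fun (Ten2.linearMap_ext
    (f := LinearMap.mulRight K (l3 r) ∘ₗ l12.toLinearMap)
    (g := LinearMap.mulLeft K (l3 r) ∘ₗ l12.toLinearMap) fun s t => by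
      simp [l12_ten, l3_apply, ten3_mul_ten3]) X

theorem l1_l23_commute (r : H) (X : Ten2 H) : Commute (l1 r) (l23 X) :=
  LinearMap.congr_fun (Ten2.linearMap_ext
    (f := LinearMap.mulLeft K (l1 r) ∘ₗ l23.toLinearMap)
    (g := LinearMap.mulRight K (l1 r) ∘ₗ l23.toLinearMap) fun s t => by
      simp [l23_ten, l1_apply, ten3_mul_ten3]) X

theorem l12_comp_l3_commute (Δ : H →ₐ[K] Ten2 H) (s t : H) :
    Commute ((l12.comp Δ) s) (l3 t) :=
  l12_l3_commute (Δ s) t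

theorem l1_l23_comp_commute (Δ : H →ₐ[K] Ten2 H) (s t : H) :
    Commute (l1 s) ((l23.comp Δ) t) :=
  l1_l23_commute s (Δ t)

/-- `Δ ⊗ id` as a homomorphism. -/
def comulIdA (Δ : H →ₐ[K] Ten2 H) : Ten2 H →ₐ[K] Ten3 H :=
  ten2Lift (l12.comp Δ) l3 (l12_comp_l3_commute Δ)

/-- `id ⊗ Δ` as a homomorphism. -/
def idComulA (Δ : H →ₐ[K] Ten2 H) : Ten2 H →ₐ[K] Ten3 H :=
  ten2Lift l1 (l23.comp Δ) (l1_l23_comp_commute Δ)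

theorem comulId_apply (Δ : H →ₐ[K] Ten2 H) (X : Ten2 H) :
    comulId Δ.toLinearMap X = comulIdA Δ X :=
  LinearMap.congr_fun (Ten2.linearMap_ext (f := comulId Δ.toLinearMap)
    (g := (comulIdA Δ).toLinearMap) fun s t => by
      rw [AlgHom.toLinearMap_apply, comulIdA, ten2Lift_ten, comulId, leg12_eq, leg3_eq, ten,
        extend_of]
      rfl) X

theorem idComul_apply (Δ : H →ₐ[K] Ten2 H) (X : Ten2 H) :
    idComul Δ.toLinearMap X = idComulA Δ X :=
  LinearMap.congr_fun (Ten2.linearMap_ext (f := idComul Δ.toLinearMap)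
    (g := (idComulA Δ).toLinearMap) fun s t => by
      rw [AlgHom.toLinearMap_apply, idComulA, ten2Lift_ten, idComul, leg23_eq, leg1_eq, ten,
        extend_of]
      rfl) X

theorem comulIdA_tenL (Δ : H →ₐ[K] Ten2 H) (s : H) : comulIdA Δ (tenL s) = l12 (Δ s) :=
  ten2Lift_tenL _ _ _ _

theorem comulIdA_tenR (Δ : H →ₐ[K] Ten2 H) (s : H) : comulIdA Δ (tenR s) = l3 s :=
  ten2Lift_tenR _ _ _ _

theorem idComulA_tenL (Δ : H →ₐ[K] Ten2 H) (s : H) : idComulA Δ (tenL s) = l1 s :=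
  ten2Lift_tenL _ _ _ _

theorem idComulA_tenR (Δ : H →ₐ[K] Ten2 H) (s : H) : idComulA Δ (tenR s) = l23 (Δ s) :=
  ten2Lift_tenR _ _ _ _

theorem l12_tenL (s : H) : l12 (tenL s) = l1 s := ten2Lift_tenL _ _ _ _

theorem l12_tenR (s : H) : l12 (tenR s) = l2 s := ten2Lift_tenR _ _ _ _

theorem l13_tenL (s : H) : l13 (tenL s) = l1 s := ten2Lift_tenL _ _ _ _

theorem l13_tenR (s : H) : l13 (tenR s) = l3 s := ten2Lift_tenR _ _ _ _

theorem l23_tenL (s : H) : l23 (tenL s) = l2 s := ten2Lift_tenL _ _ _ _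

theorem l23_tenR (s : H) : l23 (tenR s) = l3 s := ten2Lift_tenR _ _ _ _

theorem flip_tenL (s : H) : flip (tenL s) = tenR s := flip_ten _ _

theorem flip_tenR (s : H) : flip (tenR s) = tenL s := flip_ten _ _

/-! ### Linear maps out of completed tensor powers -/

section Complete

variable [HComplete H]

/-- `s ⊗ t ↦ f s * g t`, with values in a complete algebra. -/
def mulD (f g : H →ₗ[K] H) : Ten2 H →ₗ[K] H := liftLin (mulLift f g)

theorem mulD_ten (f g : H →ₗ[K] H) (s t : H) : mulD f g (ten s t) = f s * g t := by
  rw [mulD, ten, liftLin_of]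
  simp [mulLift]

theorem mulMap_apply (f g : H →ₗ[K] H) (X : Ten2 H) : mulMap f g X = of (mulD f g X) :=
  LinearMap.congr_fun (Ten2.linearMap_ext (f := mulMap f g)
    (g := of.toLinearMap ∘ₗ mulD f g) fun s t => by
      rw [LinearMap.comp_apply, mulD_ten, mulMap, ten, extend_of]
      simp [mulLift]) X

end Complete

/-- `s ⊗ t ↦ f s ⊗ g t`. -/
def mapTen (f g : H →ₗ[K] H) : Ten2 H →ₗ[K] Ten2 H := complMap (TensorProduct.map f g)

theorem mapTen_ten (f g : H →ₗ[K] H) (s t : H) : mapTen f g (ten s t) = ten (f s) (g t) := by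
  rw [mapTen, complMap, ten, extend_of]
  rfl

/-- The linear map `s ⊗ t ⊗ r ↦ f s * g t * h r`. -/
def ten3Lift {T : Type*} [Ring T] [Algebra K T] (f g h : H →ₗ[K] Compl T) :
    Ten3 H →ₗ[K] Compl T :=
  extend (mulLift (mulLift f g) h)

theorem ten3Lift_ten3 {T : Type*} [Ring T] [Algebra K T] (f g h : H →ₗ[K] Compl T) (s t r : H) :
    ten3Lift f g h (ten3 s t r) = f s * g t * h r := by
  rw [ten3Lift, ten3, extend_of]
  simp [mulLift]

end Tensor

/-! ### The Hopf algebra structure of `𝔻` -/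

section Coproduct

variable {T U : Type*} [Ring T] [Algebra K T] [Ring U] [Algebra K U]

theorem DRel.map {y b a x : Compl T} (h : DRel y b a x) (f : Compl T →ₐ[K] Compl U) :
    DRel (f y) (f b) (f a) (f x) where
  xy := by
    rw [← map_mul, h.xy]
    simp [algHom_oneSubExpDiv]
  ax := by rw [← map_mul, h.ax, map_add, map_mul]
  bx := by rw [← map_mul, h.bx, map_add, map_mul, map_smul]
  ay := by rw [← map_mul, h.ay, map_sub, map_mul]
  by' := by rw [← map_mul, h.by', map_sub, map_mul, map_smul]
  ab := h.ab.map f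

theorem DRel.comul {y b a x : Compl T} (h : DRel y b a x) (f g : Compl T →ₐ[K] Compl U)
    (hc : ∀ s t, Commute (f s) (g t)) :
    DRel (g y + f y * g (hexp (-b))) (f b + g b) (f a + g a)
      (g x + f x * g (hexp (-(eps • a)))) where
  xy := by
    have hf := h.map f
    have hg := h.map g
    have e1 : g x * (f y * g (hexp (-b))) = q • (f y * g (hexp (-b)) * g x) := by
      rw [← mul_assoc, ← (hc y x).eq, mul_assoc, ← map_mul, h.x_B, map_smul, mul_smul_comm,
        map_mul, mul_assoc]
    have e2 : f x * g (hexp (-(eps • a))) * g y = q • (g y * (f x * g (hexp (-(eps • a))))) := by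
      rw [mul_assoc, ← map_mul, h.A_y, map_smul, mul_smul_comm, map_mul, ← mul_assoc,
        (hc x y).eq, mul_assoc]
    have hAB : g (hexp (-(eps • a))) * g (hexp (-b)) = g (hexp (-b)) * g (hexp (-(eps • a))) := by
      rw [← map_mul, ← map_mul, ← hexp_add (commute_smul_neg h.ab),
        ← hexp_add (commute_smul_neg h.ab).symm, add_comm]
    have e3 : f x * g (hexp (-(eps • a))) * (f y * g (hexp (-b)))
        = q • (f y * g (hexp (-b)) * (f x * g (hexp (-(eps • a)))))
          + f (oneSubExpDiv (-(eps • a) + -b)) * g (hexp (-(eps • a) + -b)) := by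
      have l1 : f x * g (hexp (-(eps • a))) * (f y * g (hexp (-b)))
          = f (x * y) * (g (hexp (-(eps • a))) * g (hexp (-b))) := by
        rw [mul_assoc, ← mul_assoc (g _), ← (hc y _).eq, map_mul]
        simp only [mul_assoc]
      have l2 : f y * g (hexp (-b)) * (f x * g (hexp (-(eps • a))))
          = f (y * x) * (g (hexp (-(eps • a))) * g (hexp (-b))) := by
        rw [hAB, mul_assoc, ← mul_assoc (g _), ← (hc x _).eq, map_mul]
        simp only [mul_assoc]
      rw [l1, l2, h.xy, map_add, add_mul, h.hexp_AB, map_mul g, map_smul, smul_mul_assoc]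
    have hw : -(eps • (f a + g a)) + -(f b + g b)
        = g (-(eps • a) + -b) + f (-(eps • a) + -b) := by
      simp only [map_add, map_neg, map_smul, smul_add]
      abel
    rw [hw, oneSubExpDiv_add (hc _ _).symm, ← algHom_hexp, ← algHom_oneSubExpDiv,
      ← algHom_oneSubExpDiv, ← (hc _ _).eq, add_mul, mul_add, mul_add, hg.xy, e1, e2, e3,
      add_mul, mul_add, mul_add, smul_add, smul_add, smul_add, algHom_oneSubExpDiv g]
    simp only [map_add, map_neg, map_smul]
    abel
  ax := by
    have hf := h.map f
    have hg := h.map g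
    have e : g a * (f x * g (hexp (-(eps • a)))) = f x * g (hexp (-(eps • a))) * g a := by
      rw [← mul_assoc, ← (hc x a).eq, mul_assoc, ← map_mul, mul_assoc, ← map_mul,
        (hexp_commute ((Commute.refl a).smul_left eps).neg_left).eq]
    rw [add_mul, mul_add, mul_add, (hc a x).eq, hg.ax, e, ← mul_assoc, hf.ax, add_mul, add_mul,
      mul_add, mul_add]
    have e' : f x * f a * g (hexp (-(eps • a))) = f x * g (hexp (-(eps • a))) * f a := by
      rw [mul_assoc, (hc a _).eq, mul_assoc]
    rw [e']
    abel
  bx := by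
    have hf := h.map f
    have hg := h.map g
    have e : g b * (f x * g (hexp (-(eps • a)))) = f x * g (hexp (-(eps • a))) * g b := by
      rw [← mul_assoc, ← (hc x b).eq, mul_assoc, ← map_mul, mul_assoc, ← map_mul,
        (hexp_commute (h.ab.smul_left eps).neg_left).eq]
    rw [add_mul, mul_add, mul_add, (hc b x).eq, hg.bx, e, ← mul_assoc, hf.bx, add_mul, add_mul,
      mul_add, mul_add]
    have e' : f x * f b * g (hexp (-(eps • a))) = f x * g (hexp (-(eps • a))) * f b := by
      rw [mul_assoc, (hc b _).eq, mul_assoc]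
    rw [e', smul_add, smul_mul_assoc]
    abel
  ay := by
    have hf := h.map f
    have hg := h.map g
    have e : g a * (f y * g (hexp (-b))) = f y * g (hexp (-b)) * g a := by
      rw [← mul_assoc, ← (hc y a).eq, mul_assoc, ← map_mul, mul_assoc, ← map_mul,
        (hexp_commute h.ab.symm.neg_left).eq]
    rw [add_mul, mul_add, mul_add, (hc a y).eq, hg.ay, e, ← mul_assoc, hf.ay, sub_mul, add_mul,
      mul_add, mul_add]
    have e' : f y * f a * g (hexp (-b)) = f y * g (hexp (-b)) * f a := by
      rw [mul_assoc, (hc a _).eq, mul_assoc]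
    rw [e']
    abel
  by' := by
    have hf := h.map f
    have hg := h.map g
    have e : g b * (f y * g (hexp (-b))) = f y * g (hexp (-b)) * g b := by
      rw [← mul_assoc, ← (hc y b).eq, mul_assoc, ← map_mul, mul_assoc, ← map_mul,
        (hexp_commute (Commute.refl b).neg_left).eq]
    rw [add_mul, mul_add, mul_add, (hc b y).eq, hg.by', e, ← mul_assoc, hf.by', sub_mul, add_mul,
      mul_add, mul_add]
    have e' : f y * f b * g (hexp (-b)) = f y * g (hexp (-b)) * f b := by
      rw [mul_assoc, (hc b _).eq, mul_assoc]
    rw [e', smul_add, smul_mul_assoc]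
    abel
  ab := ((h.map f).ab.add_right (hc a b)).add_left
    ((hc b a).symm.add_right (h.map g).ab)

end Coproduct

section HopfD

theorem linearMap_ext_D {N : Type*} [AddCommGroup N] [Module K N] [HSep N] {f g : D →ₗ[K] N}
    (h1 : f 1 = g 1) (hy : ∀ d, f d = g d → f (y * d) = g (y * d))
    (hb : ∀ d, f d = g d → f (b * d) = g (b * d)) (ha : ∀ d, f d = g d → f (a * d) = g (a * d))
    (hx : ∀ d, f d = g d → f (x * d) = g (x * d)) : f = g := by
  have key : ∀ w : FreeAlgebra K Gen, ∀ d, f d = g d → f (toD (of w) * d) = g (toD (of w) * d) := by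
    intro w
    induction w using FreeAlgebra.induction with
    | grade0 r =>
      intro d hd
      rw [AlgHom.commutes, AlgHom.commutes, ← Algebra.smul_def, map_smul, map_smul, hd]
    | grade1 i =>
      intro d hd
      cases i
      exacts [hy d hd, hb d hd, ha d hd, hx d hd]
    | mul u v hu hv =>
      intro d hd
      have huv : toD (of (u * v)) = toD (of u) * toD (of v) := by rw [map_mul, map_mul]
      rw [huv, mul_assoc]
      exact hu _ (hv _ hd)
    | add u v hu hv =>
      intro d hd
      rw [map_add, map_add, add_mul, map_add, map_add, hu d hd, hv d hd]
  refine linearMap_ext_of_approx (Set.range fun w => toD (of w)) (fun d => ?_) ?_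
  · obtain ⟨t, r, rfl⟩ := exists_of_add_hbar_smul d
    obtain ⟨z, rfl⟩ := RingQuot.mkAlgHom_surjective K Rel t
    obtain ⟨w, s, rfl⟩ := exists_of_add_hbar_smul z
    refine ⟨toD (of w), ⟨w, rfl⟩, of (RingQuot.mkAlgHom K Rel s) + r, ?_⟩
    simp only [map_add, map_smul, smul_add, toD, AlgHom.comp_apply, add_assoc]
  · rintro _ ⟨w, rfl⟩
    simpa using key w 1 h1

theorem dRel_comul : DRel (tenR y + tenL y * tenR B) (tenL b + tenR b) (tenL a + tenR a)
    (tenR x + tenL x * tenR A) :=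
  dRel_D.comul tenL tenR tenL_tenR_commute

/-- The coproduct of `𝔻`. -/
def comulD : D →ₐ[K] Ten2 D := dRel_comul.lift

theorem comulD_y : comulD y = tenR y + tenL y * tenR B := dRel_comul.lift_y

theorem comulD_b : comulD b = tenL b + tenR b := dRel_comul.lift_b

theorem comulD_a : comulD a = tenL a + tenR a := dRel_comul.lift_a

theorem comulD_x : comulD x = tenR x + tenL x * tenR A := dRel_comul.lift_x

theorem comulD_hexp {w : D} (h : comulD w = tenL w + tenR w) :
    comulD (hexp w) = tenL (hexp w) * tenR (hexp w) := by
  rw [algHom_hexp, h, hexp_add (tenL_tenR_commute _ _), algHom_hexp, algHom_hexp]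

theorem comulD_A : comulD A = tenL A * tenR A :=
  comulD_hexp (by simp only [map_neg, map_smul, comulD_a, smul_add, neg_add])

theorem comulD_B : comulD B = tenL B * tenR B :=
  comulD_hexp (by simp only [map_neg, comulD_b, neg_add])

theorem coassocD : (comulIdA comulD).comp comulD = (idComulA comulD).comp comulD := by
  refine algHom_ext_D ?_ ?_ ?_ ?_
  · simp only [AlgHom.comp_apply, comulD_y, map_add, map_mul, comulIdA_tenL, comulIdA_tenR,
      idComulA_tenL, idComulA_tenR, comulD_B, l12_tenL, l12_tenR, l23_tenL, l23_tenR, add_mul,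
      mul_assoc, add_assoc]
  · simp only [AlgHom.comp_apply, comulD_b, map_add, comulIdA_tenL, comulIdA_tenR,
      idComulA_tenL, idComulA_tenR, l12_tenL, l12_tenR, l23_tenL, l23_tenR, add_assoc]
  · simp only [AlgHom.comp_apply, comulD_a, map_add, comulIdA_tenL, comulIdA_tenR,
      idComulA_tenL, idComulA_tenR, l12_tenL, l12_tenR, l23_tenL, l23_tenR, add_assoc]
  · simp only [AlgHom.comp_apply, comulD_x, map_add, map_mul, comulIdA_tenL, comulIdA_tenR,
      idComulA_tenL, idComulA_tenR, comulD_A, l12_tenL, l12_tenR, l23_tenL, l23_tenR, add_mul,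
      mul_assoc, add_assoc]

theorem map_oneSubExpDiv_eq_zero {T H : Type*} [Ring T] [Algebra K T] [Ring H] [Algebra K H]
    [HSep H] (f : Compl T →ₐ[K] H) {w : Compl T} (h : f w = 0) : f (oneSubExpDiv w) = 0 := by
  refine ((isHSum_hsum _).map f.toLinearMap).unique fun n => ⟨0, ?_⟩
  simp [h]

theorem map_hexp_eq_one {T H : Type*} [Ring T] [Algebra K T] [Ring H] [Algebra K H]
    [HSep H] (f : Compl T →ₐ[K] H) {w : Compl T} (h : f w = 0) : f (hexp w) = 1 := by
  have := hbar_smul_oneSubExpDiv w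
  have h1 := congrArg f this
  rw [map_smul, map_oneSubExpDiv_eq_zero f h, smul_zero, map_sub, map_one] at h1
  exact (sub_eq_zero.1 h1.symm).symm

theorem counit_rel ⦃r s : FreeC⦄ (hr : Rel r s) :
    freeLift (fun _ => (0 : K)) r = freeLift (fun _ => (0 : K)) s := by
  cases hr with
  | xy =>
    rw [map_mul, map_add, map_smul, map_mul, oneSubABDiv, map_add, map_mul,
      map_oneSubExpDiv_eq_zero _ (by simp), map_oneSubExpDiv_eq_zero _ (by simp)]
    simp
  | ax => simp
  | bx => simp
  | ay => simp
  | by' => simp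
  | ab => simp

/-- The counit of `𝔻`. -/
def counitD : D →ₐ[K] K := liftD (fun _ => 0) counit_rel

theorem counitD_dgen (g : Gen) : counitD (dgen g) = 0 := liftD_dgen _ _ _

theorem counitD_y : counitD y = 0 := counitD_dgen _

theorem counitD_b : counitD b = 0 := counitD_dgen _

theorem counitD_a : counitD a = 0 := counitD_dgen _

theorem counitD_x : counitD x = 0 := counitD_dgen _

theorem counitD_A : counitD A = 1 := map_hexp_eq_one _ (by simp [counitD_a])

theorem counitD_B : counitD B = 1 := map_hexp_eq_one _ (by simp [counitD_b])

theorem oneSubExpDiv_neg {T : Type*} [Ring T] [Algebra K T] (w : Compl T) :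
    oneSubExpDiv (-w) = -(oneSubExpDiv w * hexp (-w)) := by
  have h := oneSubExpDiv_add (Commute.refl w).neg_right
  rw [add_neg_cancel, oneSubExpDiv_zero] at h
  have h1 : hexp (-w) * (hexp w * oneSubExpDiv (-w)) = -(hexp (-w) * oneSubExpDiv w) := by
    rw [← mul_neg, eq_neg_of_add_eq_zero_right h.symm]
  rw [← mul_assoc, hexp_neg_mul_hexp, one_mul] at h1
  rw [h1]
  congr 1
  simp only [oneSubExpDiv, mul_hsum, hsum_mul]
  congr 1
  funext k
  rw [mul_neg, neg_mul, mul_smul_comm, smul_mul_assoc,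
    (hexp_commute ((Commute.refl w).neg_left.pow_right (k + 1))).eq]

/-- The images of the generators under the antipode. -/
def antipodeGen : Gen → Dᵐᵒᵖ :=
  fun g => MulOpposite.op (tuple (-(y * hexp b)) (-b) (-a) (-(x * hexp (eps • a))) g)

/-- A homomorphism to the opposite algebra as a linear map. -/
def unopLin {H H' : Type*} [Ring H] [Algebra K H] [Ring H'] [Algebra K H']
    (f : H →ₐ[K] H'ᵐᵒᵖ) : H →ₗ[K] H' :=
  (MulOpposite.opLinearEquiv K).symm.toLinearMap ∘ₗ f.toLinearMap

section

variable {H H' : Type*} [Ring H] [Algebra K H] [Ring H'] [Algebra K H'] (f : H →ₐ[K] H'ᵐᵒᵖ)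

theorem unopLin_apply (s : H) : unopLin f s = (f s).unop := rfl

theorem unopLin_mul (s t : H) : unopLin f (s * t) = unopLin f t * unopLin f s := by
  simp [unopLin_apply]

theorem unopLin_one : unopLin f 1 = 1 := by simp [unopLin_apply]

theorem unopLin_pow (s : H) (k : ℕ) : unopLin f (s ^ k) = unopLin f s ^ k := by
  simp [unopLin_apply]

end

theorem antipode_rel ⦃r s : FreeC⦄ (hr : Rel r s) :
    freeLift antipodeGen r = freeLift antipodeGen s := by
  refine MulOpposite.unop_injective ?_
  rw [← unopLin_apply, ← unopLin_apply]
  have hg : ∀ g, unopLin (freeLift antipodeGen) (gen g)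
      = tuple (-(y * hexp b)) (-b) (-a) (-(x * hexp (eps • a))) g := fun g => by
    rw [unopLin_apply, freeLift_gen]
    rfl
  have R := dRel_D
  have cAb : Commute (hexp (eps • a)) b := hexp_commute (R.ab.smul_left eps)
  have cAa : Commute (hexp (eps • a)) a := hexp_commute ((Commute.refl a).smul_left eps)
  have cBa : Commute (hexp b) a := hexp_commute R.ab.symm
  have cBb : Commute (hexp b) b := hexp_commute (Commute.refl b)
  cases hr with
  | xy =>
    have hZ : unopLin (freeLift antipodeGen) oneSubABDiv
        = -(oneSubExpDiv (-(eps • a) + -b) * (hexp (eps • a) * hexp b)) := by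
      rw [oneSubABDiv, map_add, unopLin_mul,
        map_oneSubExpDiv _ (w' := eps • a) fun k => by rw [unopLin_pow]; simp [hg, tuple],
        map_oneSubExpDiv _ (w' := b) fun k => by rw [unopLin_pow]; simp [hg, tuple],
        map_hexp _ (w' := eps • a) fun k => by rw [unopLin_pow]; simp [hg, tuple]]
      have hc : Commute (eps • a) b := R.ab.smul_left eps
      have h1 : oneSubExpDiv (eps • a + b)
          = oneSubExpDiv (eps • a) + oneSubExpDiv b * hexp (eps • a) := by
        have h2 : oneSubExpDiv b * hexp (eps • a) = hexp (eps • a) * oneSubExpDiv b := by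
          simp only [oneSubExpDiv, mul_hsum, hsum_mul]
          congr 1
          funext k
          rw [mul_neg, neg_mul, mul_smul_comm, smul_mul_assoc, (cAb.pow_right (k + 1)).eq]
        rw [h2, oneSubExpDiv_add hc]
      have h3 : -(eps • a) + -b = -(eps • a + b) := by rw [neg_add]
      rw [← h1, ← hexp_add hc, h3]
      have h4 := oneSubExpDiv_neg (-(eps • a + b))
      rwa [neg_neg] at h4
    rw [unopLin_mul, map_add, map_smul, unopLin_mul, hZ, hg, hg]
    simp only [tuple, neg_mul_neg]
    have e1 : y * hexp b * (x * hexp (eps • a)) = q • (y * x * (hexp (eps • a) * hexp b)) := by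
      rw [mul_assoc, ← mul_assoc (hexp b), R.Binv_x, smul_mul_assoc, mul_smul_comm, mul_assoc x,
        (hexp_commute (cAb.symm)).eq, ← mul_assoc y x]
    have e2 : q • (x * hexp (eps • a) * (y * hexp b)) = x * y * (hexp (eps • a) * hexp b) := by
      rw [mul_assoc x y, ← mul_assoc y, R.y_Ainv, smul_mul_assoc, mul_smul_comm]
      simp only [mul_assoc]
    rw [e1, e2, R.xy, add_mul, smul_mul_assoc]
    abel
  | ax =>
    rw [map_sub, unopLin_mul, unopLin_mul, hg, hg]
    simp only [tuple, neg_mul_neg]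
    rw [mul_assoc, cAa.eq, ← mul_assoc, ← mul_assoc, R.ax, add_mul]
    abel
  | bx =>
    rw [map_sub, unopLin_mul, unopLin_mul, map_smul, hg, hg]
    simp only [tuple, neg_mul_neg]
    rw [mul_assoc, cAb.eq, ← mul_assoc, ← mul_assoc, R.bx, add_mul, smul_mul_assoc, smul_neg]
    abel
  | ay =>
    rw [map_sub, unopLin_mul, unopLin_mul, map_neg, hg, hg]
    simp only [tuple, neg_mul_neg]
    rw [mul_assoc, cBa.eq, ← mul_assoc, ← mul_assoc, R.ay, sub_mul]
    abel
  | by' =>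
    rw [map_sub, unopLin_mul, unopLin_mul, map_neg, map_smul, hg, hg]
    simp only [tuple, neg_mul_neg]
    rw [mul_assoc, cBb.eq, ← mul_assoc, ← mul_assoc, R.by', sub_mul, smul_mul_assoc, smul_neg]
    abel
  | ab =>
    rw [map_sub, unopLin_mul, unopLin_mul, map_zero, hg, hg]
    simp only [tuple, neg_mul_neg]
    rw [R.ab.eq, sub_self]

/-- The antipode of `𝔻`. -/
def antipodeD : D →ₗ[K] D := unopLin (liftD antipodeGen antipode_rel)

theorem antipodeD_mul (s t : D) : antipodeD (s * t) = antipodeD t * antipodeD s :=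
  unopLin_mul _ _ _

theorem antipodeD_one : antipodeD 1 = 1 := unopLin_one _

theorem antipodeD_pow (s : D) (k : ℕ) : antipodeD (s ^ k) = antipodeD s ^ k := unopLin_pow _ _ _

theorem antipodeD_dgen (g : Gen) :
    antipodeD (dgen g) = tuple (-(y * hexp b)) (-b) (-a) (-(x * hexp (eps • a))) g := by
  rw [antipodeD, unopLin_apply, liftD_dgen]
  rfl

theorem antipodeD_y : antipodeD y = -(y * hexp b) := antipodeD_dgen _

theorem antipodeD_b : antipodeD b = -b := antipodeD_dgen _

theorem antipodeD_a : antipodeD a = -a := antipodeD_dgen _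

theorem antipodeD_x : antipodeD x = -(x * hexp (eps • a)) := antipodeD_dgen _

theorem antipodeD_hexp (w : D) : antipodeD (hexp w) = hexp (antipodeD w) :=
  map_hexp _ fun k => antipodeD_pow w k

theorem antipodeD_A : antipodeD A = hexp (eps • a) := by
  rw [A, antipodeD_hexp, map_neg, map_smul, antipodeD_a, smul_neg, neg_neg]

theorem antipodeD_B : antipodeD B = hexp b := by
  rw [B, antipodeD_hexp, map_neg, antipodeD_b, neg_neg]

end HopfD

section HopfStructure

theorem unitCounit_apply {H : Type*} [Ring H] [Algebra K H] (ε : H →ₐ[K] K) (s : H) :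
    unitCounit ε s = algebraMap K H (ε s) := rfl

/-- `h ↦ ε(h) 1` as a homomorphism. -/
def unitCounitA {H : Type*} [Ring H] [Algebra K H] (ε : H →ₐ[K] K) : H →ₐ[K] H :=
  (Algebra.ofId K H).comp ε

theorem unitCounitA_apply {H : Type*} [Ring H] [Algebra K H] (ε : H →ₐ[K] K) (s : H) :
    unitCounitA ε s = algebraMap K H (ε s) := rfl

theorem counit_comulD (d : D) : mulD (unitCounit counitD) LinearMap.id (comulD d) = d := by
  have hc : ∀ s t : D, Commute ((of.comp (unitCounitA counitD)) s) (of t) := fun s t => by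
    rw [AlgHom.comp_apply, unitCounitA_apply, AlgHom.commutes]
    exact Algebra.commutes _ _
  have h1 : ∀ X, of (mulD (unitCounit counitD) LinearMap.id X)
      = ten2Lift (of.comp (unitCounitA counitD)) of hc X := fun X =>
    LinearMap.congr_fun (Ten2.linearMap_ext
      (f := of.toLinearMap ∘ₗ mulD (unitCounit counitD) LinearMap.id)
      (g := (ten2Lift (of.comp (unitCounitA counitD)) of hc).toLinearMap) fun s t => by
        rw [AlgHom.toLinearMap_apply, ten2Lift_ten, LinearMap.comp_apply, mulD_ten,
          AlgHom.toLinearMap_apply, map_mul]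
        rfl) X
  have h2 : (ten2Lift (of.comp (unitCounitA counitD)) of hc).comp comulD = of := by
    refine algHom_ext_D ?_ ?_ ?_ ?_ <;>
    simp only [AlgHom.comp_apply, comulD_y, comulD_b, comulD_a, comulD_x, map_add, map_mul,
      ten2Lift_tenL, ten2Lift_tenR, unitCounitA_apply, counitD_y, counitD_b, counitD_a, counitD_x,
      map_zero, zero_mul, add_zero, zero_add]
  refine of_bijective.1 ?_
  rw [h1]
  exact DFunLike.congr_fun h2 d

theorem comul_counitD (d : D) : mulD LinearMap.id (unitCounit counitD) (comulD d) = d := by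
  have hc : ∀ s t : D, Commute (of s) ((of.comp (unitCounitA counitD)) t) := fun s t => by
    rw [AlgHom.comp_apply, unitCounitA_apply, AlgHom.commutes]
    exact (Algebra.commutes _ _).symm
  have h1 : ∀ X, of (mulD LinearMap.id (unitCounit counitD) X)
      = ten2Lift of (of.comp (unitCounitA counitD)) hc X := fun X =>
    LinearMap.congr_fun (Ten2.linearMap_ext
      (f := of.toLinearMap ∘ₗ mulD LinearMap.id (unitCounit counitD))
      (g := (ten2Lift of (of.comp (unitCounitA counitD)) hc).toLinearMap) fun s t => by
        rw [AlgHom.toLinearMap_apply, ten2Lift_ten, LinearMap.comp_apply, mulD_ten,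
          AlgHom.toLinearMap_apply, map_mul]
        rfl) X
  have h2 : (ten2Lift of (of.comp (unitCounitA counitD)) hc).comp comulD = of := by
    refine algHom_ext_D ?_ ?_ ?_ ?_ <;>
    simp only [AlgHom.comp_apply, comulD_y, comulD_b, comulD_a, comulD_x, map_add, map_mul,
      ten2Lift_tenL, ten2Lift_tenR, unitCounitA_apply, counitD_y, counitD_b, counitD_a, counitD_x,
      map_zero, add_zero, zero_add, counitD_A, counitD_B, map_one, mul_one]
  refine of_bijective.1 ?_
  rw [h1]
  exact DFunLike.congr_fun h2 d

section Antipode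

variable {H : Type*} [Ring H] [Algebra K H] [HComplete H] {S : H →ₗ[K] H}

theorem mulD_antipode_mul_ten (hS : ∀ s t, S (s * t) = S t * S s) (X : Ten2 H) (s t : H) :
    mulD S LinearMap.id (X * ten s t) = S s * mulD S LinearMap.id X * t :=
  LinearMap.congr_fun (Ten2.linearMap_ext
    (f := mulD S LinearMap.id ∘ₗ LinearMap.mulRight K (ten s t))
    (g := LinearMap.mulRight K t ∘ₗ LinearMap.mulLeft K (S s) ∘ₗ mulD S LinearMap.id)
    fun s' t' => by simp [ten_mul_ten, mulD_ten, hS, mul_assoc]) X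

theorem mulD_ten_mul_antipode (hS : ∀ s t, S (s * t) = S t * S s) (X : Ten2 H) (s t : H) :
    mulD LinearMap.id S (ten s t * X) = s * mulD LinearMap.id S X * S t :=
  LinearMap.congr_fun (Ten2.linearMap_ext
    (f := mulD LinearMap.id S ∘ₗ LinearMap.mulLeft K (ten s t))
    (g := LinearMap.mulRight K (S t) ∘ₗ LinearMap.mulLeft K s ∘ₗ mulD LinearMap.id S)
    fun s' t' => by simp [ten_mul_ten, mulD_ten, hS, mul_assoc]) X

theorem mulD_antipode_mul (hS : ∀ s t, S (s * t) = S t * S s) {X : Ten2 H} {c : K}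
    (hX : mulD S LinearMap.id X = algebraMap K H c) (Y : Ten2 H) :
    mulD S LinearMap.id (X * Y) = c • mulD S LinearMap.id Y :=
  LinearMap.congr_fun (Ten2.linearMap_ext
    (f := mulD S LinearMap.id ∘ₗ LinearMap.mulLeft K X) (g := c • mulD S LinearMap.id)
    fun s t => by
      rw [LinearMap.comp_apply, LinearMap.mulLeft_apply, mulD_antipode_mul_ten hS, hX,
        LinearMap.smul_apply, mulD_ten, ← Algebra.commutes, mul_assoc, ← Algebra.smul_def]
      rfl) Y

theorem mulD_mul_antipode (hS : ∀ s t, S (s * t) = S t * S s) {X : Ten2 H} {c : K}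
    (hX : mulD LinearMap.id S X = algebraMap K H c) (Y : Ten2 H) :
    mulD LinearMap.id S (Y * X) = c • mulD LinearMap.id S Y :=
  LinearMap.congr_fun (Ten2.linearMap_ext
    (f := mulD LinearMap.id S ∘ₗ LinearMap.mulRight K X) (g := c • mulD LinearMap.id S)
    fun s t => by
      rw [LinearMap.comp_apply, LinearMap.mulRight_apply, mulD_ten_mul_antipode hS, hX,
        LinearMap.smul_apply, mulD_ten, ← Algebra.commutes, mul_assoc, ← Algebra.smul_def]
      rfl) Y

end Antipode

theorem A_mul_Ainv : A * hexp (eps • a) = 1 := hexp_neg_mul_hexp _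

theorem Ainv_mul_A : hexp (eps • a) * A = 1 := hexp_mul_hexp_neg _

theorem B_mul_Binv : B * hexp b = 1 := hexp_neg_mul_hexp _

theorem Binv_mul_B : hexp b * B = 1 := hexp_mul_hexp_neg _

theorem antipode_comulD (d : D) :
    mulD antipodeD LinearMap.id (comulD d) = algebraMap K D (counitD d) := by
  have key : ∀ g : D, mulD antipodeD LinearMap.id (comulD g) = 0 → counitD g = 0 → ∀ d : D,
      mulD antipodeD LinearMap.id (comulD (g * d)) = algebraMap K D (counitD (g * d)) := by
    intro g hg hg' d
    have hz : mulD antipodeD LinearMap.id (comulD g) = algebraMap K D 0 := by rw [hg, map_zero]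
    rw [map_mul, mulD_antipode_mul antipodeD_mul hz, zero_smul, map_mul, hg', zero_mul, map_zero]
  refine LinearMap.congr_fun (linearMap_ext_D
    (f := mulD antipodeD LinearMap.id ∘ₗ comulD.toLinearMap)
    (g := Algebra.linearMap K D ∘ₗ counitD.toLinearMap) ?_ ?_ ?_ ?_ ?_) d
  · simp only [LinearMap.comp_apply, AlgHom.toLinearMap_apply, map_one, ← ten_one_one, mulD_ten,
      antipodeD_one]
    simp
  · refine fun d _ => key y ?_ counitD_y d
    rw [comulD_y, ← ten_eq, tenR_apply, map_add, mulD_ten, mulD_ten, antipodeD_one, antipodeD_y]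
    simp only [LinearMap.id_apply, one_mul, neg_mul, mul_assoc, Binv_mul_B, mul_one,
      add_neg_cancel]
  · refine fun d _ => key b ?_ counitD_b d
    rw [comulD_b, tenL_apply, tenR_apply, map_add, mulD_ten, mulD_ten, antipodeD_one, antipodeD_b]
    simp
  · refine fun d _ => key a ?_ counitD_a d
    rw [comulD_a, tenL_apply, tenR_apply, map_add, mulD_ten, mulD_ten, antipodeD_one, antipodeD_a]
    simp
  · refine fun d _ => key x ?_ counitD_x d
    rw [comulD_x, ← ten_eq, tenR_apply, map_add, mulD_ten, mulD_ten, antipodeD_one, antipodeD_x]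
    simp only [LinearMap.id_apply, one_mul, neg_mul, mul_assoc, Ainv_mul_A, mul_one,
      add_neg_cancel]

theorem comul_antipodeD (d : D) :
    mulD LinearMap.id antipodeD (comulD d) = algebraMap K D (counitD d) := by
  have key : ∀ g : D, mulD LinearMap.id antipodeD (comulD g) = 0 → counitD g = 0 → ∀ d : D,
      mulD LinearMap.id antipodeD (comulD d) = algebraMap K D (counitD d) →
      mulD LinearMap.id antipodeD (comulD (g * d)) = algebraMap K D (counitD (g * d)) := by
    intro g hg hg' d hd
    rw [map_mul, mulD_mul_antipode antipodeD_mul hd, hg, smul_zero, map_mul, hg', zero_mul,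
      map_zero]
  refine LinearMap.congr_fun (linearMap_ext_D
    (f := mulD LinearMap.id antipodeD ∘ₗ comulD.toLinearMap)
    (g := Algebra.linearMap K D ∘ₗ counitD.toLinearMap) ?_ ?_ ?_ ?_ ?_) d
  · simp only [LinearMap.comp_apply, AlgHom.toLinearMap_apply, map_one, ← ten_one_one, mulD_ten,
      antipodeD_one]
    simp
  · refine fun d hd => key y ?_ counitD_y d hd
    rw [comulD_y, ← ten_eq, tenR_apply, map_add, mulD_ten, mulD_ten, antipodeD_B, antipodeD_y]
    simp
  · refine fun d hd => key b ?_ counitD_b d hd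
    rw [comulD_b, tenL_apply, tenR_apply, map_add, mulD_ten, mulD_ten, antipodeD_one, antipodeD_b]
    simp
  · refine fun d hd => key a ?_ counitD_a d hd
    rw [comulD_a, tenL_apply, tenR_apply, map_add, mulD_ten, mulD_ten, antipodeD_one, antipodeD_a]
    simp
  · refine fun d hd => key x ?_ counitD_x d hd
    rw [comulD_x, ← ten_eq, tenR_apply, map_add, mulD_ten, mulD_ten, antipodeD_A, antipodeD_x]
    simp

/-- The topological Hopf algebra `𝔻`. -/
def hopfD : TopHopf D where
  complete := HComplete.isAdicComplete
  comul := comulD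
  counit := counitD
  antipode := antipodeD
  coassoc d := by
    rw [comulId_apply, idComul_apply]
    exact DFunLike.congr_fun coassocD d
  counit_comul d := by rw [mulMap_apply, counit_comulD]
  comul_counit d := by rw [mulMap_apply, comul_counitD]
  antipode_comul d := by rw [mulMap_apply, antipode_comulD, unitCounit_apply]
  comul_antipode d := by rw [mulMap_apply, comul_antipodeD, unitCounit_apply]

theorem hopfD_formulas : HasGeneratorFormulas hopfD where
  comul_y := by rw [ten_eq y B]; exact comulD_y
  comul_b := comulD_b
  comul_a := comulD_a
  comul_x := by rw [ten_eq x A]; exact comulD_x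
  counit_gen := ⟨counitD_y, counitD_b, counitD_a, counitD_x⟩
  antipode_y := antipodeD_y
  antipode_b := antipodeD_b
  antipode_a := antipodeD_a
  antipode_x := antipodeD_x

end HopfStructure

/-! ### `q`-binomial theorem -/

section QBinomial

/-- The inverse of the `q`-factorial. -/
def qInv (m : ℕ) : K := Ring.inverse (qFact m)

theorem qInt_succ (m : ℕ) : qInt (m + 1) = qInt m + q ^ m := Finset.sum_range_succ _ _

theorem qInt_succ' (m : ℕ) : qInt (m + 1) = 1 + q * qInt m := by
  rw [qInt, Finset.sum_range_succ', qInt, Finset.mul_sum, pow_zero, add_comm]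
  simp only [pow_succ']

theorem qInt_zero : qInt 0 = 0 := Finset.sum_range_zero _

theorem qInt_add (i j : ℕ) : qInt (i + j) = qInt i + q ^ i * qInt j := by
  rw [qInt, Finset.sum_range_add, qInt, qInt, Finset.mul_sum]
  simp only [pow_add]

theorem qFact_succ (m : ℕ) : qFact (m + 1) = qFact m * qInt (m + 1) := Finset.prod_range_succ _ _

theorem isUnit_qInt_succ (m : ℕ) : IsUnit (qInt (m + 1)) := by
  have := isUnit_qFact (m + 1)
  rw [qFact_succ] at this
  exact isUnit_of_mul_isUnit_right this

theorem qInv_zero : qInv 0 = 1 := by simp [qInv, qFact]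

theorem qInt_mul_qInv (m : ℕ) : qInt (m + 1) * qInv (m + 1) = qInv m := by
  refine (isUnit_qFact m).mul_left_cancel ?_
  rw [qInv, qInv, Ring.mul_inverse_cancel _ (isUnit_qFact m), ← mul_assoc, ← qFact_succ,
    Ring.mul_inverse_cancel _ (isUnit_qFact (m + 1))]

variable {H : Type*} [Ring H] [Algebra K H] {X Y : H}

theorem mul_pow_of_q_comm (h : Y * X = q • (X * Y)) (i : ℕ) : Y * X ^ i = q ^ i • (X ^ i * Y) := by
  induction i with
  | zero => simp
  | succ i ih =>
    rw [pow_succ, ← mul_assoc, ih, smul_mul_assoc, mul_assoc, h, mul_smul_comm, smul_smul, pow_succ,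
      mul_assoc]

theorem pow_mul_of_q_comm (h : Y * X = q • (X * Y)) (i : ℕ) : Y ^ i * X = q ^ i • (X * Y ^ i) := by
  induction i with
  | zero => simp
  | succ i ih =>
    rw [pow_succ', mul_assoc, ih, mul_smul_comm, ← mul_assoc, h, smul_mul_assoc, smul_smul,
      ← pow_succ, mul_assoc]

theorem mul_qInv_smul_pow (i : ℕ) : X * (qInv i • X ^ i) = qInt (i + 1) • (qInv (i + 1) • X ^ (i + 1)) := by
  rw [smul_smul, qInt_mul_qInv, mul_smul_comm, pow_succ']

theorem q_binomial (h : Y * X = q • (X * Y)) (n : ℕ) :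
    qInv n • (X + Y) ^ n =
      ∑ p ∈ antidiagonal n, (qInv p.1 • X ^ p.1) * (qInv p.2 • Y ^ p.2) := by
  induction n with
  | zero => simp [qInv_zero]
  | succ n ih =>
    refine (isUnit_qInt_succ n).smul_left_cancel.1 ?_
    rw [← mul_qInv_smul_pow, ih, Finset.mul_sum, Finset.smul_sum]
    have h1 : ∀ p ∈ antidiagonal (n + 1),
        qInt (n + 1) • ((qInv p.1 • X ^ p.1) * (qInv p.2 • Y ^ p.2))
          = qInt p.1 • ((qInv p.1 • X ^ p.1) * (qInv p.2 • Y ^ p.2))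
            + (q ^ p.1 * qInt p.2) • ((qInv p.1 • X ^ p.1) * (qInv p.2 • Y ^ p.2)) := by
      intro p hp
      rw [← Finset.HasAntidiagonal.mem_antidiagonal.1 hp, qInt_add, add_smul]
    rw [Finset.sum_congr rfl h1, Finset.sum_add_distrib, Finset.Nat.sum_antidiagonal_succ,
      Finset.Nat.sum_antidiagonal_succ' (n := n) (f := fun p => (q ^ p.1 * qInt p.2) • _),
      qInt_zero, mul_zero, zero_smul, zero_smul, zero_add, zero_add, ← Finset.sum_add_distrib]
    refine Finset.sum_congr rfl fun p _ => ?_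
    rw [add_mul, ← mul_assoc, mul_qInv_smul_pow, smul_mul_assoc]
    congr 1
    simp only [smul_mul_assoc, mul_smul_comm]
    rw [← mul_assoc Y, mul_pow_of_q_comm h, smul_mul_assoc, mul_assoc, ← pow_succ',
      ← qInt_mul_qInv p.2]
    simp only [smul_smul]
    congr 1
    ring

end QBinomial

/-! ### Commutation with powers -/

theorem q_smul_aux {R M : Type*} [CommRing R] [AddCommGroup M] [Module R M] (r n : R) (m : ℕ)
    (u v : M) : r ^ (m + 1) • (u - v) + n • (u - r ^ m • r ^ 2 • v)
      = (n + r ^ (m + 1)) • u - (r ^ (m + 1) * (1 + r * n)) • v := by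
  module

section Powers

variable {T : Type*} [Ring T] [Algebra K T] {y b a x : Compl T}

theorem DRel.x_AB (h : DRel y b a x) :
    x * hexp (-(eps • a) + -b) = q ^ 2 • (hexp (-(eps • a) + -b) * x) := by
  rw [h.hexp_AB, ← mul_assoc, h.x_A, smul_mul_assoc, mul_assoc, h.x_B, mul_smul_comm, smul_smul,
    mul_assoc, sq]

theorem DRel.AB_y (h : DRel y b a x) :
    hexp (-(eps • a) + -b) * y = q ^ 2 • (y * hexp (-(eps • a) + -b)) := by
  rw [h.hexp_AB, mul_assoc, h.B_y, mul_smul_comm, ← mul_assoc, h.A_y, smul_mul_assoc, smul_smul,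
    mul_assoc, sq]

theorem DRel.exists_x_pow_mul_y (h : DRel y b a x) (m : ℕ) :
    ∃ W, x ^ (m + 1) * y = q ^ (m + 1) • (y * x ^ (m + 1)) + W ∧
      hbar • W = qInt (m + 1) • (x ^ m - q ^ m • (hexp (-(eps • a) + -b) * x ^ m)) := by
  induction m with
  | zero =>
    refine ⟨oneSubExpDiv (-(eps • a) + -b), by simp [h.xy], ?_⟩
    rw [hbar_smul_oneSubExpDiv]
    simp [qInt]
  | succ m ih =>
    obtain ⟨W, hW, hW'⟩ := ih
    refine ⟨q ^ (m + 1) • (oneSubExpDiv (-(eps • a) + -b) * x ^ (m + 1)) + x * W, ?_, ?_⟩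
    · rw [pow_succ' x (m + 1), mul_assoc, hW, mul_add, mul_smul_comm, ← mul_assoc x y, h.xy,
        add_mul, smul_mul_assoc, smul_add, smul_smul, ← pow_succ, mul_assoc y, ← add_assoc]
    · rw [smul_add, smul_comm hbar, ← smul_mul_assoc, hbar_smul_oneSubExpDiv, ← mul_smul_comm hbar x W, hW',
        mul_smul_comm, mul_sub, mul_smul_comm, ← mul_assoc x, h.x_AB, smul_mul_assoc, mul_assoc,
        ← pow_succ', sub_mul, one_mul]
      rw [q_smul_aux, ← qInt_succ, ← qInt_succ', smul_sub, smul_smul, mul_comm (q ^ (m + 1))]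

theorem DRel.exists_x_mul_y_pow (h : DRel y b a x) (m : ℕ) :
    ∃ W, x * y ^ (m + 1) = q ^ (m + 1) • (y ^ (m + 1) * x) + W ∧
      hbar • W = qInt (m + 1) • (y ^ m - q ^ m • (y ^ m * hexp (-(eps • a) + -b))) := by
  induction m with
  | zero =>
    refine ⟨oneSubExpDiv (-(eps • a) + -b), by simp [h.xy], ?_⟩
    rw [hbar_smul_oneSubExpDiv]
    simp [qInt]
  | succ m ih =>
    obtain ⟨W, hW, hW'⟩ := ih
    refine ⟨q ^ (m + 1) • (y ^ (m + 1) * oneSubExpDiv (-(eps • a) + -b)) + W * y, ?_, ?_⟩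
    · rw [pow_succ y (m + 1), ← mul_assoc, hW, add_mul, smul_mul_assoc, mul_assoc _ x y, h.xy,
        mul_add, mul_smul_comm, smul_add, smul_smul, ← pow_succ, ← mul_assoc, ← add_assoc]
    · rw [smul_add, smul_comm hbar, ← mul_smul_comm, hbar_smul_oneSubExpDiv, ← smul_mul_assoc hbar W y, hW',
        smul_mul_assoc, sub_mul, smul_mul_assoc, mul_assoc _ _ y, h.AB_y, mul_smul_comm,
        ← mul_assoc, ← pow_succ, mul_sub, mul_one]
      rw [q_smul_aux, ← qInt_succ, ← qInt_succ', smul_sub, smul_smul, mul_comm (q ^ (m + 1))]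

end Powers

/-! ### The `R`-matrix -/

section RMatrix

variable {T U V : Type*} [Ring T] [Algebra K T] [Ring U] [Algebra K U] [Ring V] [Algebra K V]

/-- The series `∑ₘ ħᵐ / [m]! Yᵐ E Xᵐ`. -/
def rSum (Y E X : Compl U) : Compl U := hsum fun m => qInv m • (Y ^ m * E * X ^ m)

theorem map_rSum (ψ : Compl U →ₐ[K] Compl V) (Y E X : Compl U) :
    ψ (rSum Y E X) = rSum (ψ Y) (ψ E) (ψ X) := by
  rw [rSum, ← AlgHom.toLinearMap_apply, map_hsum, rSum]
  simp

theorem Rmatrix_eq : Rmatrix = rSum (tenL y) (hexp (tenL b * tenR a)) (tenR x) := by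
  rw [Rmatrix, ← hsum_hsum fun m n => (Ring.inverse (qFact m) * rat (1 / (n ! : ℚ))) •
      ten (y ^ m * b ^ n) (a ^ n * x ^ m), rSum]
  congr 1
  funext m
  rw [hexp, mul_hsum, hsum_mul, smul_hsum]
  congr 1
  funext n
  rw [ten_eq, (tenL_tenR_commute b a).mul_pow, mul_smul_comm, smul_mul_assoc, smul_smul, qInv]
  simp only [map_mul, map_pow, mul_assoc]

theorem commute_rSum {s Y E X : Compl U} {c : K} (hY : s * Y = Y * s - c • Y)
    (hX : s * X = X * s + c • X) (hE : Commute s E) : Commute s (rSum Y E X) := by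
  have hY' : ∀ m : ℕ, s * Y ^ m = Y ^ m * (s - (m * c) • 1) := by
    intro m
    induction m with
    | zero => simp
    | succ m ih =>
      rw [pow_succ, ← mul_assoc, ih, mul_assoc, sub_mul, hY, smul_mul_assoc, one_mul, mul_assoc]
      simp only [mul_sub, mul_add, mul_smul_comm, mul_one, Nat.cast_succ, add_mul, one_mul,
        add_smul]
      abel
  have hX' : ∀ m : ℕ, X ^ m * s = (s - (m * c) • 1) * X ^ m := by
    intro m
    induction m with
    | zero => simp
    | succ m ih =>
      have h1 : X * s = s * X - c • X := by rw [hX]; abel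
      rw [pow_succ, mul_assoc, h1, mul_sub, ← mul_assoc, ih, mul_assoc, ← pow_succ, mul_smul_comm,
        ← pow_succ]
      simp only [sub_mul, smul_mul_assoc, one_mul, Nat.cast_succ, add_mul, add_smul]
      abel
  rw [Commute, SemiconjBy, rSum, mul_hsum, hsum_mul]
  congr 1
  funext m
  have hE' : Commute (s - ((m : K) * c) • 1) E :=
    hE.sub_left ((Commute.one_left E).smul_left _)
  rw [mul_smul_comm, smul_mul_assoc, ← mul_assoc, ← mul_assoc, hY', mul_assoc (Y ^ m), hE'.eq,
    mul_assoc _ (X ^ m), hX']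
  simp only [mul_assoc]

variable {y b a x : Compl T} (h : DRel y b a x) {f g : Compl T →ₐ[K] Compl U}
  (hc : ∀ s t, Commute (f s) (g t))
include h hc

theorem rExp_mul_left_y :
    hexp (f b * g a) * f y = f y * (hexp (f b * g a) * g (hexp (-(eps • a)))) := by
  have h1 : f b * g a * f y = f y * (f b * g a + g (-(eps • a))) := by
    rw [mul_assoc, ← (hc y a).eq, ← mul_assoc, (h.map f).by', sub_mul, mul_add, mul_assoc, map_neg,
      map_smul, mul_neg, mul_smul_comm, smul_mul_assoc, sub_eq_add_neg]
  have h2 : Commute (f b * g a) (g (-(eps • a))) :=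
    ((hc _ _)).mul_left (((Commute.refl a).smul_right eps).neg_right.map g)
  rw [hexp_mul_of_semiconj h1, hexp_add h2, algHom_hexp g]

theorem rExp_mul_right_y :
    hexp (f b * g a) * g y = g y * (hexp (f b * g a) * f (hexp (-b))) := by
  have h1 : f b * g a * g y = g y * (f b * g a + f (-b)) := by
    rw [mul_assoc, (h.map g).ay, mul_sub, ← mul_assoc, (hc b y).eq, mul_add, map_neg, mul_neg,
      mul_assoc, sub_eq_add_neg]
  have h2 : Commute (f b * g a) (f (-b)) :=
    (((Commute.refl b).neg_right).map f).mul_left (hc _ _).symm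
  rw [hexp_mul_of_semiconj h1, hexp_add h2, algHom_hexp f]

theorem right_x_mul_rExp :
    g x * hexp (f b * g a) = hexp (f b * g a) * f (hexp (-b)) * g x := by
  have h1 : (f b * g a + f (-b)) * g x = g x * (f b * g a) := by
    rw [add_mul, mul_assoc, (h.map g).ax, mul_add, map_neg, neg_mul, add_neg_cancel_right,
      ← mul_assoc, (hc b x).eq, mul_assoc]
  have h2 : Commute (f b * g a) (f (-b)) :=
    (((Commute.refl b).neg_right).map f).mul_left (hc _ _).symm
  rw [← hexp_mul_of_semiconj h1, hexp_add h2, algHom_hexp f]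

theorem left_x_mul_rExp :
    f x * hexp (f b * g a) = hexp (f b * g a) * g (hexp (-(eps • a))) * f x := by
  have h1 : (f b * g a + g (-(eps • a))) * f x = f x * (f b * g a) := by
    rw [add_mul, mul_assoc, ← (hc x a).eq, ← mul_assoc, (h.map f).bx, add_mul, mul_assoc,
      map_neg, map_smul, neg_mul, smul_mul_assoc, smul_mul_assoc, (hc x a).eq,
      add_neg_cancel_right]
  have h2 : Commute (f b * g a) (g (-(eps • a))) :=
    ((hc _ _)).mul_left (((Commute.refl a).smul_right eps).neg_right.map g)
  rw [← hexp_mul_of_semiconj h1, hexp_add h2, algHom_hexp g]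

omit h in
theorem rExp_commute_left {s : Compl T} (hs : Commute b s) : Commute (hexp (f b * g a)) (f s) :=
  hexp_commute ((hs.map f).mul_left (hc _ _).symm)

omit h in
theorem rExp_commute_right {s : Compl T} (hs : Commute a s) : Commute (hexp (f b * g a)) (g s) :=
  hexp_commute ((hc _ _).mul_left (hs.map g))

theorem rSum_commute_a : Commute (f a + g a) (rSum (f y) (hexp (f b * g a)) (g x)) := by
  refine commute_rSum (c := 1) ?_ ?_ ?_
  · rw [add_mul, (h.map f).ay, mul_add, (hc y a).eq, one_smul]
    abel
  · rw [add_mul, (h.map g).ax, mul_add, (hc a x).eq, one_smul]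
    abel
  · exact ((rExp_commute_left hc h.ab.symm).add_right
      (rExp_commute_right hc (Commute.refl a))).symm

theorem rSum_commute_b : Commute (f b + g b) (rSum (f y) (hexp (f b * g a)) (g x)) := by
  refine commute_rSum (c := eps) ?_ ?_ ?_
  · rw [add_mul, (h.map f).by', mul_add, (hc y b).eq]
    abel
  · rw [add_mul, (h.map g).bx, mul_add, (hc b x).eq]
    abel
  · exact ((rExp_commute_left hc (Commute.refl b)).add_right
      (rExp_commute_right hc h.ab)).symm

theorem rSum_mul_comul_y :
    rSum (f y) (hexp (f b * g a)) (g x) * (g y + f y * g (hexp (-b)))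
      = (f y + f (hexp (-b)) * g y) * rSum (f y) (hexp (f b * g a)) (g x) := by
  choose W hW hW' using h.exists_x_pow_mul_y
  have hEY := rExp_mul_left_y h hc
  have hEy := rExp_mul_right_y h hc
  have hEB : Commute (hexp (f b * g a)) (f (hexp (-b))) :=
    rExp_commute_left hc (hexp_commute (Commute.refl b).neg_left).symm
  generalize hexp (f b * g a) = E at *
  let W' : ℕ → Compl T := fun m => m.casesOn 0 W
  have hx : ∀ m, g x ^ m * g y = q ^ m • (g y * g x ^ m) + g (W' m) := by
    intro m
    rw [← map_pow, ← map_mul, ← map_mul, ← map_smul, ← map_add]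
    congr 1
    cases m with
    | zero => simp [W']
    | succ m => exact hW m
  have e2 : ∀ m, f (hexp (-b)) * f y ^ m = q ^ m • (f y ^ m * f (hexp (-b))) := by
    intro m
    rw [← map_pow, ← map_mul, ← map_mul, mul_pow_of_q_comm h.B_y, map_smul]
  have hYy : ∀ m, f y ^ m * g y = g y * f y ^ m := fun m => by rw [← map_pow, (hc _ _).eq]
  have hYX : ∀ m, g x ^ m * f y = f y * g x ^ m := fun m => by rw [← map_pow, (hc _ _).eq]
  have hXB : ∀ m, g x ^ m * g (hexp (-b)) = q ^ m • (g (hexp (-b)) * g x ^ m) := fun m => by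
    rw [← map_pow, ← map_mul, pow_mul_of_q_comm h.x_B, map_smul, map_mul]
  have e1 : ∀ m, f (hexp (-b)) * g y * (f y ^ m * E * g x ^ m)
      = q ^ m • (f y ^ m * E * (g y * g x ^ m)) := by
    intro m
    calc f (hexp (-b)) * g y * (f y ^ m * E * g x ^ m)
        = f (hexp (-b)) * (g y * f y ^ m) * (E * g x ^ m) := by simp only [mul_assoc]
      _ = f (hexp (-b)) * f y ^ m * (g y * (E * g x ^ m)) := by rw [← hYy]; simp only [mul_assoc]
      _ = q ^ m • (f y ^ m * (f (hexp (-b)) * g y * (E * g x ^ m))) := by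
          rw [e2, smul_mul_assoc]; simp only [mul_assoc]
      _ = q ^ m • (f y ^ m * (g y * (E * f (hexp (-b))) * g x ^ m)) := by
          rw [(hc _ _).eq, hEB.eq]; simp only [mul_assoc]
      _ = q ^ m • (f y ^ m * E * (g y * g x ^ m)) := by rw [← hEy]; simp only [mul_assoc]
  have s1 : rSum (f y) E (g x) * g y = f (hexp (-b)) * g y * rSum (f y) E (g x)
      + hsum fun m => qInv m • (f y ^ m * E * g (W' m)) := by
    rw [rSum, hsum_mul, mul_hsum, ← hsum_add]
    congr 1
    funext m
    rw [smul_mul_assoc, mul_assoc _ (g x ^ m), hx, mul_add, mul_smul_comm (q ^ m), ← e1, smul_add,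
      mul_smul_comm (qInv m)]
  have e3 : ∀ m, f y ^ m * E * g x ^ m * (f y * g (hexp (-b)))
      = q ^ m • (f y ^ (m + 1) * E * (g (hexp (-(eps • a) + -b)) * g x ^ m)) := by
    intro m
    calc f y ^ m * E * g x ^ m * (f y * g (hexp (-b)))
        = f y ^ m * E * ((g x ^ m * f y) * g (hexp (-b))) := by simp only [mul_assoc]
      _ = f y ^ m * (E * f y) * (g x ^ m * g (hexp (-b))) := by rw [hYX]; simp only [mul_assoc]
      _ = _ := by
        rw [hEY, hXB, mul_smul_comm, h.hexp_AB, map_mul, pow_succ]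
        simp only [mul_assoc]
  have s2 : (hsum fun m => qInv m • (f y ^ m * E * g (W' m)))
      = f y * rSum (f y) E (g x) - rSum (f y) E (g x) * (f y * g (hexp (-b))) := by
    rw [hsum_succ, rSum, mul_hsum, hsum_mul, ← hsum_sub, smul_hsum]
    have h0 : qInv 0 • (f y ^ 0 * E * g (W' 0)) = 0 := by simp [W']
    rw [h0, zero_add]
    congr 1
    funext m
    have h1 : hbar • g (W m) = qInt (m + 1) •
        (g x ^ m - q ^ m • (g (hexp (-(eps • a) + -b)) * g x ^ m)) := by
      rw [← map_smul, hW', map_smul, map_sub, map_smul, map_mul, map_pow]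
    rw [smul_comm hbar, ← mul_smul_comm hbar, show W' (m + 1) = W m from rfl, h1, mul_smul_comm,
      smul_smul, mul_comm (qInv _), qInt_mul_qInv, mul_sub, smul_sub, smul_mul_assoc (qInv m), e3,
      mul_smul_comm (q ^ m), mul_smul_comm (qInv m), pow_succ']
    simp only [mul_assoc]
  rw [mul_add, s1, s2, add_mul]
  abel

theorem comul_op_x_mul_rSum :
    (f x + f (hexp (-(eps • a))) * g x) * rSum (f y) (hexp (f b * g a)) (g x)
      = rSum (f y) (hexp (f b * g a)) (g x) * (g x + f x * g (hexp (-(eps • a)))) := by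
  choose W hW hW' using h.exists_x_mul_y_pow
  have hXE := right_x_mul_rExp h hc
  have hxE := left_x_mul_rExp h hc
  have hEB : Commute (hexp (f b * g a)) (f (hexp (-b))) :=
    rExp_commute_left hc (hexp_commute (Commute.refl b).neg_left).symm
  generalize hexp (f b * g a) = E at *
  let W' : ℕ → Compl T := fun m => m.casesOn 0 W
  have hx : ∀ m, f x * f y ^ m = q ^ m • (f y ^ m * f x) + f (W' m) := by
    intro m
    rw [← map_pow, ← map_mul, ← map_mul, ← map_smul, ← map_add]
    congr 1
    cases m with
    | zero => simp [W']
    | succ m => exact hW m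
  have e2 : ∀ m, g x ^ m * g (hexp (-(eps • a))) = q ^ m • (g (hexp (-(eps • a))) * g x ^ m) := by
    intro m
    rw [← map_pow, ← map_mul, ← map_mul, pow_mul_of_q_comm h.x_A, map_smul]
  have hxX : ∀ m, f x * g x ^ m = g x ^ m * f x := fun m => by rw [← map_pow, (hc _ _).eq]
  have hYX : ∀ m, g x * f y ^ m = f y ^ m * g x := fun m => by rw [← map_pow, (hc _ _).eq]
  have hAY : ∀ m, f (hexp (-(eps • a))) * f y ^ m = q ^ m • (f y ^ m * f (hexp (-(eps • a)))) :=
    fun m => by rw [← map_pow, ← map_mul, mul_pow_of_q_comm h.A_y, map_smul, map_mul]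
  have e1 : ∀ m, f y ^ m * E * g x ^ m * (f x * g (hexp (-(eps • a))))
      = q ^ m • (f y ^ m * f x) * E * g x ^ m := by
    intro m
    calc f y ^ m * E * g x ^ m * (f x * g (hexp (-(eps • a))))
        = f y ^ m * E * (g x ^ m * g (hexp (-(eps • a))) * f x) := by
          rw [(hc _ _).eq]; simp only [mul_assoc]
      _ = q ^ m • (f y ^ m * (E * g (hexp (-(eps • a))) * f x) * g x ^ m) := by
          rw [e2, smul_mul_assoc, mul_assoc _ _ (f x), ← hxX, mul_smul_comm]
          simp only [mul_assoc]
      _ = _ := by rw [← hxE]; simp only [mul_assoc, smul_mul_assoc]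
  have s1 : f x * rSum (f y) E (g x) = rSum (f y) E (g x) * (f x * g (hexp (-(eps • a))))
      + hsum fun m => qInv m • (f (W' m) * E * g x ^ m) := by
    rw [rSum, mul_hsum, hsum_mul, ← hsum_add]
    congr 1
    funext m
    rw [mul_smul_comm, ← mul_assoc, ← mul_assoc, hx, add_mul, add_mul, ← e1, smul_add,
      smul_mul_assoc (qInv m)]
  have e3 : ∀ m, f (hexp (-(eps • a))) * g x * (f y ^ m * E * g x ^ m)
      = q ^ m • (f y ^ m * f (hexp (-(eps • a) + -b)) * E * g x ^ (m + 1)) := by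
    intro m
    calc f (hexp (-(eps • a))) * g x * (f y ^ m * E * g x ^ m)
        = f (hexp (-(eps • a))) * (g x * f y ^ m) * (E * g x ^ m) := by simp only [mul_assoc]
      _ = f (hexp (-(eps • a))) * f y ^ m * (g x * E * g x ^ m) := by
          rw [hYX]; simp only [mul_assoc]
      _ = _ := by
        rw [hAY, hXE, smul_mul_assoc, hEB.eq, h.hexp_AB, map_mul, pow_succ']
        simp only [mul_assoc]
  have s2 : (hsum fun m => qInv m • (f (W' m) * E * g x ^ m))
      = rSum (f y) E (g x) * g x - f (hexp (-(eps • a))) * g x * rSum (f y) E (g x) := by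
    rw [hsum_succ, rSum, mul_hsum, hsum_mul, ← hsum_sub, smul_hsum]
    have h0 : qInv 0 • (f (W' 0) * E * g x ^ 0) = 0 := by simp [W']
    rw [h0, zero_add]
    congr 1
    funext m
    have h1 : hbar • f (W m) = qInt (m + 1) •
        (f y ^ m - q ^ m • (f y ^ m * f (hexp (-(eps • a) + -b)))) := by
      rw [← map_smul, hW', map_smul, map_sub, map_smul, map_mul, map_pow]
    rw [smul_comm hbar, ← smul_mul_assoc hbar, ← smul_mul_assoc hbar,
      show W' (m + 1) = W m from rfl, h1, smul_mul_assoc, smul_mul_assoc,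
      smul_smul, mul_comm (qInv _), qInt_mul_qInv, sub_mul, sub_mul, smul_sub,
      mul_smul_comm (qInv m), e3, smul_mul_assoc, smul_mul_assoc, smul_mul_assoc (qInv m)]
    simp only [mul_assoc, pow_succ]
  rw [add_mul, s1, s2, mul_add]
  abel

end RMatrix

section Hexagons

variable {T U : Type*} [Ring T] [Algebra K T] [Ring U] [Algebra K U]
  {y b a x : Compl T} (h : DRel y b a x) {f₁ f₂ f₃ : Compl T →ₐ[K] Compl U}
  (h₁₂ : ∀ s t, Commute (f₁ s) (f₂ t)) (h₁₃ : ∀ s t, Commute (f₁ s) (f₃ t))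
  (h₂₃ : ∀ s t, Commute (f₂ s) (f₃ t))
include h h₁₂ h₁₃ h₂₃

theorem rSum_comul_left :
    rSum (f₂ y + f₁ y * f₂ (hexp (-b))) (hexp ((f₁ b + f₂ b) * f₃ a)) (f₃ x)
      = rSum (f₁ y) (hexp (f₁ b * f₃ a)) (f₃ x) * rSum (f₂ y) (hexp (f₂ b * f₃ a)) (f₃ x) := by
  have hE : hexp ((f₁ b + f₂ b) * f₃ a) = hexp (f₁ b * f₃ a) * hexp (f₂ b * f₃ a) := by
    rw [add_mul, hexp_add]
    refine Commute.mul_left (Commute.mul_right (h₁₂ _ _) (h₁₃ _ _)) ?_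
    exact Commute.mul_right (h₂₃ _ _).symm (Commute.refl _)
  have hq : f₁ y * f₂ (hexp (-b)) * f₂ y = q • (f₂ y * (f₁ y * f₂ (hexp (-b)))) := by
    rw [mul_assoc, ← map_mul, h.B_y, map_smul, map_mul, mul_smul_comm, ← mul_assoc, (h₁₂ _ _).eq,
      mul_assoc]
  have hXE := right_x_mul_rExp h h₂₃
  have cE1y : Commute (hexp (f₁ b * f₃ a)) (f₂ y) :=
    hexp_commute ((h₁₂ _ _).mul_left (h₂₃ _ _).symm)
  have cE1B : Commute (hexp (f₁ b * f₃ a)) (f₂ (hexp (-b))) :=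
    hexp_commute ((h₁₂ _ _).mul_left (h₂₃ _ _).symm)
  have cE2B : Commute (hexp (f₂ b * f₃ a)) (f₂ (hexp (-b))) :=
    rExp_commute_left h₂₃ (hexp_commute (Commute.refl b).neg_left).symm
  have cYB : Commute (f₁ y) (f₂ (hexp (-b))) := h₁₂ _ _
  have cXB : Commute (f₃ x) (f₂ (hexp (-b))) := (h₂₃ _ _).symm
  have cXy : Commute (f₃ x) (f₂ y) := (h₂₃ _ _).symm
  have cYy : Commute (f₁ y) (f₂ y) := h₁₂ _ _
  rw [hE]
  generalize hexp (f₁ b * f₃ a) = E₁ at *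
  generalize hexp (f₂ b * f₃ a) = E₂ at *
  generalize f₂ (hexp (-b)) = B₂ at *
  generalize f₁ y = Y at *
  generalize f₂ y = Z at *
  generalize f₃ x = X at *
  have hXE' : ∀ j, X ^ j * E₂ = B₂ ^ j * E₂ * X ^ j := by
    intro j
    induction j with
    | zero => simp
    | succ j ih =>
      rw [pow_succ, mul_assoc, hXE, cE2B.eq, ← mul_assoc, ← mul_assoc, (cXB.pow_left j).eq,
        mul_assoc B₂, ih, pow_succ']
      simp only [mul_assoc]
  rw [rSum, rSum, rSum, hsum_mul_hsum]
  congr 1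
  funext n
  rw [← smul_mul_assoc, ← smul_mul_assoc, q_binomial hq, Finset.sum_mul, Finset.sum_mul,
    ← Finset.Nat.sum_antidiagonal_swap]
  refine Finset.sum_congr rfl fun p hp => ?_
  rw [← Finset.HasAntidiagonal.mem_antidiagonal.1 hp]
  simp only [Prod.fst_swap, Prod.snd_swap, smul_mul_assoc, mul_smul_comm]
  rw [smul_comm]
  congr 2
  rw [cYB.mul_pow]
  calc Z ^ p.2 * (Y ^ p.1 * B₂ ^ p.1) * (E₁ * E₂) * X ^ (p.1 + p.2)
      = Z ^ p.2 * Y ^ p.1 * (B₂ ^ p.1 * E₁) * E₂ * X ^ (p.1 + p.2) := by simp only [mul_assoc]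
    _ = Y ^ p.1 * (Z ^ p.2 * E₁) * (B₂ ^ p.1 * E₂ * X ^ p.1) * X ^ p.2 := by
        rw [← (cE1B.pow_right p.1).eq, ← ((cYy.pow_left p.1).pow_right p.2).eq, pow_add]
        simp only [mul_assoc]
    _ = Y ^ p.1 * E₁ * (Z ^ p.2 * X ^ p.1) * E₂ * X ^ p.2 := by
        rw [← (cE1y.pow_right p.2).eq, ← hXE']
        simp only [mul_assoc]
    _ = _ := by
        rw [← ((cXy.pow_left p.1).pow_right p.2).eq]
        simp only [mul_assoc]

theorem rSum_comul_right :
    rSum (f₁ y) (hexp (f₁ b * (f₂ a + f₃ a))) (f₃ x + f₂ x * f₃ (hexp (-(eps • a))))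
      = rSum (f₁ y) (hexp (f₁ b * f₃ a)) (f₃ x) * rSum (f₁ y) (hexp (f₁ b * f₂ a)) (f₂ x) := by
  have cE : Commute (f₁ b * f₂ a) (f₁ b * f₃ a) :=
    Commute.mul_left (Commute.mul_right (Commute.refl _) (h₁₃ _ _))
      (Commute.mul_right (h₁₂ _ _).symm (h₂₃ _ _))
  have hE : hexp (f₁ b * (f₂ a + f₃ a)) = hexp (f₁ b * f₂ a) * hexp (f₁ b * f₃ a) := by
    rw [mul_add, hexp_add cE]
  have cEE : Commute (hexp (f₁ b * f₂ a)) (hexp (f₁ b * f₃ a)) :=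
    hexp_commute (hexp_commute cE.symm).symm
  have hq : f₃ x * (f₂ x * f₃ (hexp (-(eps • a)))) = q • (f₂ x * f₃ (hexp (-(eps • a))) * f₃ x) := by
    rw [← mul_assoc, ← (h₂₃ _ _).eq, mul_assoc, ← map_mul, h.x_A, map_smul, map_mul,
      mul_smul_comm, mul_assoc]
  have hEY := rExp_mul_left_y h h₁₃
  have cE2x : Commute (hexp (f₁ b * f₂ a)) (f₃ x) :=
    hexp_commute ((h₁₃ _ _).mul_left (h₂₃ _ _))
  have cE2A : Commute (hexp (f₁ b * f₂ a)) (f₃ (hexp (-(eps • a)))) :=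
    hexp_commute ((h₁₃ _ _).mul_left (h₂₃ _ _))
  have cXA : Commute (f₂ x) (f₃ (hexp (-(eps • a)))) := h₂₃ _ _
  have cXX : Commute (f₂ x) (f₃ x) := h₂₃ _ _
  have cAY : Commute (f₁ y) (f₃ (hexp (-(eps • a)))) := h₁₃ _ _
  have cYX : Commute (f₁ y) (f₃ x) := h₁₃ _ _
  rw [hE]
  generalize hexp (f₁ b * f₃ a) = E₃ at *
  generalize hexp (f₁ b * f₂ a) = E₂ at *
  generalize f₃ (hexp (-(eps • a))) = A₃ at *
  generalize f₁ y = Y at *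
  generalize f₂ x = X₂ at *
  generalize f₃ x = X₃ at *
  have hEY' : ∀ j, E₃ * Y ^ j = Y ^ j * (E₃ * A₃ ^ j) := by
    intro j
    induction j with
    | zero => simp
    | succ j ih =>
      rw [pow_succ, ← mul_assoc, ih, mul_assoc, mul_assoc, ← (cAY.pow_right j).eq,
        ← mul_assoc E₃, hEY, pow_succ' A₃]
      simp only [mul_assoc]
  rw [rSum, rSum, rSum, hsum_mul_hsum]
  congr 1
  funext n
  rw [add_comm X₃, ← mul_smul_comm, q_binomial hq, Finset.mul_sum,
    ← Finset.Nat.sum_antidiagonal_swap]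
  refine Finset.sum_congr rfl fun p hp => ?_
  rw [← Finset.HasAntidiagonal.mem_antidiagonal.1 hp]
  simp only [Prod.fst_swap, Prod.snd_swap, smul_mul_assoc, mul_smul_comm]
  rw [smul_comm]
  congr 2
  rw [cXA.mul_pow]
  calc Y ^ (p.1 + p.2) * (E₂ * E₃) * (X₂ ^ p.2 * A₃ ^ p.2 * X₃ ^ p.1)
      = Y ^ (p.1 + p.2) * E₃ * (E₂ * A₃ ^ p.2) * X₃ ^ p.1 * X₂ ^ p.2 := by
        rw [cEE.eq, ((cXA.pow_left p.2).pow_right p.2).eq, mul_assoc (A₃ ^ p.2),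
          ((cXX.pow_left p.2).pow_right p.1).eq]
        simp only [mul_assoc]
    _ = Y ^ p.1 * (Y ^ p.2 * (E₃ * A₃ ^ p.2)) * (E₂ * X₃ ^ p.1) * X₂ ^ p.2 := by
        rw [(cE2A.pow_right p.2).eq, pow_add]
        simp only [mul_assoc]
    _ = Y ^ p.1 * E₃ * (Y ^ p.2 * X₃ ^ p.1) * E₂ * X₂ ^ p.2 := by
        rw [← hEY', (cE2x.pow_right p.1).eq]
        simp only [mul_assoc]
    _ = _ := by
        rw [((cYX.pow_left p.2).pow_right p.1).eq]
        simp only [mul_assoc]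

end Hexagons

section QuasitriangularD

theorem l13_Rmatrix : l13 Rmatrix = rSum (l1 y) (hexp (l1 b * l3 a)) (l3 x) := by
  rw [Rmatrix_eq, map_rSum, algHom_hexp, map_mul, l13_tenL, l13_tenL, l13_tenR, l13_tenR]

theorem l23_Rmatrix : l23 Rmatrix = rSum (l2 y) (hexp (l2 b * l3 a)) (l3 x) := by
  rw [Rmatrix_eq, map_rSum, algHom_hexp, map_mul, l23_tenL, l23_tenL, l23_tenR, l23_tenR]

theorem l12_Rmatrix : l12 Rmatrix = rSum (l1 y) (hexp (l1 b * l2 a)) (l2 x) := by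
  rw [Rmatrix_eq, map_rSum, algHom_hexp, map_mul, l12_tenL, l12_tenL, l12_tenR, l12_tenR]

theorem comulId_Rmatrix : comulIdA comulD Rmatrix = l13 Rmatrix * l23 Rmatrix := by
  have hy : l12 (comulD y) = l2 y + l1 y * l2 B := by
    rw [comulD_y]
    simp only [map_add, map_mul, l12_tenL, l12_tenR]
  have hb : l12 (comulD b) = l1 b + l2 b := by
    rw [comulD_b]
    simp only [map_add, l12_tenL, l12_tenR]
  have h := map_rSum (comulIdA comulD) (tenL y) (hexp (tenL b * tenR a)) (tenR x)
  rw [algHom_hexp, map_mul, comulIdA_tenL, comulIdA_tenL, comulIdA_tenR, comulIdA_tenR, hy, hb,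
    ← Rmatrix_eq] at h
  rw [l13_Rmatrix, l23_Rmatrix, h]
  exact rSum_comul_left dRel_D l1_l2_commute l1_l3_commute l2_l3_commute

theorem idComul_Rmatrix : idComulA comulD Rmatrix = l13 Rmatrix * l12 Rmatrix := by
  have hx : l23 (comulD x) = l3 x + l2 x * l3 A := by
    rw [comulD_x]
    simp only [map_add, map_mul, l23_tenL, l23_tenR]
  have ha : l23 (comulD a) = l2 a + l3 a := by
    rw [comulD_a]
    simp only [map_add, l23_tenL, l23_tenR]
  have h := map_rSum (idComulA comulD) (tenL y) (hexp (tenL b * tenR a)) (tenR x)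
  rw [algHom_hexp, map_mul, idComulA_tenL, idComulA_tenL, idComulA_tenR, idComulA_tenR, hx, ha,
    ← Rmatrix_eq] at h
  rw [l13_Rmatrix, l12_Rmatrix, h]
  exact rSum_comul_right dRel_D l1_l2_commute l1_l3_commute l2_l3_commute

theorem comul_op_Rmatrix (d : D) : flip (comulD d) * Rmatrix = Rmatrix * comulD d := by
  have key : ∀ g : D, flip (comulD g) * Rmatrix = Rmatrix * comulD g → ∀ d : D,
      flip (comulD d) * Rmatrix = Rmatrix * comulD d →
      flip (comulD (g * d)) * Rmatrix = Rmatrix * comulD (g * d) := by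
    intro g hg d hd
    rw [map_mul, flip_mul, mul_assoc, hd, ← mul_assoc, hg, mul_assoc]
  refine LinearMap.congr_fun (linearMap_ext_D
    (f := LinearMap.mulRight K Rmatrix ∘ₗ flip ∘ₗ comulD.toLinearMap)
    (g := LinearMap.mulLeft K Rmatrix ∘ₗ comulD.toLinearMap) ?_ (key y ?_) (key b ?_) (key a ?_)
    (key x ?_)) d
  · simp [flip_one]
  · rw [comulD_y, map_add, flip_mul, flip_tenL, flip_tenR, flip_tenR, (tenR_tenL_commute _ _).eq,
      Rmatrix_eq]
    exact (rSum_mul_comul_y dRel_D tenL_tenR_commute).symm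
  · rw [comulD_b, map_add, flip_tenL, flip_tenR, Rmatrix_eq, add_comm (tenR b)]
    exact rSum_commute_b dRel_D tenL_tenR_commute
  · rw [comulD_a, map_add, flip_tenL, flip_tenR, Rmatrix_eq, add_comm (tenR a)]
    exact rSum_commute_a dRel_D tenL_tenR_commute
  · rw [comulD_x, map_add, flip_mul, flip_tenL, flip_tenR, flip_tenR, (tenR_tenL_commute _ _).eq,
      Rmatrix_eq]
    exact comul_op_x_mul_rSum dRel_D tenL_tenR_commute

end QuasitriangularD

/-! ### Quasitriangular Hopf algebras -/

section Drinfeld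

variable {H : Type*} [Ring H] [Algebra K H]

/-- The linear map `s ⊗ t ↦ g t * f s`. -/
def revLift {T : Type*} [Ring T] [Algebra K T] (f g : H →ₗ[K] Compl T) : Ten2 H →ₗ[K] Compl T :=
  extend (mulLift g f ∘ₗ (TensorProduct.comm K H H).toLinearMap)

theorem revLift_ten {T : Type*} [Ring T] [Algebra K T] (f g : H →ₗ[K] Compl T) (s t : H) :
    revLift f g (ten s t) = g t * f s := by
  rw [revLift, ten, extend_of]
  simp [mulLift]

/-- The linear map `s ⊗ t ⊗ r ↦ h r * (f s * g t)`. -/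
def revLift3 {T : Type*} [Ring T] [Algebra K T] (f g h : H →ₗ[K] Compl T) :
    Ten3 H →ₗ[K] Compl T :=
  extend (mulLift h (mulLift f g) ∘ₗ (TensorProduct.comm K (H ⊗[K] H) H).toLinearMap)

theorem revLift3_ten3 {T : Type*} [Ring T] [Algebra K T] (f g h : H →ₗ[K] Compl T) (s t r : H) :
    revLift3 f g h (ten3 s t r) = h r * (f s * g t) := by
  rw [revLift3, ten3, extend_of]
  simp [mulLift]

theorem mapTen_mapTen (f g f' g' : H →ₗ[K] H) (X : Ten2 H) :
    mapTen f g (mapTen f' g' X) = mapTen (f ∘ₗ f') (g ∘ₗ g') X :=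
  LinearMap.congr_fun (Ten2.linearMap_ext (f := mapTen f g ∘ₗ mapTen f' g')
    (g := mapTen (f ∘ₗ f') (g ∘ₗ g')) fun s t => by simp [mapTen_ten]) X

theorem l13_ten_mul_l23_ten (s r t r' : H) :
    l13 (ten s r) * l23 (ten t r') = ten3 s t (r * r') := by
  rw [l13_ten, l23_ten, ten3_mul_ten3, mul_one, one_mul]

theorem l13_ten_mul_l12_ten (s r s' t : H) :
    l13 (ten s r) * l12 (ten s' t) = ten3 (s * s') t r := by
  rw [l13_ten, l12_ten, ten3_mul_ten3, mul_one, one_mul]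

theorem l12_ten_mul_l3 (s t r : H) : l12 (ten s t) * l3 r = ten3 s t r := by
  rw [l12_ten, l3_apply, ten3_mul_ten3, mul_one, mul_one, one_mul]

theorem l1_mul_l23_ten (s t r : H) : l1 s * l23 (ten t r) = ten3 s t r := by
  rw [l23_ten, l1_apply, ten3_mul_ten3, mul_one, one_mul, one_mul]

theorem comulIdA_ten (Δ : H →ₐ[K] Ten2 H) (s t : H) :
    comulIdA Δ (ten s t) = l12 (Δ s) * l3 t := by
  rw [ten_eq, map_mul, comulIdA_tenL, comulIdA_tenR]

theorem idComulA_ten (Δ : H →ₐ[K] Ten2 H) (s t : H) :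
    idComulA Δ (ten s t) = l1 s * l23 (Δ t) := by
  rw [ten_eq, map_mul, idComulA_tenL, idComulA_tenR]

/-- Two maps that are linear in two variables in completed tensor squares agree if they agree on
pure tensors. -/
theorem bilin_ext {N : Type*} [AddCommGroup N] [Module K N] [HSep N]
    {F G : Ten2 H →ₗ[K] Ten2 H →ₗ[K] N}
    (h : ∀ s r t r', F (ten s r) (ten t r') = G (ten s r) (ten t r')) (X Y : Ten2 H) :
    F X Y = G X Y := by
  have h1 : ∀ s r, F (ten s r) = G (ten s r) := fun s r => Ten2.linearMap_ext (h s r)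
  exact LinearMap.congr_fun (Ten2.linearMap_ext (f := F.flip Y) (g := G.flip Y) fun s r => by
    simp [h1]) X

variable [HComplete H]

/-- The data of a quasitriangular Hopf algebra with an antimultiplicative antipode, in terms of
maps between complete algebras. -/
structure QTri (Δ : H →ₐ[K] Ten2 H) (ε : H →ₐ[K] K) (S : H →ₗ[K] H) (R : Ten2 H) : Prop where
  S_one : S 1 = 1
  S_mul : ∀ s t, S (s * t) = S t * S s
  antipode_comul : ∀ s, mulD S LinearMap.id (Δ s) = algebraMap K H (ε s)
  comul_antipode : ∀ s, mulD LinearMap.id S (Δ s) = algebraMap K H (ε s)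
  comul_S : ∀ s, Δ (S s) = mapTen S S (flip (Δ s))
  counit_left : mulD (unitCounit ε) LinearMap.id R = 1
  counit_right : mulD LinearMap.id (unitCounit ε) R = 1
  comul_id : comulIdA Δ R = l13 R * l23 R
  id_comul : idComulA Δ R = l13 R * l12 R
  comul_op : ∀ s, flip (Δ s) * R = R * Δ s

namespace QTri

variable {Δ : H →ₐ[K] Ten2 H} {ε : H →ₐ[K] K} {S : H →ₗ[K] H} {R : Ten2 H} (h : QTri Δ ε S R)
include h

theorem inv_mul : mapTen S LinearMap.id R * R = 1 := by
  let Θ : Ten3 H →ₗ[K] Ten2 H :=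
    ten3Lift (tenL.toLinearMap ∘ₗ S) tenL.toLinearMap tenR.toLinearMap
  have hΘ : ∀ s t r, Θ (ten3 s t r) = ten (S s * t) r := fun s t r => by
    rw [ten3Lift_ten3, ten_eq, map_mul]
    rfl
  have h1 : Θ (l13 R * l23 R) = mapTen S LinearMap.id R * R :=
    bilin_ext (F := ((LinearMap.mul K (Ten3 H)).compl₁₂ l13.toLinearMap l23.toLinearMap).compr₂ Θ)
      (G := (LinearMap.mul K (Ten2 H)).compl₁₂ (mapTen S LinearMap.id) LinearMap.id)
      (fun s r t r' => by
        simp only [LinearMap.compr₂_apply, LinearMap.compl₁₂_apply, LinearMap.mul_apply',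
          AlgHom.toLinearMap_apply, l13_ten_mul_l23_ten, hΘ, mapTen_ten, LinearMap.id_apply,
          ten_mul_ten]) R R
  have h2 : ∀ Z r, Θ (l12 Z * l3 r) = tenL (mulD S LinearMap.id Z) * tenR r := fun Z r =>
    LinearMap.congr_fun (Ten2.linearMap_ext
      (f := Θ ∘ₗ LinearMap.mulRight K (l3 r) ∘ₗ l12.toLinearMap)
      (g := LinearMap.mulRight K (tenR r) ∘ₗ tenL.toLinearMap ∘ₗ mulD S LinearMap.id)
      fun s t => by
        simp only [LinearMap.comp_apply, LinearMap.mulRight_apply, AlgHom.toLinearMap_apply,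
          l12_ten_mul_l3, hΘ, mulD_ten, LinearMap.id_apply]
        rw [ten_eq]) Z
  have h3 : Θ (comulIdA Δ R) = tenR (mulD (unitCounit ε) LinearMap.id R) :=
    LinearMap.congr_fun (Ten2.linearMap_ext (f := Θ ∘ₗ (comulIdA Δ).toLinearMap)
      (g := tenR.toLinearMap ∘ₗ mulD (unitCounit ε) LinearMap.id) fun s t => by
        simp only [LinearMap.comp_apply, AlgHom.toLinearMap_apply, comulIdA_ten, h2,
          h.antipode_comul, mulD_ten, unitCounit_apply, LinearMap.id_apply, map_mul,
          AlgHom.commutes]) R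
  rw [← h1, ← h.comul_id, h3, h.counit_left, map_one]

theorem mul_inv : R * mapTen S LinearMap.id R = 1 := by
  let Θ : Ten3 H →ₗ[K] Ten2 H :=
    ten3Lift tenL.toLinearMap (tenL.toLinearMap ∘ₗ S) tenR.toLinearMap
  have hΘ : ∀ s t r, Θ (ten3 s t r) = ten (s * S t) r := fun s t r => by
    rw [ten3Lift_ten3, ten_eq, map_mul]
    rfl
  have h1 : Θ (l13 R * l23 R) = R * mapTen S LinearMap.id R :=
    bilin_ext (F := ((LinearMap.mul K (Ten3 H)).compl₁₂ l13.toLinearMap l23.toLinearMap).compr₂ Θ)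
      (G := (LinearMap.mul K (Ten2 H)).compl₁₂ LinearMap.id (mapTen S LinearMap.id))
      (fun s r t r' => by
        simp only [LinearMap.compr₂_apply, LinearMap.compl₁₂_apply, LinearMap.mul_apply',
          AlgHom.toLinearMap_apply, l13_ten_mul_l23_ten, hΘ, mapTen_ten, LinearMap.id_apply,
          ten_mul_ten]) R R
  have h2 : ∀ Z r, Θ (l12 Z * l3 r) = tenL (mulD LinearMap.id S Z) * tenR r := fun Z r =>
    LinearMap.congr_fun (Ten2.linearMap_ext
      (f := Θ ∘ₗ LinearMap.mulRight K (l3 r) ∘ₗ l12.toLinearMap)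
      (g := LinearMap.mulRight K (tenR r) ∘ₗ tenL.toLinearMap ∘ₗ mulD LinearMap.id S)
      fun s t => by
        simp only [LinearMap.comp_apply, LinearMap.mulRight_apply, AlgHom.toLinearMap_apply,
          l12_ten_mul_l3, hΘ, mulD_ten, LinearMap.id_apply]
        rw [ten_eq]) Z
  have h3 : Θ (comulIdA Δ R) = tenR (mulD (unitCounit ε) LinearMap.id R) :=
    LinearMap.congr_fun (Ten2.linearMap_ext (f := Θ ∘ₗ (comulIdA Δ).toLinearMap)
      (g := tenR.toLinearMap ∘ₗ mulD (unitCounit ε) LinearMap.id) fun s t => by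
        simp only [LinearMap.comp_apply, AlgHom.toLinearMap_apply, comulIdA_ten, h2,
          h.comul_antipode, mulD_ten, unitCounit_apply, LinearMap.id_apply, map_mul,
          AlgHom.commutes]) R
  rw [← h1, ← h.comul_id, h3, h.counit_left, map_one]

theorem antipode_R : mapTen S S R = R := by
  let Θ : Ten3 H →ₗ[K] Ten2 H :=
    ten3Lift (tenL.toLinearMap ∘ₗ S) (tenR.toLinearMap ∘ₗ S) tenR.toLinearMap
  have hΘ : ∀ s t r, Θ (ten3 s t r) = ten (S s) (S t * r) := fun s t r => by
    rw [ten3Lift_ten3, ten_eq, map_mul, ← mul_assoc]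
    rfl
  have h1 : Θ (l13 R * l12 R) = mapTen S S R * mapTen S LinearMap.id R :=
    bilin_ext (F := ((LinearMap.mul K (Ten3 H)).compl₁₂ l13.toLinearMap l12.toLinearMap).compr₂ Θ)
      (G := ((LinearMap.mul K (Ten2 H)).compl₁₂ (mapTen S S) (mapTen S LinearMap.id)).flip)
      (fun s r t r' => by
        simp only [LinearMap.compr₂_apply, LinearMap.compl₁₂_apply, LinearMap.mul_apply',
          AlgHom.toLinearMap_apply, l13_ten_mul_l12_ten, hΘ, mapTen_ten, LinearMap.id_apply,
          LinearMap.flip_apply, ten_mul_ten, h.S_mul]) R R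
  have h2 : ∀ s Z, Θ (l1 s * l23 Z) = tenL (S s) * tenR (mulD S LinearMap.id Z) := fun s Z =>
    LinearMap.congr_fun (Ten2.linearMap_ext
      (f := Θ ∘ₗ LinearMap.mulLeft K (l1 s) ∘ₗ l23.toLinearMap)
      (g := LinearMap.mulLeft K (tenL (S s)) ∘ₗ tenR.toLinearMap ∘ₗ mulD S LinearMap.id)
      fun t r => by
        simp only [LinearMap.comp_apply, LinearMap.mulLeft_apply, AlgHom.toLinearMap_apply,
          l1_mul_l23_ten, hΘ, mulD_ten, LinearMap.id_apply]
        rw [ten_eq]) Z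
  have h3 : Θ (idComulA Δ R) = tenL (S (mulD LinearMap.id (unitCounit ε) R)) :=
    LinearMap.congr_fun (Ten2.linearMap_ext (f := Θ ∘ₗ (idComulA Δ).toLinearMap)
      (g := tenL.toLinearMap ∘ₗ S ∘ₗ mulD LinearMap.id (unitCounit ε)) fun s t => by
        simp only [LinearMap.comp_apply, AlgHom.toLinearMap_apply, idComulA_ten, h2,
          h.antipode_comul, mulD_ten, unitCounit_apply, LinearMap.id_apply,
          AlgHom.commutes, ← Algebra.commutes (ε t), ← Algebra.smul_def, map_smul]) R
  have h4 : mapTen S S R * mapTen S LinearMap.id R = 1 := by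
    rw [← h1, ← h.id_comul, h3, h.counit_right, h.S_one, map_one]
  calc mapTen S S R = mapTen S S R * (mapTen S LinearMap.id R * R) := by rw [h.inv_mul, mul_one]
    _ = R := by rw [← mul_assoc, h4, one_mul]

theorem comul_mul_inv (s : H) :
    Δ s * mapTen S LinearMap.id R = mapTen S LinearMap.id R * flip (Δ s) := by
  calc Δ s * mapTen S LinearMap.id R
      = mapTen S LinearMap.id R * (R * Δ s) * mapTen S LinearMap.id R := by
        rw [← mul_assoc, h.inv_mul, one_mul]
    _ = mapTen S LinearMap.id R * flip (Δ s) * (R * mapTen S LinearMap.id R) := by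
        rw [← h.comul_op]; simp only [mul_assoc]
    _ = _ := by rw [h.mul_inv, mul_one]

/-- The identity `∑ S(s₂) u s₁ = ε(s) u` for the Drinfeld element `u`. -/
theorem revLift_comul (s : H) :
    mulD S LinearMap.id (flip (R * Δ s)) = ε s • mulD S LinearMap.id (flip R) := by
  have h1 : mulD S LinearMap.id (flip (flip (Δ s) * R))
      = mulD S LinearMap.id (flip (tenL (mulD S LinearMap.id (Δ s)) * R)) :=
    bilin_ext (F := ((LinearMap.mul K (Ten2 H)).compl₁₂ flip LinearMap.id).compr₂
        (mulD S LinearMap.id ∘ₗ flip))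
      (G := ((LinearMap.mul K (Ten2 H)).compl₁₂ (tenL.toLinearMap ∘ₗ mulD S LinearMap.id)
        LinearMap.id).compr₂ (mulD S LinearMap.id ∘ₗ flip))
      (fun s r t r' => by
        simp only [LinearMap.compr₂_apply, LinearMap.compl₁₂_apply, LinearMap.mul_apply',
          AlgHom.toLinearMap_apply, LinearMap.comp_apply, flip_ten, mulD_ten, LinearMap.id_apply,
          ten_mul_ten, tenL_apply, h.S_mul, one_mul, mul_assoc]) (Δ s) R
  rw [← h.comul_op, h1, h.antipode_comul, AlgHom.commutes, ← Algebra.smul_def, map_smul, map_smul]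

theorem comul_drinfeld {u : H} (hu : u = mulD S LinearMap.id (flip R))
    (hconj : ∀ s, u * s = S (S s) * u) :
    Δ u = mapTen S LinearMap.id R * flip (mapTen S LinearMap.id R) * ten u u := by
  let N : Ten2 H →ₗ[K] Ten2 H := revLift tenL.toLinearMap (Δ.toLinearMap ∘ₗ S)
  have hN : ∀ s t, N (ten s t) = Δ (S t) * tenL s := fun s t => revLift_ten _ _ s t
  have hNR : N R = mapTen S LinearMap.id R * tenL u := by
    let Θ : Ten3 H →ₗ[K] Ten2 H :=
      revLift3 tenL.toLinearMap (tenR.toLinearMap ∘ₗ S) (tenL.toLinearMap ∘ₗ S)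
    have hΘ : ∀ s t r, Θ (ten3 s t r) = ten (S r * s) (S t) := fun s t r => by
      rw [revLift3_ten3, ten_eq, map_mul, mul_assoc]
      rfl
    have h1 : Θ (l13 R * l12 R) = tenL (mulD S LinearMap.id (flip R)) * mapTen LinearMap.id S R :=
      bilin_ext
        (F := ((LinearMap.mul K (Ten3 H)).compl₁₂ l13.toLinearMap l12.toLinearMap).compr₂ Θ)
        (G := (LinearMap.mul K (Ten2 H)).compl₁₂ (tenL.toLinearMap ∘ₗ mulD S LinearMap.id ∘ₗ flip)
          (mapTen LinearMap.id S))
        (fun s r t r' => by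
          simp only [LinearMap.compr₂_apply, LinearMap.compl₁₂_apply, LinearMap.mul_apply',
            AlgHom.toLinearMap_apply, l13_ten_mul_l12_ten, hΘ, mapTen_ten, LinearMap.id_apply,
            LinearMap.comp_apply, flip_ten, mulD_ten, tenL_apply, ten_mul_ten, one_mul,
            mul_assoc]) R R
    have h2 : ∀ s Z, Θ (l1 s * l23 Z) = mapTen S S (flip Z) * tenL s := fun s Z =>
      LinearMap.congr_fun (Ten2.linearMap_ext
        (f := Θ ∘ₗ LinearMap.mulLeft K (l1 s) ∘ₗ l23.toLinearMap)
        (g := LinearMap.mulRight K (tenL s) ∘ₗ mapTen S S ∘ₗ flip)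
        fun t r => by
          simp only [LinearMap.comp_apply, LinearMap.mulLeft_apply, LinearMap.mulRight_apply,
            AlgHom.toLinearMap_apply, l1_mul_l23_ten, hΘ, flip_ten, mapTen_ten, tenL_apply,
            ten_mul_ten, mul_one]) Z
    have h3 : N R = Θ (idComulA Δ R) :=
      LinearMap.congr_fun (Ten2.linearMap_ext (f := N) (g := Θ ∘ₗ (idComulA Δ).toLinearMap)
        fun s t => by
          simp only [LinearMap.comp_apply, AlgHom.toLinearMap_apply, idComulA_ten, h2, hN,
            h.comul_S]) R
    have h4 : tenL u * mapTen LinearMap.id S R = mapTen (S ∘ₗ S) S R * tenL u :=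
      LinearMap.congr_fun (Ten2.linearMap_ext
        (f := LinearMap.mulLeft K (tenL u) ∘ₗ mapTen LinearMap.id S)
        (g := LinearMap.mulRight K (tenL u) ∘ₗ mapTen (S ∘ₗ S) S) fun s t => by
          simp only [LinearMap.comp_apply, LinearMap.mulLeft_apply, LinearMap.mulRight_apply,
            mapTen_ten, tenL_apply, ten_mul_ten, LinearMap.id_apply, hconj, one_mul, mul_one]) R
    have h5 : mapTen (S ∘ₗ S) S R = mapTen S LinearMap.id R := by
      conv_rhs => rw [← h.antipode_R]
      rw [mapTen_mapTen, LinearMap.id_comp]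
    rw [h3, h.id_comul, h1, ← hu, h4, h5]
  let L : Ten3 H →ₗ[K] Ten2 H :=
    revLift3 tenL.toLinearMap tenR.toLinearMap (Δ.toLinearMap ∘ₗ S)
  have hL : ∀ s t r, L (ten3 s t r) = Δ (S r) * ten s t := fun s t r => by
    rw [revLift3_ten3, ten_eq]
    rfl
  have h6 : ∀ Z r, L (l12 Z * l3 r) = Δ (S r) * Z := fun Z r =>
    LinearMap.congr_fun (Ten2.linearMap_ext
      (f := L ∘ₗ LinearMap.mulRight K (l3 r) ∘ₗ l12.toLinearMap)
      (g := LinearMap.mulLeft K (Δ (S r))) fun s t => by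
        simp only [LinearMap.comp_apply, LinearMap.mulRight_apply, LinearMap.mulLeft_apply,
          AlgHom.toLinearMap_apply, l12_ten_mul_l3, hL]) Z
  have h7 : Δ (mulD S LinearMap.id (flip R)) = L (comulIdA Δ R) :=
    LinearMap.congr_fun (Ten2.linearMap_ext
      (f := Δ.toLinearMap ∘ₗ mulD S LinearMap.id ∘ₗ flip) (g := L ∘ₗ (comulIdA Δ).toLinearMap)
      fun s t => by
        simp only [LinearMap.comp_apply, AlgHom.toLinearMap_apply, comulIdA_ten, h6, flip_ten,
          mulD_ten, LinearMap.id_apply, map_mul]) R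
  let M : Ten2 H → Ten2 H →ₗ[K] Ten2 H := fun Z =>
    revLift tenR.toLinearMap (LinearMap.mulRight K Z ∘ₗ Δ.toLinearMap ∘ₗ S)
  have hM : ∀ Z s t, M Z (ten s t) = Δ (S t) * Z * tenR s := fun Z s t => revLift_ten _ _ s t
  have h8 : ∀ X Y, L (l13 X * l23 Y) = M (N X) Y := fun X Y => by
    refine LinearMap.congr_fun (Ten2.linearMap_ext
      (f := L ∘ₗ LinearMap.mulLeft K (l13 X) ∘ₗ l23.toLinearMap) (g := M (N X)) fun t r' => ?_) Y
    rw [hM]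
    refine LinearMap.congr_fun (Ten2.linearMap_ext
      (f := L ∘ₗ LinearMap.mulRight K (l23 (ten t r')) ∘ₗ l13.toLinearMap)
      (g := LinearMap.mulRight K (tenR t) ∘ₗ LinearMap.mulLeft K (Δ (S r')) ∘ₗ N)
      fun s r => ?_) X
    simp only [LinearMap.comp_apply, LinearMap.mulRight_apply, LinearMap.mulLeft_apply,
      AlgHom.toLinearMap_apply, l13_ten_mul_l23_ten, hL, hN, h.S_mul, map_mul]
    rw [ten_eq]
    simp only [mul_assoc]
  have h9 : M (mapTen S LinearMap.id R * tenL u) R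
      = mapTen S LinearMap.id R * flip (N R) * tenL u :=
    LinearMap.congr_fun (Ten2.linearMap_ext (f := M (mapTen S LinearMap.id R * tenL u))
      (g := LinearMap.mulRight K (tenL u) ∘ₗ LinearMap.mulLeft K (mapTen S LinearMap.id R) ∘ₗ
        flip ∘ₗ N) fun s t => by
        simp only [LinearMap.comp_apply, LinearMap.mulRight_apply, LinearMap.mulLeft_apply, hM, hN,
          flip_mul, flip_tenL]
        rw [← mul_assoc, h.comul_mul_inv, mul_assoc _ (tenL u), (tenL_tenR_commute u s).eq]
        simp only [mul_assoc]) R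
  have h10 : Δ u = M (N R) R := by rw [hu, h7, h.comul_id, h8]
  rw [h10, hNR, h9, hNR, flip_mul, flip_tenL, ten_eq, (tenL_tenR_commute u u).eq]
  simp only [mul_assoc]

end QTri

end Drinfeld

/-! ### `𝔻` is quasitriangular -/

section Quasitriangular

theorem mapTen_flip_mul {H : Type*} [Ring H] [Algebra K H] {S : H →ₗ[K] H}
    (hS : ∀ s t, S (s * t) = S t * S s) (X Y : Ten2 H) :
    mapTen S S (flip (X * Y)) = mapTen S S (flip Y) * mapTen S S (flip X) :=
  bilin_ext (F := (LinearMap.mul K (Ten2 H)).compr₂ (mapTen S S ∘ₗ flip))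
    (G := ((LinearMap.mul K (Ten2 H)).compl₁₂ (mapTen S S ∘ₗ flip) (mapTen S S ∘ₗ flip)).flip)
    (fun s r t r' => by
      simp only [LinearMap.compr₂_apply, LinearMap.compl₁₂_apply, LinearMap.mul_apply',
        LinearMap.comp_apply, LinearMap.flip_apply, flip_ten, mapTen_ten, ten_mul_ten, hS]) X Y

theorem comulD_Ainv : comulD (hexp (eps • a)) = tenL (hexp (eps • a)) * tenR (hexp (eps • a)) :=
  comulD_hexp (by simp only [map_smul, comulD_a, smul_add])

theorem comulD_Binv : comulD (hexp b) = tenL (hexp b) * tenR (hexp b) :=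
  comulD_hexp comulD_b

theorem comul_antipode_eq (d : D) :
    comulD (antipodeD d) = mapTen antipodeD antipodeD (flip (comulD d)) := by
  have key : ∀ g : D, comulD (antipodeD g) = mapTen antipodeD antipodeD (flip (comulD g)) →
      ∀ d : D, comulD (antipodeD d) = mapTen antipodeD antipodeD (flip (comulD d)) →
      comulD (antipodeD (g * d)) = mapTen antipodeD antipodeD (flip (comulD (g * d))) := by
    intro g hg d hd
    rw [antipodeD_mul, map_mul, map_mul, mapTen_flip_mul antipodeD_mul, hg, hd]
  refine LinearMap.congr_fun (linearMap_ext_D (f := comulD.toLinearMap ∘ₗ antipodeD)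
    (g := mapTen antipodeD antipodeD ∘ₗ flip ∘ₗ comulD.toLinearMap) ?_ (fun d => key y ?_ d)
    (fun d => key b ?_ d) (fun d => key a ?_ d) (fun d => key x ?_ d)) d
  · simp only [LinearMap.comp_apply, AlgHom.toLinearMap_apply, antipodeD_one, map_one, flip_one]
    rw [← ten_one_one, mapTen_ten, antipodeD_one]
  · rw [antipodeD_y, map_neg, map_mul, comulD_y, comulD_Binv, ← ten_eq, ← ten_eq, tenR_apply,
      add_mul, ten_mul_ten, ten_mul_ten, map_add, map_add, flip_ten, flip_ten, mapTen_ten,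
      mapTen_ten, antipodeD_one, antipodeD_y, antipodeD_B, B_mul_Binv, one_mul]
    simp only [ten_eq, map_neg, mul_neg, map_one, mul_one]
    abel
  · rw [antipodeD_b, map_neg, comulD_b, tenL_apply, tenR_apply, map_add, map_add, flip_ten,
      flip_ten, mapTen_ten, mapTen_ten, antipodeD_one, antipodeD_b]
    simp only [ten_eq, map_neg, mul_neg, map_one, mul_one, one_mul]
    abel
  · rw [antipodeD_a, map_neg, comulD_a, tenL_apply, tenR_apply, map_add, map_add, flip_ten,
      flip_ten, mapTen_ten, mapTen_ten, antipodeD_one, antipodeD_a]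
    simp only [ten_eq, map_neg, mul_neg, map_one, mul_one, one_mul]
    abel
  · rw [antipodeD_x, map_neg, map_mul, comulD_x, comulD_Ainv, ← ten_eq, ← ten_eq, tenR_apply,
      add_mul, ten_mul_ten, ten_mul_ten, map_add, map_add, flip_ten, flip_ten, mapTen_ten,
      mapTen_ten, antipodeD_one, antipodeD_x, antipodeD_A, A_mul_Ainv, one_mul]
    simp only [ten_eq, map_neg, mul_neg, map_one, mul_one]
    abel

theorem map_Rmatrix_eq_one {T : Type*} [Ring T] [Algebra K T] {f : Ten2 D →ₗ[K] Compl T}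
    (h1 : f 1 = 1) (h0 : ∀ m n, m + n ≠ 0 → f (ten (y ^ m * b ^ n) (a ^ n * x ^ m)) = 0) :
    f Rmatrix = 1 := by
  have h2 : ∀ k, f (∑ p ∈ antidiagonal (k + 1), (Ring.inverse (qFact p.1) * rat (1 / (p.2 ! : ℚ)))
      • ten (y ^ p.1 * b ^ p.2) (a ^ p.2 * x ^ p.1)) = 0 := fun k => by
    rw [map_sum]
    refine Finset.sum_eq_zero fun p hp => ?_
    rw [map_smul, h0 p.1 p.2 (by rw [Finset.HasAntidiagonal.mem_antidiagonal.1 hp]; omega), smul_zero]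
  rw [Rmatrix, hsum_succ, map_add, map_smul, map_hsum]
  simp only [h2]
  have h3 : hsum (fun _ => (0 : Compl T)) = 0 :=
    (IsHSum.eq_hsum fun n => ⟨0, by simp⟩).symm
  simp [h3, qFact, rat_one, ten_one_one, h1]

theorem counit_left_Rmatrix : mulD (unitCounit counitD) LinearMap.id Rmatrix = 1 := by
  refine map_Rmatrix_eq_one ?_ fun m n h => ?_
  · rw [← ten_one_one, mulD_ten, unitCounit_apply]
    simp
  · rw [mulD_ten, unitCounit_apply, map_mul, map_pow, map_pow, counitD_y, counitD_b, ← pow_add,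
      zero_pow h, map_zero, zero_mul]

theorem counit_right_Rmatrix : mulD LinearMap.id (unitCounit counitD) Rmatrix = 1 := by
  refine map_Rmatrix_eq_one ?_ fun m n h => ?_
  · rw [← ten_one_one, mulD_ten, unitCounit_apply]
    simp
  · rw [mulD_ten, unitCounit_apply, map_mul counitD, map_pow, map_pow, counitD_a, counitD_x, ← pow_add,
      add_comm n, zero_pow h, map_zero, mul_zero]

theorem qtriD : QTri comulD counitD antipodeD Rmatrix where
  S_one := antipodeD_one
  S_mul := antipodeD_mul
  antipode_comul := antipode_comulD
  comul_antipode := comul_antipodeD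
  comul_S := comul_antipode_eq
  counit_left := counit_left_Rmatrix
  counit_right := counit_right_Rmatrix
  comul_id := comulId_Rmatrix
  id_comul := idComul_Rmatrix
  comul_op := comul_op_Rmatrix

/-- The universal `R`-matrix of `𝔻` as a unit. -/
def RD : (Ten2 D)ˣ where
  val := Rmatrix
  inv := mapTen antipodeD LinearMap.id Rmatrix
  val_inv := qtriD.mul_inv
  inv_val := qtriD.inv_mul

theorem isQuasitriangular_RD : IsQuasitriangular hopfD RD where
  comul_id := by
    rw [leg13_eq, leg23_eq]
    exact (comulId_apply comulD Rmatrix).trans comulId_Rmatrix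
  id_comul := by
    rw [leg13_eq, leg12_eq]
    exact (idComul_apply comulD Rmatrix).trans idComul_Rmatrix
  comul_op := comul_op_Rmatrix

/-- The Drinfeld element of `𝔻`. -/
def uD : D := mulD antipodeD LinearMap.id (flip Rmatrix)

theorem isDrinfeldElement_uD : IsDrinfeldElement hopfD RD uD :=
  (mulMap_apply _ _ _).symm

theorem mulD_flip_mul_tenL {H : Type*} [Ring H] [Algebra K H] [HComplete H] {S : H →ₗ[K] H}
    (hS : ∀ s t, S (s * t) = S t * S s) (h1 : S 1 = 1) (X : Ten2 H) (s : H) :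
    mulD S LinearMap.id (flip (X * tenL s)) = mulD S LinearMap.id (flip X) * s := by
  rw [flip_mul, flip_tenL, tenR_apply, mulD_antipode_mul_ten hS, h1, one_mul]

theorem mulD_flip_mul_tenR {H : Type*} [Ring H] [Algebra K H] [HComplete H] {S : H →ₗ[K] H}
    (hS : ∀ s t, S (s * t) = S t * S s) (X : Ten2 H) (s : H) :
    mulD S LinearMap.id (flip (X * tenR s)) = S s * mulD S LinearMap.id (flip X) := by
  rw [flip_mul, flip_tenR, tenL_apply, mulD_antipode_mul_ten hS, mul_one]

theorem uD_tenL (s : D) : mulD antipodeD LinearMap.id (flip (Rmatrix * tenL s)) = uD * s :=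
  mulD_flip_mul_tenL antipodeD_mul antipodeD_one _ _

theorem uD_tenR (s : D) :
    mulD antipodeD LinearMap.id (flip (Rmatrix * tenR s)) = antipodeD s * uD :=
  mulD_flip_mul_tenR antipodeD_mul _ _

theorem uD_tenL_tenR (s t : D) : mulD antipodeD LinearMap.id (flip (Rmatrix * (tenL s * tenR t)))
    = antipodeD t * (uD * s) := by
  rw [← mul_assoc, mulD_flip_mul_tenR antipodeD_mul, uD_tenL]

theorem uD_b : uD * b = b * uD := by
  have h := qtriD.revLift_comul b
  rw [comulD_b, mul_add, map_add, map_add, uD_tenL, uD_tenR, counitD_b, zero_smul, antipodeD_b,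
    neg_mul] at h
  exact sub_eq_zero.1 (by rw [sub_eq_add_neg, h])

theorem uD_a : uD * a = a * uD := by
  have h := qtriD.revLift_comul a
  rw [comulD_a, mul_add, map_add, map_add, uD_tenL, uD_tenR, counitD_a, zero_smul, antipodeD_a,
    neg_mul] at h
  exact sub_eq_zero.1 (by rw [sub_eq_add_neg, h])

theorem uD_x : uD * x = A * x * hexp (eps • a) * uD := by
  have h := qtriD.revLift_comul x
  rw [comulD_x, mul_add, map_add, map_add, uD_tenR, uD_tenL_tenR, counitD_x, zero_smul,
    antipodeD_x, antipodeD_A, neg_mul] at h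
  have h1 : hexp (eps • a) * (uD * x) = x * hexp (eps • a) * uD := (neg_add_eq_zero.1 h).symm
  calc uD * x = A * (hexp (eps • a) * (uD * x)) := by rw [← mul_assoc, A_mul_Ainv, one_mul]
    _ = _ := by rw [h1]; simp only [mul_assoc]

theorem uD_y : uD * y = B * y * hexp b * uD := by
  have h := qtriD.revLift_comul y
  rw [comulD_y, mul_add, map_add, map_add, uD_tenR, uD_tenL_tenR, counitD_y, zero_smul,
    antipodeD_y, antipodeD_B, neg_mul] at h
  have h1 : hexp b * (uD * y) = y * hexp b * uD := (neg_add_eq_zero.1 h).symm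
  calc uD * y = B * (hexp b * (uD * y)) := by rw [← mul_assoc, B_mul_Binv, one_mul]
    _ = _ := by rw [h1]; simp only [mul_assoc]

theorem antipodeD_Ainv : antipodeD (hexp (eps • a)) = A := by
  rw [antipodeD_hexp, map_smul, antipodeD_a, smul_neg, A]

theorem antipodeD_Binv : antipodeD (hexp b) = B := by
  rw [antipodeD_hexp, antipodeD_b, B]

theorem antipode_sq_x : antipodeD (antipodeD x) = A * x * hexp (eps • a) := by
  rw [antipodeD_x, map_neg, antipodeD_mul, antipodeD_x, antipodeD_Ainv]
  simp only [mul_neg, neg_neg, mul_assoc]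

theorem antipode_sq_y : antipodeD (antipodeD y) = B * y * hexp b := by
  rw [antipodeD_y, map_neg, antipodeD_mul, antipodeD_y, antipodeD_Binv]
  simp only [mul_neg, neg_neg, mul_assoc]

theorem antipode_sq_b : antipodeD (antipodeD b) = b := by
  rw [antipodeD_b, map_neg, antipodeD_b, neg_neg]

theorem antipode_sq_a : antipodeD (antipodeD a) = a := by
  rw [antipodeD_a, map_neg, antipodeD_a, neg_neg]

theorem semiconj_antipode_sq {w : D} (hy : w * y = antipodeD (antipodeD y) * w)
    (hb : w * b = antipodeD (antipodeD b) * w) (ha : w * a = antipodeD (antipodeD a) * w)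
    (hx : w * x = antipodeD (antipodeD x) * w) (d : D) :
    w * d = antipodeD (antipodeD d) * w := by
  have key : ∀ g : D, w * g = antipodeD (antipodeD g) * w → ∀ d : D,
      w * d = antipodeD (antipodeD d) * w →
      w * (g * d) = antipodeD (antipodeD (g * d)) * w := by
    intro g hg d hd
    rw [antipodeD_mul, antipodeD_mul, ← mul_assoc, hg, mul_assoc, hd, mul_assoc]
  exact LinearMap.congr_fun (linearMap_ext_D (f := LinearMap.mulLeft K w)
    (g := LinearMap.mulRight K w ∘ₗ antipodeD ∘ₗ antipodeD)
    (by simp [antipodeD_one]) (key y hy) (key b hb) (key a ha) (key x hx)) d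

theorem uD_mul (d : D) : uD * d = antipodeD (antipodeD d) * uD :=
  semiconj_antipode_sq (by rw [uD_y, antipode_sq_y]) (by rw [uD_b, antipode_sq_b])
    (by rw [uD_a, antipode_sq_a]) (by rw [uD_x, antipode_sq_x]) d

theorem comul_uD : comulD uD
    = mapTen antipodeD LinearMap.id Rmatrix * flip (mapTen antipodeD LinearMap.id Rmatrix) *
      ten uD uD :=
  qtriD.comul_drinfeld rfl uD_mul

end Quasitriangular

/-! ### The Drinfeld element and its antipode -/

section DrinfeldElement

theorem y_pow_semiconj (m : ℕ) : SemiconjBy (y ^ m) (m • 1 + -a) (-a) := by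
  induction m with
  | zero => simp
  | succ m ih =>
    have h1 : (m • 1 + -a) * y = y * ((m + 1) • 1 + -a) := by
      rw [add_mul, neg_mul, dRel_D.ay, mul_add, mul_neg, mul_smul_comm, smul_mul_assoc, mul_one,
        one_mul, add_smul, one_smul]
      abel
    rw [SemiconjBy, pow_succ, mul_assoc, ← h1, ← mul_assoc, ih.eq, mul_assoc]

theorem uD_eq : uD = hsum fun m =>
    qInv m • (antipodeD x ^ m * (y ^ m * (hexp b ^ m * hexp (-(a * b))))) := by
  rw [uD, Rmatrix, ← hsum_hsum fun m n => (Ring.inverse (qFact m) * rat (1 / (n ! : ℚ))) •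
      ten (y ^ m * b ^ n) (a ^ n * x ^ m), map_hsum, map_hsum]
  congr 1
  funext m
  have hc : Commute (m • b) (-(a * b)) :=
    (((dRel_D.ab.symm.mul_right (Commute.refl b)).neg_right).smul_left m)
  have hab : Commute (m • 1 + -a) b :=
    ((Commute.one_left b).smul_left m).add_left dRel_D.ab.neg_left
  rw [← hexp_nsmul, ← hexp_add hc, map_hsum, map_hsum, hexp, mul_hsum, mul_hsum, smul_hsum]
  congr 1
  funext n
  have h1 : m • b + -(a * b) = (m • 1 + -a) * b := by
    rw [add_mul, smul_mul_assoc, one_mul, neg_mul]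
  rw [map_smul, map_smul, flip_ten, mulD_ten, antipodeD_mul, antipodeD_pow, antipodeD_pow,
    antipodeD_a, h1, hab.mul_pow, mul_smul_comm, mul_smul_comm, smul_smul, qInv, LinearMap.id_apply,
    mul_assoc, ← mul_assoc (_ ^ n), ← ((y_pow_semiconj m).pow_right n).eq]
  simp only [mul_assoc]

/-- The action of `𝔻` on the vector `yᵏ v` of the Verma module. -/
def vermaEval (k : ℕ) : D →ₗ[K] Verma where
  toFun d := verma d (ve k)
  map_add' s t := by rw [map_add, LinearMap.add_apply]
  map_smul' c s := by rw [map_smul, LinearMap.smul_apply]; rfl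

theorem vermaEval_apply (k : ℕ) (d : D) : vermaEval k d = verma d (ve k) := rfl

theorem verma_mul_ve {s t : D} {j k : ℕ} {c : PolyH} (h : verma t (ve j) = c • ve k) :
    verma (s * t) (ve j) = c • verma s (ve k) := by
  rw [map_mul, Module.End.mul_apply, h, map_smul]

theorem verma_mul_y_ve (d : D) (k : ℕ) : verma (d * y) (ve k) = verma d (ve (k + 1)) := by
  rw [map_mul, Module.End.mul_apply, verma_y_ve]

theorem smul_ve_injective {k : ℕ} {c c' : PolyH} (h : c • ve k = c' • ve k) : c = c' := by
  simpa [ve] using congrFun h k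

theorem isHSum_smul_ve {c : ℕ → PolyH} {s : PolyH} (h : IsHSum c s) (k : ℕ) :
    IsHSum (fun n => c n • ve k) (s • ve k) :=
  h.map ((LinearMap.toSpanSingleton PolyH Verma (ve k)).restrictScalars K)

theorem exists_verma_hexp_ve {w : D} {k : ℕ} {c : PolyH} (h : verma w (ve k) = c • ve k) :
    ∃ c' : PolyH, verma (hexp w) (ve k) = c' • ve k := by
  obtain ⟨s, hs⟩ := HComplete.exists_sum fun n => rat (1 / (n ! : ℚ)) • c ^ n
  refine ⟨s, ((isHSum_hsum _).map (vermaEval k)).unique ?_⟩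
  convert isHSum_smul_ve hs k using 1
  funext n
  rw [map_smul, vermaEval_apply, verma_pow_ve h, smul_assoc]

theorem antipode_uD_commute_b : Commute (antipodeD uD) b := by
  have h := congrArg antipodeD uD_b
  rw [antipodeD_mul, antipodeD_mul, antipodeD_b, neg_mul, mul_neg] at h
  exact (neg_injective h).symm

theorem antipode_uD_commute_a : Commute (antipodeD uD) a := by
  have h := congrArg antipodeD uD_a
  rw [antipodeD_mul, antipodeD_mul, antipodeD_a, neg_mul, mul_neg] at h
  exact (neg_injective h).symm

theorem antipode_sq_y' : antipodeD (antipodeD y) = q • y := by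
  rw [antipode_sq_y, B, dRel_D.B_y, smul_mul_assoc, mul_assoc, hexp_neg_mul_hexp, mul_one]

theorem q_isUnit : IsUnit q := by
  rw [PowerSeries.isUnit_iff_constantCoeff, constantCoeff_q]
  exact isUnit_one

theorem uD_y' : uD * y = q • (y * uD) := by rw [uD_mul, antipode_sq_y', smul_mul_assoc]

theorem antipode_uD_y : q • (antipodeD uD * y) = y * antipodeD uD := by
  have h := congrArg antipodeD uD_y'
  rw [antipodeD_mul, map_smul, antipodeD_mul, antipodeD_y] at h
  have hc : Commute (antipodeD uD) (hexp b) := (hexp_commute antipode_uD_commute_b.symm).symm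
  have h2 : y * antipodeD uD * hexp b = q • (antipodeD uD * y) * hexp b := by
    rw [mul_assoc, hc.eq, ← mul_assoc, smul_mul_assoc, mul_assoc _ y]
    simpa only [neg_mul, mul_neg, smul_neg, neg_inj] using h
  have h3 := congrArg (· * B) h2
  simp only [mul_assoc, Binv_mul_B, mul_one] at h3
  exact h3.symm

theorem AB_eq : A * B = hexp (-(eps • a) + -b) := dRel_D.hexp_AB.symm

theorem verma_antipode_uD : verma (antipodeD uD) (ve 0) = verma (hexp (-(a * b))) (ve 0) := by
  have hG : antipodeD (hexp (-(a * b))) = hexp (-(a * b)) := by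
    rw [antipodeD_hexp, map_neg, antipodeD_mul, antipodeD_a, antipodeD_b, neg_mul_neg,
      dRel_D.ab.eq]
  obtain ⟨α, hα⟩ := exists_verma_hexp_ve (w := eps • a) (k := 0) (c := eps • va 0) (by
    rw [map_smul, LinearMap.smul_apply, verma_a_ve, smul_assoc])
  have hx : verma (antipodeD (antipodeD x)) (ve 0) = 0 := by
    rw [antipode_sq_x, verma_mul_ve hα, map_mul, Module.End.mul_apply, verma_x_ve, vd]
    simp
  rw [uD_eq, hsum_succ, map_add, map_smul antipodeD hbar, map_hsum]
  have h0 : vermaEval 0 (hsum fun m => antipodeD (qInv (m + 1) • (antipodeD x ^ (m + 1) *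
      (y ^ (m + 1) * (hexp b ^ (m + 1) * hexp (-(a * b))))))) = 0 := by
    refine ((isHSum_hsum _).map (vermaEval 0)).unique fun n => ⟨0, ?_⟩
    rw [smul_zero, add_zero]
    refine (Finset.sum_eq_zero fun k _ => ?_).symm
    beta_reduce
    rw [map_smul, map_smul, antipodeD_mul, antipodeD_pow, vermaEval_apply,
      pow_succ (antipodeD (antipodeD x)), ← mul_assoc,
      map_mul, Module.End.mul_apply, hx, map_zero, smul_zero, smul_zero]
  rw [map_add, LinearMap.add_apply, verma_hbar_smul, ← vermaEval_apply 0 (hsum _), h0]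
  simp [qInv_zero, hG]

/-- The partial sums of a series whose terms satisfy a two-term recursion, by telescoping. -/
theorem telescope {R : Type*} [CommRing R] {t r h : R} {c : ℕ → R}
    (h0 : c 0 = 1) (hc : ∀ m, r ^ (m + 1) * t * (h * c (m + 1)) = (r ^ m * t - 1) * c m) (n : ℕ) :
    t = ∑ m ∈ Finset.range n, h ^ m * c m + h ^ n * (r ^ n * t * c n) := by
  induction n with
  | zero => simp [h0]
  | succ n ih =>
    have h1 : h ^ (n + 1) * (r ^ (n + 1) * t * c (n + 1)) = h ^ n * ((r ^ n * t - 1) * c n) := by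
      rw [← hc]
      ring
    rw [Finset.sum_range_succ, h1]
    nth_rewrite 1 [ih]
    ring

theorem verma_uD : verma uD (ve 0) = verma (A * B * antipodeD uD) (ve 0) := by
  have hea : ∀ k, verma (eps • a) (ve k) = (eps • va k) • ve k := fun k => by
    rw [map_smul, LinearMap.smul_apply, verma_a_ve, smul_assoc]
  choose α hα using fun k => exists_verma_hexp_ve (hea k)
  choose t ht using fun k => exists_verma_hexp_ve (w := -(eps • a) + -b) (k := k)
    (c := -(eps • va k) + -vb k) (by
      rw [map_add, map_neg, map_neg, LinearMap.add_apply, LinearMap.neg_apply, LinearMap.neg_apply,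
        hea, verma_b_ve, add_smul, neg_smul, neg_smul])
  obtain ⟨β, hβ⟩ := exists_verma_hexp_ve (verma_b_ve 0)
  obtain ⟨g, hg⟩ := exists_verma_hexp_ve (w := -(a * b)) (k := 0) (c := -(vb 0 * va 0)) (by
    rw [map_neg, LinearMap.neg_apply, verma_mul_ve (verma_b_ve 0), verma_a_ve, smul_smul]
    exact (neg_smul _ _).symm)
  have hK : ∀ (r : K) (v : Verma), r • v = algebraMap K PolyH r • v := fun r v =>
    (algebraMap_smul PolyH r v).symm
  set Q := algebraMap K PolyH q with hQ
  set η := algebraMap K PolyH hbar with hη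
  have hα' : ∀ k, α k = Q * α (k + 1) := fun k => by
    have h := congrArg (fun d => verma d (ve k)) dRel_D.y_Ainv
    simp only [map_smul, LinearMap.smul_apply] at h
    rw [verma_mul_ve (hα k), verma_mul_y_ve, verma_y_ve, hα, hK, smul_smul] at h
    exact smul_ve_injective h
  have hα0 : ∀ k, α 0 = Q ^ k * α k := fun k => by
    induction k with
    | zero => simp
    | succ k ih => rw [ih, hα' k]; ring
  have ht' : ∀ k, t (k + 1) = Q ^ 2 * t k := fun k => by
    have h := congrArg (fun d => verma d (ve k)) dRel_D.AB_y
    simp only [map_smul, LinearMap.smul_apply] at h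
    rw [verma_mul_ve (ht k), verma_mul_y_ve, verma_y_ve, ht, hK, smul_smul, map_pow] at h
    exact smul_ve_injective h
  have ht0 : ∀ k, t k = Q ^ (2 * k) * t 0 := fun k => by
    induction k with
    | zero => simp
    | succ k ih => rw [ht', ih]; ring
  have hinv : t 0 * (α 0 * β) = 1 := by
    have h1 : hexp (eps • a) * (hexp b * hexp (-(eps • a) + -b)) = 1 := by
      rw [← mul_assoc, ← hexp_add (dRel_D.ab.smul_left eps), ← neg_add, hexp_mul_hexp_neg]
    have h := congrArg (fun d => verma d (ve 0)) h1
    simp only [map_one, Module.End.one_apply] at h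
    rw [map_mul, Module.End.mul_apply, verma_mul_ve (ht 0), hβ, map_smul, map_smul, hα, smul_smul,
      smul_smul] at h
    have h2 : t 0 * (β * α 0) = 1 := smul_ve_injective (k := 0) (by rw [one_smul, ← mul_assoc, h])
    rw [mul_comm (α 0), h2]
  have hd : ∀ k, η * vd (k + 1) = Q * (η * vd k) + (1 - t k) := fun k => by
    have h := congrArg (fun d => verma (hbar • d) (ve k)) dRel_D.xy
    simp only [smul_add, hbar_smul_oneSubExpDiv, map_add, map_smul, map_sub, map_one,
      LinearMap.add_apply, LinearMap.sub_apply, LinearMap.smul_apply, Module.End.one_apply, ht,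
      verma_mul_y_ve, verma_x_ve, Nat.add_sub_cancel] at h
    rw [verma_mul_ve (verma_x_ve k), verma_y_ve] at h
    have h3 : vd k • ve (k - 1 + 1) = vd k • ve k := by
      cases k with
      | zero => simp [vd]
      | succ k => rfl
    rw [h3, hK, hK hbar, hK q, smul_smul, smul_smul, smul_smul] at h
    refine smul_ve_injective (k := k) ?_
    rw [add_smul, sub_smul, one_smul, h, mul_left_comm Q, mul_assoc]
  have hvd : ∀ m, η * vd (m + 1) = algebraMap K PolyH (qInt (m + 1)) * (1 - Q ^ m * t 0) := by
    intro m
    induction m with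
    | zero => rw [hd, vd, qInt, Finset.sum_range_one, pow_zero, pow_zero, map_one]; ring
    | succ m ih =>
      rw [hd, ih, ht0 (m + 1), qInt_succ (m + 1)]
      have h1 : Q * algebraMap K PolyH (qInt (m + 1))
          = algebraMap K PolyH (qInt (m + 1)) + Q ^ (m + 1) - 1 := by
        rw [hQ, ← map_mul, ← map_pow, ← map_add, ← qInt_succ, qInt_succ' (m + 1), map_add, map_one]
        ring
      rw [map_add, map_pow, ← hQ]
      linear_combination h1
  let e : ℕ → PolyH := fun m => ∏ i ∈ Finset.range m, -(α (i + 1) * vd (i + 1))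
  have he : ∀ m, verma (antipodeD x ^ m) (ve m) = e m • ve 0 := fun m => by
    induction m with
    | zero => simp [e]
    | succ m ih =>
      have h1 : verma (antipodeD x) (ve (m + 1)) = (-(α (m + 1) * vd (m + 1))) • ve m := by
        rw [antipodeD_x, map_neg, LinearMap.neg_apply, verma_mul_ve (hα _), verma_x_ve, smul_smul,
          Nat.add_sub_cancel]
        exact (neg_smul _ _).symm
      rw [pow_succ, verma_mul_ve h1, ih, smul_smul, mul_comm]
      simp only [e, Finset.prod_range_succ]
  let c : ℕ → PolyH := fun m => algebraMap K PolyH (qInv m) * (β ^ m * e m)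
  have hc : ∀ m, Q ^ (m + 1) * t 0 * (η * c (m + 1)) = (Q ^ m * t 0 - 1) * c m := fun m => by
    have h1 := congrArg (algebraMap K PolyH) (qInt_mul_qInv m)
    rw [map_mul] at h1
    simp only [c, e, Finset.prod_range_succ, ← h1]
    have h2 := hα0 (m + 1)
    rw [h2] at hinv
    linear_combination (-(algebraMap K PolyH (qInv (m + 1))) * β ^ m * e m *
      (t 0 * (Q ^ (m + 1) * α (m + 1) * β))) * hvd m - (algebraMap K PolyH (qInv (m + 1))) * β ^ m *
      e m * algebraMap K PolyH (qInt (m + 1)) * (1 - Q ^ m * t 0) * hinv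
  have hsum_c : IsHSum c (t 0) := fun n => ⟨Q ^ n * t 0 * c n, by
    simp only [Algebra.smul_def, map_pow, ← hη]
    exact telescope (by simp [c, e, qInv_zero]) hc n⟩
  have hu : verma uD (ve 0) = (g * t 0) • ve 0 := by
    rw [uD_eq]
    refine ((isHSum_hsum _).map (vermaEval 0)).unique ?_
    have h3 := (isHSum_smul_ve hsum_c 0).map ((LinearMap.lsmul PolyH Verma g).restrictScalars K)
    rw [mul_smul]
    refine Eq.mp (congrArg (IsHSum · _) (funext fun m => ?_)) h3
    have h1 : verma (antipodeD x ^ m * (y ^ m * (hexp b ^ m * hexp (-(a * b))))) (ve 0)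
        = (g * (β ^ m * e m)) • ve 0 := by
      rw [← mul_assoc, ← mul_assoc, verma_mul_ve hg, verma_mul_ve (verma_pow_ve hβ m), map_mul,
        Module.End.mul_apply, verma_y_pow_ve, zero_add, he, smul_smul, smul_smul, mul_assoc]
    have h2 : g • (c m • ve 0) = (g * c m) • ve 0 := smul_smul _ _ _
    have h4 : vermaEval 0 (qInv m • (antipodeD x ^ m * (y ^ m * (hexp b ^ m * hexp (-(a * b))))))
        = (g * c m) • ve 0 := by
      rw [map_smul, vermaEval_apply, h1, hK, smul_smul, mul_left_comm]
    exact h2.trans h4.symm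
  rw [hu, map_mul, Module.End.mul_apply, verma_antipode_uD, hg, map_smul, AB_eq, ht, smul_smul]

theorem uD_eq_AB_mul : uD = A * B * antipodeD uD := by
  have h1 : A * B * antipodeD uD * y = q • (y * (A * B * antipodeD uD)) := by
    have h2 : q • (A * B * antipodeD uD * y) = q • q • (y * (A * B * antipodeD uD)) := by
      rw [mul_assoc, ← mul_smul_comm, antipode_uD_y, ← mul_assoc, AB_eq, dRel_D.AB_y,
        smul_mul_assoc, sq, mul_smul, mul_assoc]
    exact (q_isUnit.smul_left_cancel).1 h2
  have hw : (uD - A * B * antipodeD uD) * y = q • (y * (uD - A * B * antipodeD uD)) := by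
    rw [sub_mul, h1, uD_y', mul_sub, smul_sub]
  refine sub_eq_zero.1 (verma_faithful fun n => ?_)
  induction n with
  | zero => rw [map_sub, LinearMap.sub_apply, verma_uD, sub_self]
  | succ n ih =>
    rw [← verma_mul_y_ve, hw, map_smul, LinearMap.smul_apply, map_mul, Module.End.mul_apply, ih,
      map_zero, smul_zero]

end DrinfeldElement

/-! ### The spinner and the ribbon element -/

section Ribbon

theorem isPosSqrt_unique {H : Type*} [Ring H] [Algebra K H] [HSep H] {s s' t : H}
    (hs : IsPosSqrt s t) (hs' : IsPosSqrt s' t) : s = s' := by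
  obtain ⟨hs, c, hc⟩ := hs
  obtain ⟨hs', c', hc'⟩ := hs'
  have h2 : (2 : ℕ) • (s - s') = -(hbar • (c * (s - s') + (s - s') * c')) := by
    have h3 : s * (s - s') + (s - s') * s' = 0 := by
      rw [mul_sub, sub_mul, ← sq, ← sq, hs, hs']
      abel
    have h4 : s * (s - s') + (s - s') * s'
        = (2 : ℕ) • (s - s') + hbar • (c * (s - s') + (s - s') * c') := by
      nth_rewrite 1 [hc]
      nth_rewrite 3 [hc']
      rw [add_mul, mul_add, one_mul, mul_one, smul_mul_assoc, mul_smul_comm, smul_add, two_nsmul]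
      abel
    exact eq_neg_of_add_eq_zero_left (h4.symm.trans h3)
  have h5 : s - s' = hbar • -(rat (1 / 2) • (c * (s - s') + (s - s') * c')) := by
    have h6 : rat (1 / 2) • (2 : ℕ) • (s - s') = s - s' := by
      rw [two_nsmul, smul_add, ← add_smul, ← rat_add]
      norm_num [rat_one]
    nth_rewrite 1 [← h6, h2]
    rw [smul_neg, smul_neg, smul_comm]
  refine sub_eq_zero.1 (HSep.eq_zero _ fun n => ?_)
  induction n with
  | zero => exact ⟨s - s', by simp⟩
  | succ n ih =>
    obtain ⟨r, hr⟩ := ih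
    refine ⟨-(rat (1 / 2) • (c * r + r * c')), ?_⟩
    rw [h5, hr, pow_succ', mul_smul, mul_smul_comm, smul_mul_assoc, ← smul_add, smul_comm (rat _),
      ← smul_neg]

/-- The logarithm of the spinner, divided by `ħ`. -/
def wD : D := rat (1 / 2) • (-(eps • a) + -b)

theorem rat_half_smul {M : Type*} [AddCommGroup M] [Module K M] (m : M) :
    rat (1 / 2) • (m + m) = m := by
  rw [smul_add, ← add_smul, ← rat_add]
  norm_num [rat_one]

theorem hexp_wD_mul_self : hexp wD * hexp wD = A * B := by
  rw [← hexp_add (Commute.refl wD), wD, ← smul_add, rat_half_smul, AB_eq]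

/-- The spinner of `𝔻`. -/
def CD : Dˣ where
  val := hexp wD
  inv := hexp (-wD)
  val_inv := hexp_mul_hexp_neg _
  inv_val := hexp_neg_mul_hexp _

theorem wD_commute {d : D} (ha : Commute d a) (hb : Commute d b) : Commute wD d :=
  (((ha.symm.smul_left eps).neg_left).add_left hb.symm.neg_left).smul_left _

theorem comulD_wD : comulD wD = tenL wD + tenR wD := by
  simp only [wD, map_smul, map_add, map_neg, comulD_a, comulD_b, smul_add, smul_neg, neg_add]
  abel

theorem counitD_wD : counitD wD = 0 := by simp [wD, counitD_a, counitD_b]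

theorem antipodeD_wD : antipodeD wD = -wD := by
  simp only [wD, map_smul, map_add, map_neg, antipodeD_a, antipodeD_b, smul_add, smul_neg, neg_add,
    neg_neg]

theorem wD_mul_y : wD * y = y * wD + eps • y := by
  have h : (-(eps • a) + -b) * y = y * (-(eps • a) + -b) + (eps • y + eps • y) := by
    rw [add_mul, neg_mul, neg_mul, smul_mul_assoc, dRel_D.ay, dRel_D.by', mul_add, mul_neg, mul_neg,
      mul_smul_comm, smul_sub]
    abel
  rw [wD, smul_mul_assoc, h, smul_add, rat_half_smul, mul_smul_comm]

theorem neg_wD_mul_x : -wD * x = x * -wD + eps • x := by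
  have h : (-(eps • a) + -b) * x = x * (-(eps • a) + -b) - (eps • x + eps • x) := by
    rw [add_mul, neg_mul, neg_mul, smul_mul_assoc, dRel_D.ax, dRel_D.bx, mul_add, mul_neg, mul_neg,
      mul_smul_comm, smul_add]
    abel
  rw [wD, neg_mul, smul_mul_assoc, h, smul_sub, rat_half_smul, mul_neg, mul_smul_comm]
  abel

theorem hexp_wD_mul (d : D) : hexp wD * d = antipodeD (antipodeD d) * hexp wD := by
  refine semiconj_antipode_sq ?_ ?_ ?_ ?_ d
  · rw [hexp_mul_eq_q_smul wD_mul_y, antipode_sq_y', smul_mul_assoc]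
  · rw [antipode_sq_b]
    exact hexp_commute (wD_commute dRel_D.ab.symm (Commute.refl b))
  · rw [antipode_sq_a]
    exact hexp_commute (wD_commute (Commute.refl a) dRel_D.ab)
  · have h1 := mul_hexp_neg_eq_q_smul neg_wD_mul_x
    rw [neg_neg] at h1
    have h2 : q • antipodeD (antipodeD x) = x := by
      rw [antipode_sq_x, ← smul_mul_assoc, A, ← dRel_D.x_A, mul_assoc, hexp_neg_mul_hexp, mul_one]
    refine (q_isUnit.smul_left_cancel).1 ?_
    rw [← h1, ← smul_mul_assoc, h2]

theorem hexp_wD_commute_antipode_uD : Commute (hexp wD) (antipodeD uD) :=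
  hexp_commute (wD_commute antipode_uD_commute_a antipode_uD_commute_b)

theorem hexp_neg_wD_mul_uD : hexp (-wD) * uD = antipodeD uD * hexp wD := by
  nth_rewrite 1 [uD_eq_AB_mul]
  rw [← hexp_wD_mul_self, mul_assoc, ← mul_assoc, hexp_neg_mul_hexp, one_mul,
    hexp_wD_commute_antipode_uD.eq]

theorem counitD_uD : counitD uD = 1 := by
  rw [uD_eq, hsum_succ, map_add, map_smul counitD hbar]
  have h0 : counitD (hsum fun m => qInv (m + 1) • (antipodeD x ^ (m + 1) *
      (y ^ (m + 1) * (hexp b ^ (m + 1) * hexp (-(a * b)))))) = 0 := by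
    refine ((isHSum_hsum _).map counitD.toLinearMap).unique fun n => ⟨0, ?_⟩
    simp [counitD_y]
  rw [h0]
  simp only [qInv_zero, pow_zero, one_mul, one_smul, smul_zero, add_zero]
  exact map_hexp_eq_one _ (by simp [counitD_a])

theorem isPosSqrt_CD : IsPosSqrt (CD : D) (A * B) :=
  ⟨by rw [sq]; exact hexp_wD_mul_self, exists_hexp_eq _⟩

theorem isSpinner_CD : IsSpinner hopfD uD CD where
  drinfeld := hexp_neg_wD_mul_uD
  counit := map_hexp_eq_one _ counitD_wD
  comul := by
    rw [ten_eq]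
    exact comulD_hexp comulD_wD
  antipode := by
    show antipodeD (hexp wD) = hexp (-wD)
    rw [antipodeD_hexp, antipodeD_wD]
  conj d := by
    show hexp wD * d * hexp (-wD) = antipodeD (antipodeD d)
    rw [hexp_wD_mul, mul_assoc, hexp_mul_hexp_neg, mul_one]

theorem comulD_hexp_neg_wD : comulD (hexp (-wD)) = ten (hexp (-wD)) (hexp (-wD)) := by
  rw [ten_eq]
  exact comulD_hexp (by rw [map_neg, map_neg, map_neg, comulD_wD, neg_add])

theorem ten_hexp_neg_wD_commute : Commute (ten (hexp (-wD)) (hexp (-wD)))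
    (mapTen antipodeD LinearMap.id Rmatrix) := by
  have h := qtriD.comul_mul_inv (hexp (-wD))
  rwa [comulD_hexp_neg_wD, flip_ten] at h

theorem isRibbonElement_vD : IsRibbonElement hopfD RD uD (((CD⁻¹ : Dˣ) : D) * uD) where
  central d := by
    show hexp (-wD) * uD * d = d * (hexp (-wD) * uD)
    have h : hexp (-wD) * antipodeD (antipodeD d) = d * hexp (-wD) := by
      have h1 := congrArg (fun r => hexp (-wD) * r * hexp (-wD)) (hexp_wD_mul d)
      simp only [mul_assoc, hexp_mul_hexp_neg, mul_one] at h1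
      rw [← h1, ← mul_assoc, hexp_neg_mul_hexp, one_mul]
    rw [mul_assoc, uD_mul, ← mul_assoc, h, mul_assoc]
  sq := by
    show (hexp (-wD) * uD) ^ 2 = uD * antipodeD uD
    have h : Commute (hexp (-wD)) uD := hexp_commute (wD_commute uD_a uD_b).neg_left
    rw [sq]
    nth_rewrite 2 [hexp_neg_wD_mul_uD]
    rw [h.eq, ← hexp_wD_commute_antipode_uD.eq, mul_assoc, ← mul_assoc (hexp (-wD)),
      hexp_neg_mul_hexp, one_mul]
  comul := by
    show comulD (hexp (-wD) * uD) = mapTen antipodeD LinearMap.id Rmatrix *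
      flip (mapTen antipodeD LinearMap.id Rmatrix) * ten (hexp (-wD) * uD) (hexp (-wD) * uD)
    have h1 := ten_hexp_neg_wD_commute
    have h2 : Commute (ten (hexp (-wD)) (hexp (-wD)))
        (flip (mapTen antipodeD LinearMap.id Rmatrix)) := by
      have h := congrArg flip h1.eq
      rwa [flip_mul, flip_mul, flip_ten] at h
    rw [map_mul, comul_uD, comulD_hexp_neg_wD, ← mul_assoc, (h1.mul_right h2).eq, mul_assoc,
      ten_mul_ten]
  antipode := by
    show antipodeD (hexp (-wD) * uD) = hexp (-wD) * uD
    rw [antipodeD_mul, antipodeD_hexp, map_neg, antipodeD_wD, neg_neg, hexp_neg_wD_mul_uD]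
  counit := by
    show counitD (hexp (-wD) * uD) = 1
    rw [map_mul, counitD_uD, mul_one]
    exact map_hexp_eq_one _ (by rw [map_neg, counitD_wD, neg_zero])

end Ribbon

end

end QD

theorem theorem4p5 :
    Function.Bijective QD.ordering ∧
    ∃ P : QD.TopHopf QD.D, QD.HasGeneratorFormulas P ∧
    ∃ R : (QD.Ten2 QD.D)ˣ, (R : QD.Ten2 QD.D) = QD.Rmatrix ∧ QD.IsQuasitriangular P R ∧
    ∃ u : QD.D, QD.IsDrinfeldElement P R u ∧ u = QD.A * QD.B * P.antipode u ∧
    ∃ C : QD.Dˣ,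
      (QD.IsPosSqrt (C : QD.D) (QD.A * QD.B) ∧
        ∀ C' : QD.D, QD.IsPosSqrt C' (QD.A * QD.B) → C' = C) ∧
      QD.IsSpinner P u C ∧
      QD.IsRibbonElement P R u (((C⁻¹ : QD.Dˣ) : QD.D) * u) := by
  exact ⟨QD.ordering_bijective, QD.hopfD, QD.hopfD_formulas, QD.RD, rfl, QD.isQuasitriangular_RD,
    QD.uD, QD.isDrinfeldElement_uD, QD.uD_eq_AB_mul, QD.CD,
    ⟨QD.isPosSqrt_CD, fun _ h => QD.isPosSqrt_unique h QD.isPosSqrt_CD⟩, QD.isSpinner_CD,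
    QD.isRibbonElement_vD⟩
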